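/- Let $R$ be a discrete valuation ring with fraction field $K$ of characteristic $0$ and residue field $k$ of characteristic $p>0$. Let $m\ge 1$ be an integer and suppose that $R$ contains a primitive $m$-th root of unity $\zeta$. Let $X$ be a noetherian normal scheme, faithfully flat over $R$, whose generic fibre $X_K$ and special fibre $X_k$ are integral. For a scheme $Z$ write ${}_m\mathrm{Pic}(Z)=\ker(m:\mathrm{Pic}(Z)\to\mathrm{Pic}(Z))$, and suppose that restriction to the generic fibre gives a bijection ${}_m\mathrm{Pic}(X)\to{}_m\mathrm{Pic}(X_K)$. Let $f_K:Y_K\to X_K$ be a $\mathbb Z/m\mathbb Z$-torsor with $Y_K$ connected, let $Y$ be the normalization of $X$ in $Y_K$, and suppose that the special fibre $Y_k$ is reduced. Then there exists a $\mu_m$-torsor $Y'\to X$ which extends $f_K$, that is, a $\mu_m$-torsor together with an $X_K$-isomorphism $Y_K\cong Y'\times_X X_K$ which is compatible with the actions via the isomorphism $(\mathbb Z/m\mathbb Z)_K\cong(\mu_m)_K$, $1\mapsto\zeta$. It is unique: between any two such extensions there is a unique isomorphism of $\mu_m$-torsors over $X$ compatible with the identifications of their generic fibres with $Y_K$. -/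

import Mathlib

open CategoryTheory CategoryTheory.Limits AlgebraicGeometry

universe u

noncomputable section

namespace TorsorExt

/-! ### Normal schemes and fibres over a discrete valuation ring -/

/-- A scheme is normal if all its local rings are integrally closed domains. -/
def IsNormalScheme (X : Scheme.{u}) : Prop :=
  ∀ x : X, IsDomain (X.presheaf.stalk x) ∧ IsIntegrallyClosed (X.presheaf.stalk x)

section Fibres

variable {R : Type u} [CommRing R] {X : Scheme.{u}}

/-- The base change `X ×_R A` of an `R`-scheme `s : X ⟶ Spec R` to an `R`-algebra `A`.
For `A = Frac R` this is the generic fibre, for `A` the residue field the special fibre. -/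
abbrev baseChange (s : X ⟶ Spec (.of R)) (A : Type u) [CommRing A] [Algebra R A] : Scheme.{u} :=
  pullback s (Spec.map (CommRingCat.ofHom (algebraMap R A)))

/-- The projection `X ×_R A ⟶ X`. -/
abbrev baseChangeFst (s : X ⟶ Spec (.of R)) (A : Type u) [CommRing A] [Algebra R A] :
    baseChange s A ⟶ X :=
  pullback.fst s (Spec.map (CommRingCat.ofHom (algebraMap R A)))

end Fibres

/-! ### The `m`-torsion of the Picard group -/

section Picard

/-- The structure sheaf as a module over itself. -/
abbrev unitModule (X : Scheme.{u}) : X.Modules := SheafOfModules.unit X.ringCatSheaf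

/-- The tensor product of two `𝒪_X`-modules: the sheaf associated with
`U ↦ L(U) ⊗_{𝒪(U)} M(U)`. -/
def tensorModule {X : Scheme.{u}} (L M : X.Modules) : X.Modules :=
  (PresheafOfModules.sheafification (𝟙 X.ringCatSheaf.obj)).obj
    (PresheafOfModules.Monoidal.tensorObj (R := X.presheaf)
      ((Scheme.Modules.toPresheafOfModules X).obj L)
      ((Scheme.Modules.toPresheafOfModules X).obj M))

/-- The tensor power `L^{⊗ m}` of an `𝒪_X`-module. -/
def tensorPower {X : Scheme.{u}} (L : X.Modules) : ℕ → X.Modules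
  | 0 => unitModule X
  | n + 1 => tensorModule (tensorPower L n) L

/-- Invertible `𝒪_X`-modules (line bundles): modules locally isomorphic to `𝒪_X`. -/
def IsInvertibleModule {X : Scheme.{u}} (L : X.Modules) : Prop :=
  ∀ x : X, ∃ U : X.Opens, x ∈ U ∧ Nonempty (L.restrict U.ι ≅ unitModule (U : Scheme.{u}))

/-- Isomorphism classes of `𝒪_X`-modules. -/
abbrev ModuleClass (X : Scheme.{u}) : Type (u + 1) := Quotient (isIsomorphicSetoid X.Modules)

/-- `_m Pic(X) = ker (m : Pic(X) → Pic(X))`: the isomorphism classes of invertible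
modules `L` with `L^{⊗ m} ≅ 𝒪_X`. -/
def picTorsion (m : ℕ) (X : Scheme.{u}) : Set (ModuleClass X) :=
  {c | ∃ L : X.Modules, IsInvertibleModule L ∧ Nonempty (tensorPower L m ≅ unitModule X) ∧
    c = Quotient.mk _ L}

/-- Pullback of modules along a morphism, on isomorphism classes. -/
def pullbackClass {X Y : Scheme.{u}} (f : X ⟶ Y) : ModuleClass Y → ModuleClass X :=
  Quotient.map (Scheme.Modules.pullback f).obj
    (fun _ _ ⟨e⟩ ↦ ⟨(Scheme.Modules.pullback f).mapIso e⟩)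

end Picard

/-! ### Torsors under a finite abstract group -/

/-- A `G`-torsor over `X` for a finite abstract group `G`, that is a torsor under the constant
group scheme: a scheme `Y`, affine, faithfully flat and of finite presentation over `X`,
with an action of `G` by `X`-automorphisms for which
`G × Y ⟶ Y ×_X Y`, `(g, y) ↦ (y, g y)` is an isomorphism. -/
structure ConstTorsor (G : Type) [Group G] [Finite G] (X : Scheme.{u}) where
  total : Scheme.{u}
  proj : total ⟶ X
  affine : IsAffineHom proj
  flat : Flat proj
  surjective : Surjective proj
  finPres : LocallyOfFinitePresentation proj
  act : G →* Aut (Over.mk proj)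
  isIso_shear : IsIso (Sigma.desc (fun g : G ↦
    pullback.lift (f := proj) (g := proj) (𝟙 total) (act g).hom.left
      ((Category.id_comp _).trans (Over.w (act g).hom).symm)))

attribute [instance] ConstTorsor.affine

/-! ### Torsors under a group scheme -/

section GroupScheme

open MonoidalCategory CartesianMonoidalCategory

/-- Let `G` be a group scheme over `S` and `s : X ⟶ S` an `S`-scheme. A `G`-torsor over `X`
(with affine total space, which is automatic for affine `G`): a scheme `Y`, affine, faithfully
flat and locally of finite presentation over `X`, with an action `G ×_S Y ⟶ Y` over `X` for which
`G ×_S Y ⟶ Y ×_X Y`, `(g, y) ↦ (g y, y)` is an isomorphism. -/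
structure Torsor {S : Scheme.{u}} (G : Grp (Over S)) {X : Scheme.{u}} (s : X ⟶ S) where
  total : Scheme.{u}
  proj : total ⟶ X
  affine : IsAffineHom proj
  flat : Flat proj
  surjective : Surjective proj
  finPres : LocallyOfFinitePresentation proj
  act : G.X ⊗ Over.mk (proj ≫ s) ⟶ Over.mk (proj ≫ s)
  one_act : lift (toUnit (Over.mk (proj ≫ s)) ≫ MonObj.one) (𝟙 _) ≫ act = 𝟙 _
  mul_act : (MonObj.mul ▷ Over.mk (proj ≫ s)) ≫ act =
    (α_ G.X G.X (Over.mk (proj ≫ s))).hom ≫ (G.X ◁ act) ≫ act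
  act_proj : act.left ≫ proj = (snd G.X (Over.mk (proj ≫ s))).left ≫ proj
  isIso_shear : IsIso (pullback.lift (f := proj) (g := proj)
    act.left (snd G.X (Over.mk (proj ≫ s))).left act_proj)

variable {S X : Scheme.{u}} {G : Grp (Over S)} {s : X ⟶ S}

/-- The total space of a torsor as a scheme over the base `S` of the group scheme. -/
abbrev Torsor.over (Y : Torsor G s) : Over S := Over.mk (Y.proj ≫ s)

/-- The action `y ↦ g y` of a section `g ∈ G(S)` on the total space of a torsor. -/
def Torsor.translate (Y : Torsor G s) (g : 𝟙_ (Over S) ⟶ G.X) : Y.total ⟶ Y.total :=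
  (lift (toUnit Y.over ≫ g) (𝟙 Y.over) ≫ Y.act).left

/-- A morphism of schemes `e : Y ⟶ Y'` between the total spaces of two `G`-torsors over `X`
is a morphism of torsors if it is an `X`-morphism commuting with the actions of `G`. -/
def IsTorsorHom (Y Y' : Torsor G s) (e : Y.total ⟶ Y'.total) : Prop :=
  ∃ h : e ≫ Y'.proj = Y.proj,
    Y.act ≫ Over.homMk (U := Y.over) (V := Y'.over) e (by simp [← h]) =
      (G.X ◁ Over.homMk (U := Y.over) (V := Y'.over) e (by simp [← h])) ≫ Y'.act

end GroupScheme

/-! ### The group scheme of `m`-th roots of unity -/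

section RootsOfUnity

open MonoidalCategory

/-- The group scheme `μ_m = Spec R[ℤ/m] = Spec R[T]/(T^m - 1)` over `R`, with comultiplication
`T ↦ T ⊗ T`. -/
def muGrp (m : ℕ) (R : Type u) [CommRing R] : Grp (Over (Spec (.of R))) :=
  (hopfSpec (.of R)).obj
    (.op (.of R (MonoidAlgebra R (Multiplicative (ZMod m)))))

/-- The homomorphism `ℤ/m → Rˣ`, `i ↦ ζ^i`, attached to an `m`-th root of unity `ζ`. -/
def zmodPowHom {R : Type u} [CommRing R] {m : ℕ} (ζ : rootsOfUnity m R) :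
    Multiplicative (ZMod m) →* Rˣ :=
  AddMonoidHom.toMultiplicativeLeft (ZMod.lift m
    ⟨zmultiplesHom (Additive Rˣ) (Additive.ofMul (ζ : Rˣ)), by
      have h : (ζ : Rˣ) ^ m = 1 := (mem_rootsOfUnity m _).1 ζ.2
      rw [zmultiplesHom_apply, natCast_zsmul, ← ofMul_pow, h, ofMul_one]⟩)

/-- The section of `μ_m` over `R` given by an `m`-th root of unity `ζ ∈ R`
(`T ↦ ζ` on the Hopf algebra). -/
def muSection {R : Type u} [CommRing R] {m : ℕ} (ζ : rootsOfUnity m R) :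
    𝟙_ (Over (Spec (.of R))) ⟶ (muGrp m R).X :=
  Over.homMk (Spec.map (CommRingCat.ofHom
    (MonoidAlgebra.lift R R (Multiplicative (ZMod m))
      ((Units.coeHom R).comp (zmodPowHom ζ))).toRingHom)) (by
    have h : ∀ f : MonoidAlgebra R (Multiplicative (ZMod m)) →ₐ[R] R,
        CommRingCat.ofHom (algebraMap R (MonoidAlgebra R (Multiplicative (ZMod m)))) ≫
          CommRingCat.ofHom f.toRingHom = 𝟙 (CommRingCat.of R) := fun f ↦ by
      ext x
      exact f.commutes x
    exact (Spec.map_comp _ _).symm.trans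
      ((congrArg Spec.map (h _)).trans (Spec.map_id _)))

end RootsOfUnity

/-! ### Extension of `ℤ/m`-torsors to `μ_m`-torsors -/

section Extension

variable {R : Type u} [CommRing R] {K : Type u} [CommRing K] [Algebra R K] {X : Scheme.{u}}
  {s : X ⟶ Spec (.of R)} {m : ℕ} [NeZero m]

/-- Let `ζ ∈ R` be an `m`-th root of unity. A `μ_m`-torsor `Y' ⟶ X` together with `q : Y ⟶ Y'`
extends the `ℤ/m`-torsor `Y ⟶ X_K` if `q` identifies `Y` with `Y' ×_X X_K` over `X_K`
and the action of `1 ∈ ℤ/m` on `Y` with that of `ζ ∈ μ_m(R)` on `Y'`.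
When `ζ` is primitive and `K` a field, this says that `Y ≅ Y'_K` as torsors under
`(ℤ/m)_K ≅ (μ_m)_K`, `1 ↦ ζ`. -/
structure IsExtension (ζ : rootsOfUnity m R)
    (Y : ConstTorsor (Multiplicative (ZMod m)) (baseChange s K))
    (Y' : Torsor (muGrp m R) s) (q : Y.total ⟶ Y'.total) : Prop where
  isPullback : IsPullback q Y.proj Y'.proj (baseChangeFst s K)
  equivariant : (Y.act (Multiplicative.ofAdd 1)).hom.left ≫ q = q ≫ Y'.translate (muSection ζ)

/-- The normalization of `X` in the total space of a torsor `Y ⟶ X_K`, as an `R`-scheme. -/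
def normalizationHom (Y : ConstTorsor (Multiplicative (ZMod m)) (baseChange s K)) :
    (Y.proj ≫ baseChangeFst s K).normalization ⟶ Spec (.of R) :=
  (Y.proj ≫ baseChangeFst s K).fromNormalization ≫ s

end Extension

end TorsorExt
end

/-! Let `σ` be the action of `1 ∈ ℤ/m` on functions on `Y_K`. Since `K` contains `ζ` and `1/m`,
these functions split into eigenspaces, `b` having degree `i` when `σ b = ζ^i b`. The torsor
condition makes the degree-one part an invertible sheaf on `X_K`, and `t ↦ t^m` trivialises its
`m`-th tensor power. By the Picard hypothesis this sheaf extends to `X`. Hence every point of `X`,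
including those of the special fibre, has a neighbourhood `U` with an invertible function `t` of
degree one over `U_K` (`exists_isUnit_homog_totalAction`).

The heart of the matter is to make `t^m` a unit on `U` itself (`exists_homog_pow_eq`). As the
special fibre is integral, a uniformizer `ϖ` is prime or a unit on `U`, so after scaling `t` by a
power of `ϖ` one has `t^m = ϖ^r u` with `0 ≤ r < m` and `u` a unit on `U`. If `r > 0`, then `t` is
integral over `U` and `t^m` is divisible by `ϖ`. Reducedness of `Y_k` gives `t = ϖ d` with `d`
integral; normality of `X` puts `d^m`, which has degree zero, into `𝒪(U)`; and `u = ϖ^(m-r) d^m`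
forces `ϖ` to be a unit on `U`. In that case `ϖ^r` is absorbed into `u`.

The local torsors `t^m = u` are not glued by cocycles. Instead `Y'` is the relative spectrum of a
canonical algebra: the functions on `Y_K` all of whose homogeneous components are integral over `X`
(`integralAlgebra`, axiomatised by `IsIntegralModel`). Where `t` exists, a component `b` of degree
`i` is `(b t^(-i)) t^i`, and `b t^(-i)` is integral of degree zero, hence a function on `U`. So the
algebra is free on `1, t, …, t^(m-1)`, and its grading is the action of `μ_m`. It can be smaller
than the algebra of the normalization: taking components divides by `m`, which may vanish in the
residue field.

For uniqueness, every extension is an integral model (`IsExtension.isIntegralModel`), so its algebra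
is determined inside the functions on `Y_K`. By flatness, functions on an extension embed into those
on `Y_K`, and evaluating the coaction at the powers of `ζ` identifies its components with the
eigencomponents. A homogeneous function has an `m`-th power coming from `X`, so it is integral;
conversely the isomorphism `G × T ≅ T ×_X T` provides enough functions in each degree to capture
every integral component. The same evaluation at powers of `ζ` shows that isomorphisms of integral
models respect the actions. -/

noncomputable section

namespace TorsorExt

open Opposite TopologicalSpace

/-! ### Sections of tensor products of sheaves of modules. -/

section

variable {X : Scheme.{u}}

/-- A section over `U` which freely generates `M` over every smaller open set. -/
def IsGenerator (M : X.Modules) {U : X.Opens} (s : Γ(M, U)) : Prop :=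
  ∀ (V : X.Opens) (h : V ≤ U),
    Function.Bijective (fun a : Γ(X, V) ↦ a • M.presheaf.map (homOfLE h).op s)

/-- The presheaf tensor product of two sheaves of modules. -/
abbrev tensorPresheaf (L M : X.Modules) : X.PresheafOfModules :=
  PresheafOfModules.Monoidal.tensorObj (R := X.presheaf)
      ((Scheme.Modules.toPresheafOfModules X).obj L)
      ((Scheme.Modules.toPresheafOfModules X).obj M)

/-- The sheafification map to the tensor product. -/
def toTensor (L M : X.Modules) : (tensorPresheaf L M).presheaf ⟶ (tensorModule L M).presheaf :=
  CategoryTheory.toSheafify _ (tensorPresheaf L M).presheaf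

instance (L M : X.Modules) : Presheaf.IsLocallyInjective (Opens.grothendieckTopology X) (toTensor L M) := by
  unfold toTensor
  exact inferInstanceAs (Presheaf.IsLocallyInjective (Opens.grothendieckTopology X) (CategoryTheory.toSheafify _ (tensorPresheaf L M).presheaf))
instance (L M : X.Modules) : Presheaf.IsLocallySurjective (Opens.grothendieckTopology X) (toTensor L M) :=
  inferInstanceAs (Presheaf.IsLocallySurjective (Opens.grothendieckTopology X) (CategoryTheory.toSheafify _ (tensorPresheaf L M).presheaf))

instance (M : X.Modules) (U : X.Opens) : Module Γ(X, U) (((Scheme.Modules.toPresheafOfModules X).obj M).obj (op U)) :=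
  (((Scheme.Modules.toPresheafOfModules X).obj M).obj (op U)).isModule

/-- product of sections -/
def tmul {L M : X.Modules} {U : X.Opens} (s : Γ(L, U)) (t : Γ(M, U)) : Γ(tensorModule L M, U) :=
  (toTensor L M).app (op U) (show (tensorPresheaf L M).obj (op U) from
    TensorProduct.tmul (X.presheaf.obj (op U)) (M := ((Scheme.Modules.toPresheafOfModules X).obj L).obj (op U)) (N := ((Scheme.Modules.toPresheafOfModules X).obj M).obj (op U))  s t)

lemma map_tmul {L M : X.Modules} {U V : X.Opens} (h : V ≤ U) (s : Γ(L, U)) (t : Γ(M, U)) :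
    (tensorModule L M).presheaf.map (homOfLE h).op (tmul s t) =
      tmul (L.presheaf.map (homOfLE h).op s) (M.presheaf.map (homOfLE h).op t) := by
  have := (NatTrans.naturality_apply (toTensor L M) (homOfLE h).op (show (tensorPresheaf L M).obj (op U) from
    TensorProduct.tmul (X.presheaf.obj (op U)) (M := ((Scheme.Modules.toPresheafOfModules X).obj L).obj (op U)) (N := ((Scheme.Modules.toPresheafOfModules X).obj M).obj (op U)) s t))
  exact this.symm

/-- The sheafification map is the unit of the adjunction for presheaves of modules, and that unit is
linear. -/
lemma toTensor_smul {L M : X.Modules} {U : X.Opens} (a : Γ(X, U)) (x : (tensorPresheaf L M).obj (op U)) :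
    (toTensor L M).app (op U) (a • x) = a • (show Γ(tensorModule L M, U) from (toTensor L M).app (op U) x) :=
  ((((PresheafOfModules.sheafificationAdjunction (𝟙 X.ringCatSheaf.obj)).unit.app (tensorPresheaf L M)).app (op U)).hom.map_smul a x)

lemma smul_tmul {L M : X.Modules} {U : X.Opens} (a b : Γ(X, U)) (s : Γ(L, U)) (t : Γ(M, U)) :
   tmul (a • s) (b • t) = (a * b) • tmul s t := by
  unfold tmul
  rw [← toTensor_smul]
  congr 1
  exact TensorProduct.smul_tmul_smul (R := X.presheaf.obj (op U)) (M := ((Scheme.Modules.toPresheafOfModules X).obj L).obj (op U)) (N := ((Scheme.Modules.toPresheafOfModules X).obj M).obj (op U)) a b s t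

end

/-! ### Local generators and invertible modules. -/

section

variable {X : Scheme.{u}}

lemma IsGenerator.res {M : X.Modules} {U V : X.Opens} {s : Γ(M, U)} (hs : IsGenerator M s) (h : V ≤ U) :
    IsGenerator M (M.presheaf.map (homOfLE h).op s) := by
  intro W hW
  have : M.presheaf.map (homOfLE hW).op (M.presheaf.map (homOfLE h).op s) =
    M.presheaf.map (homOfLE (hW.trans h)).op s := by
    rw [← ConcreteCategory.comp_apply, ← Functor.map_comp]; rfl
  simp_rw [this]
  exact hs W _

lemma Modules.section_ext {M : X.Modules} {U : X.Opens} (s t : Γ(M, U))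
    (h : ∀ x ∈ U, ∃ (V : X.Opens) (hV : V ≤ U), x ∈ V ∧
      M.presheaf.map (homOfLE hV).op s = M.presheaf.map (homOfLE hV).op t) : s = t := by
  choose V hV hx he using h
  refine TopCat.Sheaf.eq_of_locally_eq' (⟨M.presheaf, M.isSheaf⟩ : TopCat.Sheaf Ab X)
    (fun x : U ↦ V x.1 x.2) U (fun x ↦ homOfLE (hV x.1 x.2)) ?_ s t fun x ↦ he _ _
  exact fun x hxU ↦ Opens.mem_iSup.mpr ⟨⟨x, hxU⟩, hx _ _⟩

lemma Modules.res_res {M : X.Modules} {U V W : X.Opens} (h : V ≤ U) (h' : W ≤ V) (s : Γ(M, U)) :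
    M.presheaf.map (homOfLE h').op (M.presheaf.map (homOfLE h).op s) =
      M.presheaf.map (homOfLE (h'.trans h)).op s := by
  rw [← ConcreteCategory.comp_apply, ← Functor.map_comp]; rfl

lemma Scheme.res_res {U V W : X.Opens} (h : V ≤ U) (h' : W ≤ V) (s : Γ(X, U)) :
    X.presheaf.map (homOfLE h').op (X.presheaf.map (homOfLE h).op s) =
      X.presheaf.map (homOfLE (h'.trans h)).op s := by
  rw [← ConcreteCategory.comp_apply, ← Functor.map_comp]; rfl

/-- A section which is locally a generator is a generator. -/
lemma isGenerator_of_locally {M : X.Modules} {U : X.Opens} (s : Γ(M, U))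
    (h : ∀ x ∈ U, ∃ (V : X.Opens) (hV : V ≤ U), x ∈ V ∧
      IsGenerator M (M.presheaf.map (homOfLE hV).op s)) : IsGenerator M s := by
  intro W hW
  choose V hV hx hs using h
  constructor
  · intro a b hab
    refine X.sheaf.eq_of_locally_eq' (fun x : W ↦ V x.1 (hW x.2) ⊓ W) W
      (fun x ↦ homOfLE inf_le_right)
      (fun x hxU ↦ Opens.mem_iSup.mpr ⟨⟨x, hxU⟩, hx _ _, hxU⟩) a b fun x ↦ ?_
    apply (hs x.1 (hW x.2) (V x.1 (hW x.2) ⊓ W) inf_le_left).1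
    have := congr(M.presheaf.map (homOfLE (inf_le_right : V x.1 (hW x.2) ⊓ W ≤ W)).op $hab)
    simp only [Scheme.Modules.map_smul, Modules.res_res] at this
    simp only [Modules.res_res]
    exact this
  · intro y
    have hex (x : W) := (hs x.1 (hW x.2) (V x.1 (hW x.2) ⊓ W) inf_le_left).2
      (M.presheaf.map (homOfLE inf_le_right).op y)
    simp only [Modules.res_res] at hex
    choose a ha using hex
    -- The local coefficients agree on overlaps because a generator determines its coefficients
    -- uniquely there.
    obtain ⟨b, hb, -⟩ := X.sheaf.existsUnique_gluing' (fun x : W ↦ V x.1 (hW x.2) ⊓ W) W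
      (fun x ↦ homOfLE inf_le_right)
      (fun x hxU ↦ Opens.mem_iSup.mpr ⟨⟨x, hxU⟩, hx _ _, hxU⟩) a (by
        intro x x'
        apply (hs x.1 (hW x.2) (V x.1 (hW x.2) ⊓ W ⊓ (V x'.1 (hW x'.2) ⊓ W)) (inf_le_left.trans inf_le_left)).1
        have h1 := congr(M.presheaf.map (homOfLE (inf_le_left : V x.1 (hW x.2) ⊓ W ⊓ (V x'.1 (hW x'.2) ⊓ W) ≤ _)).op $(ha x))
        have h2 := congr(M.presheaf.map (homOfLE (inf_le_right : V x.1 (hW x.2) ⊓ W ⊓ (V x'.1 (hW x'.2) ⊓ W) ≤ _)).op $(ha x'))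
        simp only [Scheme.Modules.map_smul, Modules.res_res] at h1 h2
        simp only [Modules.res_res]
        exact h1.trans h2.symm)
    refine ⟨b, Modules.section_ext _ _ fun x hxU ↦ ⟨_, inf_le_right, ⟨hx _ (hW hxU), hxU⟩, ?_⟩⟩
    refine (Scheme.Modules.map_smul M _ b _).trans ?_
    rw [← ha ⟨x, hxU⟩, ← hb ⟨x, hxU⟩, Modules.res_res]
    rfl

lemma IsGenerator.unit_smul {M : X.Modules} {U : X.Opens} {s : Γ(M, U)} (hs : IsGenerator M s)
    (a : Γ(X, U)) (ha : IsUnit a) : IsGenerator M (a • s) := by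
  intro W hW
  simp only [Scheme.Modules.map_smul, smul_smul]
  have hu : IsUnit (X.presheaf.map (homOfLE hW).op a) := ha.map (X.presheaf.map (homOfLE hW).op).hom
  exact (hs W hW).comp (IsUnit.isUnit_iff_mulRight_bijective.mp hu)

lemma IsGenerator.unit_of {M : X.Modules} {U : X.Opens} {s t : Γ(M, U)} (hs : IsGenerator M s)
    (ht : IsGenerator M t) : ∃ a : Γ(X, U), IsUnit a ∧ t = a • s := by
  have h1 := (hs U le_rfl)
  have h2 := (ht U le_rfl)
  have (x : Γ(M, U)) : M.presheaf.map (homOfLE (le_refl U)).op x = x := by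
    have : (homOfLE (le_refl U)).op = 𝟙 (op U) := rfl
    rw [this, M.presheaf.map_id]; rfl
  simp only [this] at h1 h2
  obtain ⟨a, ha⟩ := h1.2 t
  obtain ⟨b, hb⟩ := h2.2 s
  refine ⟨a, .of_mul_eq_one b (h2.1 ?_), ha.symm⟩
  dsimp only at ha hb ⊢
  rw [mul_smul, hb, ha, one_smul]

instance (P : X.PresheafOfModules) (U : X.Opens) : Module Γ(X, U) (P.obj (op U)) :=
  (P.obj (op U)).isModule

/-- Allows generators of a sheafification to be tested on the presheaf. Local injectivity makes
coefficients unique; local surjectivity produces them locally, and uniqueness lets them glue in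
`𝒪_X`. -/
lemma isGenerator_of_presheaf {P : X.PresheafOfModules} {M : X.Modules}
    (φ : P.presheaf ⟶ M.presheaf)
    [Presheaf.IsLocallyInjective (Opens.grothendieckTopology X) φ]
    [Presheaf.IsLocallySurjective (Opens.grothendieckTopology X) φ]
    (hφ : ∀ (U : X.Opens) (a : Γ(X, U)) (x : P.obj (op U)),
      φ.app (op U) (a • x) = HSMul.hSMul (α := Γ(X, U)) (β := Γ(M, U)) a (φ.app (op U) x))
    {U : X.Opens} (z : P.obj (op U))
    (hz : ∀ (V : X.Opens) (hV : V ≤ U), Function.Bijective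
      (fun a : Γ(X, V) ↦ (a • (show P.obj (op V) from P.presheaf.map (homOfLE hV).op z)))) :
    IsGenerator M (show Γ(M, U) from φ.app (op U) z) := by
  have hnat (V W : X.Opens) (h : V ≤ W) (y : P.obj (op W)) :
      (M.presheaf.map (homOfLE h).op (show Γ(M, W) from φ.app (op W) y)) =
        φ.app (op V) (P.presheaf.map (homOfLE h).op y) :=
    (NatTrans.naturality_apply φ (homOfLE h).op y).symm
  have hsm (V W : X.Opens) (h : V ≤ W) (a : Γ(X, W)) (y : P.obj (op W)) :
      P.presheaf.map (homOfLE h).op (a • y) = X.presheaf.map (homOfLE h).op a •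
        (show P.obj (op V) from P.presheaf.map (homOfLE h).op y) := P.map_smul _ _ _
  have hrr {V W W' : X.Opens} (h : V ≤ W) (h' : W' ≤ V) (s : P.obj (op W)) :
      P.presheaf.map (homOfLE h').op (show P.obj (op V) from P.presheaf.map (homOfLE h).op s) =
      P.presheaf.map (homOfLE (h'.trans h)).op s := by
    erw [← ConcreteCategory.comp_apply, ← Functor.map_comp]; rfl
  intro V hV
  -- Injectivity is needed on all smaller opens, because gluing coefficients uses it on overlaps.
  have hinj (W : X.Opens) (hW : W ≤ U) : Function.Injective (fun a : Γ(X, W) ↦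
      a • M.presheaf.map (homOfLE hW).op (show Γ(M, U) from φ.app (op U) z)) := by
    intro a b hab
    replace hab : φ.app (op W) (a • (show P.obj (op W) from P.presheaf.map (homOfLE hW).op z)) =
        φ.app (op W) (b • (show P.obj (op W) from P.presheaf.map (homOfLE hW).op z)) := by
      rw [hφ, hφ]
      have := hnat W U hW z
      dsimp only at hab this ⊢
      rwa [this] at hab
    have hmem := Presheaf.equalizerSieve_mem (Opens.grothendieckTopology X) φ _ _ hab
    choose W' f hf hx using hmem
    refine X.sheaf.eq_of_locally_eq' (fun x : W ↦ W' x.1 x.2) W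
      (fun x ↦ f x.1 x.2) (fun x hxU ↦ Opens.mem_iSup.mpr ⟨⟨x, hxU⟩, hx _ _⟩) a b fun x ↦ ?_
    have h3 : P.presheaf.map (homOfLE (f x.1 x.2).le).op
          (a • (show P.obj (op W) from P.presheaf.map (homOfLE hW).op z)) =
        P.presheaf.map (homOfLE (f x.1 x.2).le).op
          (b • (show P.obj (op W) from P.presheaf.map (homOfLE hW).op z)) := hf x.1 x.2
    apply (hz _ ((f x.1 x.2).le.trans hW)).1
    rw [hsm, hsm] at h3
    dsimp only at h3 ⊢
    rw [← hrr hW (f x.1 x.2).le]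
    exact h3
  refine ⟨hinj V hV, fun y ↦ ?_⟩
  have hmem := Presheaf.imageSieve_mem (Opens.grothendieckTopology X) φ y
  choose W f hf hx using hmem
  have (x : V) : ∃ a : Γ(X, W x.1 x.2),
      a • M.presheaf.map (homOfLE ((f x.1 x.2).le.trans hV)).op (show Γ(M, U) from φ.app (op U) z) =
        M.presheaf.map (f x.1 x.2).op y := by
    obtain ⟨w, hw⟩ := hf x.1 x.2
    obtain ⟨a, ha⟩ := (hz _ ((f x.1 x.2).le.trans hV)).2 w
    refine ⟨a, ?_⟩
    rw [hnat]
    refine (hφ _ _ _).symm.trans ?_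
    rw [← hw]
    exact congrArg _ ha
  choose a ha using this
  obtain ⟨b, hb, -⟩ := X.sheaf.existsUnique_gluing' (fun x : V ↦ W x.1 x.2) V
      (fun x ↦ f x.1 x.2) (fun x hxU ↦ Opens.mem_iSup.mpr ⟨⟨x, hxU⟩, hx _ _⟩) a (by
      intro x x'
      apply hinj _ ((inf_le_left.trans (f x.1 x.2).le).trans hV)
      have h1 := congr(M.presheaf.map (homOfLE (inf_le_left : W x.1 x.2 ⊓ W x'.1 x'.2 ≤ _)).op $(ha x))
      have h2 := congr(M.presheaf.map (homOfLE (inf_le_right : W x.1 x.2 ⊓ W x'.1 x'.2 ≤ _)).op $(ha x'))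
      have e : f x.1 x.2 = homOfLE (f x.1 x.2).le := rfl
      have e' : f x'.1 x'.2 = homOfLE (f x'.1 x'.2).le := rfl
      rw [e] at h1
      rw [e'] at h2
      rw [Scheme.Modules.map_smul, Modules.res_res, Modules.res_res] at h1 h2
      exact h1.trans h2.symm)
  refine ⟨b, Modules.section_ext _ _ fun x hxU ↦ ⟨W x hxU, (f x hxU).le, hx _ _, ?_⟩⟩
  refine (Scheme.Modules.map_smul M _ b _).trans ?_
  have e : f x hxU = homOfLE (f x hxU).le := rfl
  have := ha ⟨x, hxU⟩
  rw [e] at this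
  rw [← this, ← hb ⟨x, hxU⟩, Modules.res_res]
  rfl

/-- Over each smaller open set both modules of sections are free of rank one, so their tensor
product is free on the pure tensor; this passes to the sheafification. -/
lemma IsGenerator.tmul {L M : X.Modules} {U : X.Opens} {s : Γ(L, U)} {t : Γ(M, U)}
    (hs : IsGenerator L s) (ht : IsGenerator M t) : IsGenerator (tensorModule L M) (tmul s t) := by
  refine isGenerator_of_presheaf (P := tensorPresheaf L M) (toTensor L M)
    (fun U a x ↦ toTensor_smul a x) _ fun V hV ↦ ?_
  let e1 : Γ(X, V) ≃ₗ[Γ(X, V)] ((Scheme.Modules.toPresheafOfModules X).obj L).obj (op V) :=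
    LinearEquiv.ofBijective (LinearMap.toSpanSingleton _ _ (L.presheaf.map (homOfLE hV).op s)) (hs V hV)
  let e2 : Γ(X, V) ≃ₗ[Γ(X, V)] ((Scheme.Modules.toPresheafOfModules X).obj M).obj (op V) :=
    LinearEquiv.ofBijective (LinearMap.toSpanSingleton _ _ (M.presheaf.map (homOfLE hV).op t)) (ht V hV)
  have := ((TensorProduct.rid Γ(X, V) Γ(X, V)).symm.trans (TensorProduct.congr e1 e2)).bijective
  have heq : ⇑((TensorProduct.rid Γ(X, V) Γ(X, V)).symm.trans (TensorProduct.congr e1 e2)) =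
      fun a ↦ a • TensorProduct.tmul Γ(X, V) (M := ((Scheme.Modules.toPresheafOfModules X).obj L).obj (op V))
        (N := ((Scheme.Modules.toPresheafOfModules X).obj M).obj (op V))
        (L.presheaf.map (homOfLE hV).op s) (M.presheaf.map (homOfLE hV).op t) := by
    ext a
    rw [LinearEquiv.trans_apply, TensorProduct.rid_symm_apply, TensorProduct.congr_tmul]
    have h1 : e1 a = a • L.presheaf.map (homOfLE hV).op s := rfl
    have h2 : e2 1 = M.presheaf.map (homOfLE hV).op t := one_smul _ _
    rw [h1, h2]
    rfl
  rw [heq] at this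
  exact this

/-- The power of a section. -/
def spow {L : X.Modules} {U : X.Opens} (s : Γ(L, U)) : (n : ℕ) → Γ(tensorPower L n, U)
  | 0 => (1 : Γ(X, U))
  | n + 1 => TorsorExt.tmul (spow s n) s

lemma map_spow {L : X.Modules} {U V : X.Opens} (h : V ≤ U) (s : Γ(L, U)) (n : ℕ) :
    (tensorPower L n).presheaf.map (homOfLE h).op (spow s n) =
      spow (L.presheaf.map (homOfLE h).op s) n := by
  induction n with
  | zero => exact map_one (X.presheaf.map (homOfLE h).op).hom
  | succ n ih => exact (map_tmul h _ _).trans (by rw [ih]; rfl)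

lemma smul_spow {L : X.Modules} {U : X.Opens} (a : Γ(X, U)) (s : Γ(L, U)) (n : ℕ) :
    spow (a • s) n = a ^ n • spow s n := by
  induction n with
  | zero =>
    have : (1 : Γ(X, U)) = a ^ 0 * 1 := by simp
    exact this
  | succ n ih =>
    change TorsorExt.tmul (spow (a • s) n) (a • s) = _
    rw [ih, smul_tmul, ← pow_succ]
    rfl

lemma isGenerator_unit (U : X.Opens) : IsGenerator (unitModule X) (show Γ(unitModule X, U) from (1 : Γ(X, U))) := by
  intro V hV
  have h1 : (unitModule X).presheaf.map (homOfLE hV).op (show Γ(unitModule X, U) from (1 : Γ(X, U))) =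
    (1 : Γ(X, V)) := map_one (X.presheaf.map (homOfLE hV).op).hom
  have h2 : (fun a : Γ(X, V) ↦ a * 1) = id := funext mul_one
  rw [h1]
  exact h2 ▸ Function.bijective_id

lemma IsGenerator.spow {L : X.Modules} {U : X.Opens} {s : Γ(L, U)}
    (hs : IsGenerator L s) (n : ℕ) : IsGenerator (tensorPower L n) (spow s n) := by
  induction n with
  | zero => exact isGenerator_unit U
  | succ n ih => exact ih.tmul hs

lemma isIso_of_bijective {M N : X.Modules} (φ : M ⟶ N) (h : ∀ U, Function.Bijective (φ.app U)) :
    IsIso φ := by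
  rw [Scheme.Modules.Hom.isIso_iff_isIso_app]
  intro U
  exact (ConcreteCategory.isIso_iff_bijective (φ.app U)).mpr (h U)

/-- A module with a global generator is trivial. -/
lemma nonempty_iso_unit_of_isGenerator {M : X.Modules} (s : Γ(M, ⊤)) (hs : IsGenerator M s) :
    Nonempty (M ≅ unitModule X) := by
  let φ : unitModule X ⟶ M := (SheafOfModules.unitHomEquiv M).symm
    (PresheafOfModules.sectionsMk (fun U ↦ M.presheaf.map (homOfLE (le_top : U.unop ≤ ⊤)).op s) (by
      intro U V f
      exact Modules.res_res (M := M) (U := ⊤) (V := U.unop) (W := V.unop) le_top f.unop.le s))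
  have hφ (U : X.Opens) (a : Γ(X, U)) : φ.app U a = a • M.presheaf.map (homOfLE (le_top : U ≤ ⊤)).op s := by
    have h1 : φ.app U (1 : Γ(X, U)) = M.presheaf.map (homOfLE (le_top : U ≤ ⊤)).op s := by
      have := (SheafOfModules.unitHomEquiv M).apply_symm_apply
        (PresheafOfModules.sectionsMk (fun U ↦ M.presheaf.map (homOfLE (le_top : U.unop ≤ ⊤)).op s) (by
          intro U V f
          exact Modules.res_res (M := M) (U := ⊤) (V := U.unop) (W := V.unop) le_top f.unop.le s))
      exact congr(($this).val (op U))
    rw [← h1]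
    refine Eq.trans ?_ (Scheme.Modules.Hom.app_smul φ a (show Γ(unitModule X, U) from (1 : Γ(X, U))))
    congr 1
    exact (mul_one a).symm
  have : IsIso φ := isIso_of_bijective _ fun U ↦ by
    have := hs U le_top
    rwa [← funext (hφ U)] at this
  exact ⟨(asIso φ).symm⟩

lemma IsGenerator.map_iso {M N : X.Modules} (e : M ≅ N) {U : X.Opens} {s : Γ(M, U)}
    (hs : IsGenerator M s) : IsGenerator N (e.hom.app U s) := by
  intro V hV
  have h1 : N.presheaf.map (homOfLE hV).op (e.hom.app U s) =
      e.hom.app V (M.presheaf.map (homOfLE hV).op s) :=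
    (NatTrans.naturality_apply e.hom.mapPresheaf (homOfLE hV).op s).symm
  simp_rw [h1, ← Scheme.Modules.Hom.app_smul]
  exact ((ConcreteCategory.isIso_iff_bijective (e.hom.app V)).mp inferInstance).comp (hs V hV)

lemma isGenerator_restrict_iff {Y : Scheme.{u}} (f : Y ⟶ X) [IsOpenImmersion f] {M : X.Modules}
    {U : Y.Opens} (s : Γ(M, f ''ᵁ U)) :
    IsGenerator (M.restrict f) (show Γ(M.restrict f, U) from s) ↔ IsGenerator M s := by
  have key (V : Y.Opens) (hV : V ≤ U) : Function.Bijective (fun a : Γ(Y, V) ↦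
      a • (M.restrict f).presheaf.map (homOfLE hV).op (show Γ(M.restrict f, U) from s)) ↔
      Function.Bijective (fun a : Γ(X, f ''ᵁ V) ↦
        a • M.presheaf.map (homOfLE (f.image_mono hV)).op s) := by
    have he : Function.Bijective (f.appIso V).inv :=
      (ConcreteCategory.isIso_iff_bijective (f.appIso V).inv).mp inferInstance
    rw [← Function.Bijective.of_comp_iff _ he]
    rfl
  refine ⟨fun h V hV ↦ ?_, fun h V hV ↦ (key V hV).2 (h _ _)⟩
  obtain ⟨W, rfl⟩ : ∃ W : Y.Opens, V = f ''ᵁ W := ⟨f ⁻¹ᵁ V, by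
    rw [f.image_preimage_eq_opensRange_inf, inf_eq_right.mpr]
    exact hV.trans (f.image_le_opensRange _)⟩
  have hW : W ≤ U := by
    rw [← f.preimage_image_eq W, ← f.preimage_image_eq U]
    exact f.preimage_mono hV
  exact (key W hW).1 (h W hW)

/-- Replaces local trivialisations of a restricted module by sections on `X`, so that invertibility
can be handled without restriction functors. -/
lemma nonempty_restrict_iso_iff {M : X.Modules} (U : X.Opens) :
    Nonempty (M.restrict U.ι ≅ unitModule (U : Scheme.{u})) ↔ ∃ s : Γ(M, U), IsGenerator M s := by
  have hU : U.ι ''ᵁ ⊤ = U := by simp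
  constructor
  · rintro ⟨e⟩
    have h : ∃ s : Γ(M, U.ι ''ᵁ ⊤), IsGenerator M s :=
      ⟨_, (isGenerator_restrict_iff U.ι _).mp ((isGenerator_unit (X := U) ⊤).map_iso e.symm)⟩
    rwa [hU] at h
  · rintro ⟨s, hs⟩
    obtain ⟨s, hs⟩ : ∃ s : Γ(M, U.ι ''ᵁ ⊤), IsGenerator M s := by
      rw [hU]
      exact ⟨s, hs⟩
    exact nonempty_iso_unit_of_isGenerator _ ((isGenerator_restrict_iff U.ι (U := ⊤) s).mpr hs)

lemma isInvertibleModule_iff {M : X.Modules} :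
    IsInvertibleModule M ↔ ∀ x : X, ∃ U : X.Opens, x ∈ U ∧ ∃ s : Γ(M, U), IsGenerator M s := by
  simp_rw [← nonempty_restrict_iso_iff]
  rfl

end

/-! ### Trivialising a tensor power, and the sheaf of eigenfunctions of an endomorphism. -/

section

variable {X : Scheme.{u}}

/-- If `s_y = a s_x` and `u_y = a^m u_x` on overlaps, the sections `u_x⁻¹ s_x^m` agree there and
glue to a global generator. For a torsor, `s_x` will be an invertible function of degree one and
`u_x` its `m`-th power. -/
lemma nonempty_tensorPower_iso_unit {L : X.Modules} (m : ℕ) (U : X → X.Opens)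
    (hU : ∀ x, x ∈ U x) (s : ∀ x, Γ(L, U x)) (hs : ∀ x, IsGenerator L (s x))
    (u : ∀ x, (Γ(X, U x))ˣ)
    (hu : ∀ x y (a : Γ(X, U x ⊓ U y)),
      L.presheaf.map (homOfLE inf_le_right).op (s y) =
        a • L.presheaf.map (homOfLE inf_le_left).op (s x) →
      X.presheaf.map (homOfLE inf_le_right).op (u y).1 =
        a ^ m * X.presheaf.map (homOfLE inf_le_left).op (u x).1) :
    Nonempty (tensorPower L m ≅ unitModule X) := by
  obtain ⟨t, ht, -⟩ := TopCat.Sheaf.existsUnique_gluing'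
    (⟨(tensorPower L m).presheaf, (tensorPower L m).isSheaf⟩ : TopCat.Sheaf Ab X) U ⊤
    (fun x ↦ homOfLE le_top) (fun x _ ↦ Opens.mem_iSup.mpr ⟨x, hU x⟩)
    (fun x ↦ ((u x)⁻¹).1 • spow (s x) m) (by
      intro x y
      change (tensorPower L m).presheaf.map (homOfLE inf_le_left).op
          (((u x)⁻¹).1 • spow (s x) m) =
        (tensorPower L m).presheaf.map (homOfLE inf_le_right).op
          (((u y)⁻¹).1 • spow (s y) m)
      rw [Scheme.Modules.map_smul, Scheme.Modules.map_smul, map_spow, map_spow]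
      obtain ⟨a, -, ha⟩ := ((hs x).res (inf_le_left : U x ⊓ U y ≤ U x)).unit_of
        ((hs y).res (inf_le_right : U x ⊓ U y ≤ U y))
      have h1 := hu x y a ha
      rw [ha, smul_spow, smul_smul]
      congr 1
      have h2 := congr(X.presheaf.map (homOfLE (inf_le_right : U x ⊓ U y ≤ U y)).op $((u y).inv_mul))
      have h3 := congr(X.presheaf.map (homOfLE (inf_le_left : U x ⊓ U y ≤ U x)).op $((u x).inv_mul))
      rw [map_mul, map_one, h1] at h2
      rw [map_mul, map_one] at h3
      linear_combination (X.presheaf.map (homOfLE (inf_le_right : U x ⊓ U y ≤ U y)).op ((u y)⁻¹).1) * a ^ m * h3 - X.presheaf.map (homOfLE (inf_le_left : U x ⊓ U y ≤ U x)).op ((u x)⁻¹).1 * h2)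
  refine nonempty_iso_unit_of_isGenerator t (isGenerator_of_locally t fun x _ ↦
    ⟨U x, le_top, hU x, ?_⟩)
  have h4 : (tensorPower L m).presheaf.map (homOfLE (le_top : U x ≤ ⊤)).op t =
    ((u x)⁻¹).1 • spow (s x) m := ht x
  rw [h4]
  exact ((hs x).spow m).unit_smul _ (Units.isUnit _)

section
variable {Y : Scheme.{u}} (f : Y ⟶ X) {σ : Y ⟶ Y} (hσ : σ ≫ f = f)

/-- The pullback of functions along an `X`-endomorphism. -/
def endPull (U : X.Opens) : Γ(Y, f ⁻¹ᵁ U) →+* Γ(Y, f ⁻¹ᵁ U) :=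
  (σ.appLE (f ⁻¹ᵁ U) (f ⁻¹ᵁ U) (by rw [← Scheme.Hom.comp_preimage, hσ])).hom

lemma endPull_app (U : X.Opens) (a : Γ(X, U)) : endPull f hσ U (f.app U a) = f.app U a := by
  have : f.app U ≫ σ.appLE (f ⁻¹ᵁ U) (f ⁻¹ᵁ U) (by rw [← Scheme.Hom.comp_preimage, hσ]) = f.app U := by
    rw [f.app_eq_appLE, Scheme.Hom.appLE_comp_appLE]
    simp only [hσ]
  exact congr($this a)

lemma endPull_map {U V : X.Opens} (h : V ≤ U) (b : Γ(Y, f ⁻¹ᵁ U)) :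
    endPull f hσ V (Y.presheaf.map (homOfLE (f.preimage_mono h)).op b) =
      Y.presheaf.map (homOfLE (f.preimage_mono h)).op (endPull f hσ U b) := by
  simp only [endPull, ← ConcreteCategory.comp_apply,
    Scheme.Hom.map_appLE, Scheme.Hom.appLE_map]

variable (c : Γ(X, ⊤))

/-- The eigenspace of an `X`-endomorphism acting on functions. -/
def eigen (U : X.Opens) : AddSubgroup Γ(Y, f ⁻¹ᵁ U) where
  carrier := {b | endPull f hσ U b = f.app U (X.presheaf.map (homOfLE le_top).op c) * b}
  add_mem' ha hb := by
    simp only [Set.mem_ofPred_eq, map_add, mul_add] at ha hb ⊢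
    rw [ha, hb]
  zero_mem' := by simp
  neg_mem' ha := by
    simp only [Set.mem_ofPred_eq, map_neg, mul_neg] at ha ⊢
    rw [ha]

lemma mem_eigen {U : X.Opens} {b : Γ(Y, f ⁻¹ᵁ U)} : b ∈ eigen f hσ c U ↔
    endPull f hσ U b = f.app U (X.presheaf.map (homOfLE le_top).op c) * b := Iff.rfl

lemma app_map {U V : X.Opens} (h : V ≤ U) (a : Γ(X, U)) :
    f.app V (X.presheaf.map (homOfLE h).op a) =
      Y.presheaf.map (homOfLE (f.preimage_mono h)).op (f.app U a) :=
  NatTrans.naturality_apply f.c (homOfLE h).op a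

lemma map_mem_eigen {U V : X.Opens} (h : V ≤ U) {b : Γ(Y, f ⁻¹ᵁ U)} (hb : b ∈ eigen f hσ c U) :
    Y.presheaf.map (homOfLE (f.preimage_mono h)).op b ∈ eigen f hσ c V := by
  rw [mem_eigen] at hb ⊢
  rw [endPull_map f hσ h, hb, map_mul, ← app_map f h, Scheme.res_res]

lemma mem_eigen_of_locally {U : X.Opens} {b : Γ(Y, f ⁻¹ᵁ U)} (h : ∀ x ∈ U, ∃ (V : X.Opens) (hV : V ≤ U),
    x ∈ V ∧ Y.presheaf.map (homOfLE (f.preimage_mono hV)).op b ∈ eigen f hσ c V) :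
    b ∈ eigen f hσ c U := by
  choose V hV hx hs using h
  rw [mem_eigen]
  refine Y.sheaf.eq_of_locally_eq' (fun x : U ↦ f ⁻¹ᵁ V x.1 x.2) (f ⁻¹ᵁ U)
    (fun x ↦ homOfLE (f.preimage_mono (hV _ _)))
    (fun y hy ↦ Opens.mem_iSup.mpr ⟨⟨f y, hy⟩, hx (f y) hy⟩) _ _ fun x ↦ ?_
  have := hs x.1 x.2
  rw [mem_eigen] at this
  refine (endPull_map f hσ (hV _ _) _).symm.trans ?_
  refine Eq.trans ?_ (map_mul (Y.presheaf.map (homOfLE (f.preimage_mono (hV x.1 x.2))).op).hom _ _).symm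
  refine this.trans ?_
  congr 1
  rw [← Scheme.res_res le_top (hV _ _), app_map]

lemma smul_mem_eigen {U : X.Opens} (a : Γ(X, U)) {b : Γ(Y, f ⁻¹ᵁ U)} (hb : b ∈ eigen f hσ c U) :
    f.app U a * b ∈ eigen f hσ c U := by
  rw [mem_eigen] at hb ⊢
  rw [map_mul, endPull_app, hb]
  ring

/-- The subpresheaf of eigenfunctions in `f_* 𝒪_Y`. -/
def eigenSubmodule : PresheafOfModules.Submodule
    ((Scheme.Modules.toPresheafOfModules X).obj
      ((Scheme.Modules.pushforward f).obj (unitModule Y))) where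
  obj U :=
    { __ := eigen f hσ c U.unop
      smul_mem' := fun a b hb ↦ by
        obtain ⟨U⟩ := U
        have hb : b ∈ eigen f hσ c U := hb
        change ((f.app U a) * (show Γ(Y, f ⁻¹ᵁ U) from b)) ∈ eigen f hσ c U
        exact smul_mem_eigen f hσ c a hb }
  map {U V} i b hb := by
    obtain ⟨U⟩ := U
    obtain ⟨V⟩ := V
    exact map_mem_eigen f hσ c i.unop.le hb

/-- The sheaf of eigenfunctions in `f_* 𝒪_Y`. -/
def eigenModule : X.Modules where
  val := (eigenSubmodule f hσ c).toPresheafOfModules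
  isSheaf := by
    change TopCat.Presheaf.IsSheaf _
    rw [TopCat.Presheaf.isSheaf_iff_isSheaf_comp (forget _),
      TopCat.Presheaf.isSheaf_iff_isSheafUniqueGluing_types]
    intro ι U sf hsf
    obtain ⟨b, hb, hbu⟩ := Y.sheaf.existsUnique_gluing' (fun i ↦ f ⁻¹ᵁ (U i)) (f ⁻¹ᵁ (iSup U))
      (fun i ↦ homOfLE (f.preimage_mono (le_iSup U i)))
      (fun y hy ↦ by
        obtain ⟨i, hi⟩ := Opens.mem_iSup.mp (show f y ∈ iSup U from hy)
        exact Opens.mem_iSup.mpr ⟨i, hi⟩) (fun i ↦ (sf i).1) (fun i j ↦ congr_arg Subtype.val (hsf i j))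
    have hbm : b ∈ eigen f hσ c (iSup U) := mem_eigen_of_locally f hσ c fun x hx ↦ by
      obtain ⟨i, hi⟩ := Opens.mem_iSup.mp hx
      refine ⟨U i, le_iSup U i, hi, ?_⟩
      have := hb i
      exact this ▸ (sf i).2
    refine ⟨⟨b, hbm⟩, fun i ↦ Subtype.ext (hb i), fun y hy ↦ Subtype.ext (hbu _ fun i ↦ congr_arg Subtype.val (hy i))⟩

/-- The function underlying an eigensection. -/
def eigenModule.val {U : X.Opens} (s : Γ(eigenModule f hσ c, U)) : Γ(Y, f ⁻¹ᵁ U) := Subtype.val s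

variable {f hσ c}

/-- An eigensection from an eigenfunction. -/
def eigenModule.mk {U : X.Opens} (s : Γ(Y, f ⁻¹ᵁ U)) (hs : s ∈ eigen f hσ c U) :
  Γ(eigenModule f hσ c, U) := (⟨s, hs⟩ : eigen f hσ c U)

lemma eigenModule.val_mk {U : X.Opens} (s : Γ(Y, f ⁻¹ᵁ U)) (hs : s ∈ eigen f hσ c U) :
  eigenModule.val _ _ _ (eigenModule.mk s hs) = s := rfl

lemma eigenModule.val_mem {U : X.Opens} (s : Γ(eigenModule f hσ c, U)) :
    eigenModule.val _ _ _ s ∈ eigen f hσ c U := Subtype.prop (p := (· ∈ eigen f hσ c U)) s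

lemma eigenModule.val_injective {U : X.Opens} :
    Function.Injective (eigenModule.val f hσ c (U := U)) := Subtype.val_injective

lemma eigenModule.val_smul {U : X.Opens} (a : Γ(X, U)) (s : Γ(eigenModule f hσ c, U)) :
    eigenModule.val _ _ _ (a • s) = f.app U a * eigenModule.val _ _ _ s := rfl

lemma eigenModule.val_map {U V : X.Opens} (h : V ≤ U) (s : Γ(eigenModule f hσ c, U)) :
    eigenModule.val _ _ _ ((eigenModule f hσ c).presheaf.map (homOfLE h).op s) =
      Y.presheaf.map (homOfLE (f.preimage_mono h)).op (eigenModule.val _ _ _ s) := rfl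
end

end

/-! ### Descent of functions along torsors under a constant group. -/

section

lemma CommRingCat.exists_sum_of_isPushout {A B C D : CommRingCat.{u}} {f : A ⟶ B} {g : A ⟶ C}
    {inl : B ⟶ D} {inr : C ⟶ D} (h : IsPushout f g inl inr) (x : D) :
    ∃ (n : ℕ) (b : Fin n → B) (c : Fin n → C), x = ∑ i, inl (b i) * inr (c i) := by
  algebraize [f.hom, g.hom]
  have h' := CommRingCat.isPushout_tensorProduct A B C
  let e := h'.isoIsPushout _ _ h
  have hl (b : B) : e.hom (b ⊗ₜ[A] 1) = inl b := congr($(h'.inl_isoIsPushout_hom _ _ h) b)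
  have hr (c : C) : e.hom ((1 : B) ⊗ₜ[A] c) = inr c := congr($(h'.inr_isoIsPushout_hom _ _ h) c)
  obtain ⟨y, rfl⟩ : ∃ y, e.hom y = x := ⟨e.inv x, by simp⟩
  induction y using TensorProduct.induction_on with
  | zero => exact ⟨0, Fin.elim0, Fin.elim0, by simp⟩
  | tmul b c =>
    refine ⟨1, fun _ ↦ b, fun _ ↦ c, ?_⟩
    rw [Fin.sum_univ_one, ← hl, ← hr, ← map_mul, Algebra.TensorProduct.tmul_mul_tmul, one_mul, mul_one]
  | add y z hy hz =>
    obtain ⟨n, b, c, h1⟩ := hy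
    obtain ⟨n', b', c', h2⟩ := hz
    refine ⟨n + n', Fin.append b b', Fin.append c c', ?_⟩
    rw [map_add, h1, h2, Fin.sum_univ_add]
    simp

/-- Faithfully flat descent: `A → B ⇉ B ⊗_A B` is an equalizer in the category of rings, here read
off on elements. -/
lemma CommRingCat.exists_of_isPushout_of_faithfullyFlat {A B D : CommRingCat.{u}} {f : A ⟶ B}
    {inl : B ⟶ D} {inr : B ⟶ D} (h : IsPushout f f inl inr) (hf : f.hom.FaithfullyFlat)
    (b : B) (hb : inl b = inr b) : ∃ a, f a = b := by
  have hl := CommRingCat.isLimitForkPushoutSelfOfFaithfullyFlat f hf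
  -- A polynomial ring over `ℤ`, lifted to the right universe, represents elements: the map `k` is
  -- the element `b`, to which the universal property of the equalizer applies.
  let P : CommRingCat.{u} := .of (Polynomial (ULift.{u} ℤ))
  let k : P ⟶ B := CommRingCat.ofHom (Polynomial.eval₂RingHom
    ((Int.castRingHom B).comp ULift.ringEquiv.toRingHom) b)
  have hk : k Polynomial.X = b := Polynomial.eval₂_X _ _
  have hk' : k ≫ pushout.inl f f = k ≫ pushout.inr f f := by
    have e := h.isoPushout
    rw [← cancel_mono h.isoPushout.inv, Category.assoc, Category.assoc, h.inl_isoPushout_inv,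
      h.inr_isoPushout_inv]
    refine CommRingCat.hom_ext (RingHom.ext fun (x : Polynomial (ULift.{u} ℤ)) ↦ ?_)
    change inl (k x) = inr (k x)
    induction x using Polynomial.induction_on with
    | C n =>
      have : (Polynomial.C n : Polynomial (ULift.{u} ℤ)) = (n.down : Polynomial (ULift.{u} ℤ)) := by
        obtain ⟨n⟩ := n
        exact (eq_intCast ((Polynomial.C : ULift.{u} ℤ →+* _).comp (ULift.ringEquiv (R := ℤ)).symm.toRingHom) n)
      rw [this, map_intCast, map_intCast, map_intCast]
    | add p q hp hq => rw [map_add, map_add, hp, hq, map_add]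
    | monomial n a hn =>
      rw [pow_succ, ← mul_assoc, map_mul k.hom, map_mul inl.hom, map_mul inr.hom, hn, hk, hb]
  let l := hl.lift (Fork.ofι k hk')
  have hlf : l ≫ f = k := hl.fac (Fork.ofι k hk') WalkingParallelPair.zero
  exact ⟨l Polynomial.X, by rw [← CommRingCat.comp_apply, hlf, hk]⟩

variable {X Y : Scheme.{u}}

lemma appLE_congr_hom {f g : Y ⟶ X} (h : f = g) {U : X.Opens} {V : Y.Opens} (e : V ≤ f ⁻¹ᵁ U)
    (e' : V ≤ g ⁻¹ᵁ U) : f.appLE U V e = g.appLE U V e' := by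
  subst h
  rfl

lemma faithfullyFlat_app (f : Y ⟶ X) [IsAffineHom f] [Flat f] [Surjective f] {U : X.Opens}
    (hU : IsAffineOpen U) : (f.app U).hom.FaithfullyFlat := by
  have : IsAffine U := hU
  have : IsAffine (f ⁻¹ᵁ U) := hU.preimage f
  have : Surjective (f ∣_ U) := IsZariskiLocalAtTarget.restrict ‹_› U
  have := (Flat.flat_and_surjective_iff_faithfullyFlat_of_isAffine (f ∣_ U)).mp ⟨inferInstance, inferInstance⟩
  rw [Scheme.Hom.appTop, morphismRestrict_app'] at this
  rw [Scheme.Hom.app_eq_appLE]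
  exact (f.appLE_congr _ (by simp) (by simp) (fun φ ↦ φ.hom.FaithfullyFlat)).mp this

lemma isPushout_preimage {S P T : Scheme.{u}} {f : T ⟶ S} {g : P ⟶ X} {iX : X ⟶ S} {iY : P ⟶ T}
    (H : IsPullback g iY iX f) [IsAffineHom f] [IsAffineHom iX] {U : S.Opens} (hU : IsAffineOpen U) :
    IsPushout (iX.app U) (f.app U) (g.appLE (iX ⁻¹ᵁ U) ((g ≫ iX) ⁻¹ᵁ U) (Scheme.Hom.comp_preimage ..).le)
      (iY.appLE (f ⁻¹ᵁ U) ((g ≫ iX) ⁻¹ᵁ U) (by rw [H.w, Scheme.Hom.comp_preimage])) := by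
  have := (isIso_pushoutSection_iff H (US := U) le_rfl le_rfl (UY := (g ≫ iX) ⁻¹ᵁ U) (by
    rw [← Scheme.Hom.comp_preimage iY, ← H.w, Scheme.Hom.comp_preimage, inf_idem])).mp
    (isIso_pushoutSection_of_isAffineOpen H _ _ _ hU (hU.preimage _) (hU.preimage _))
  simpa [Scheme.Hom.app_eq_appLE] using this

section ConstTorsor
variable {G : Type} [Group G] [Finite G] (T : ConstTorsor G X)

instance : Flat T.proj := T.flat
instance : Surjective T.proj := T.surjective

/-- The graph of the action of a group element. -/
abbrev ConstTorsor.graph (g : G) : T.total ⟶ pullback T.proj T.proj :=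
  pullback.lift (𝟙 T.total) (T.act g).hom.left
      ((Category.id_comp _).trans (Over.w (T.act g).hom).symm)

/-- The map `G × T ⟶ T ×_X T` of the action. -/
abbrev ConstTorsor.shear : (∐ fun _ : G ↦ T.total) ⟶ pullback T.proj T.proj := Sigma.desc T.graph

instance : IsIso T.shear := T.isIso_shear

/-- Sections of the self-product of a torsor are determined by their restrictions to graphs. -/
lemma ConstTorsor.graph_ext (U : (pullback T.proj T.proj).Opens)
    (a b : Γ(pullback T.proj T.proj, U)) (h : ∀ g, (T.graph g).app U a = (T.graph g).app U b) : a = b := by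
  have h1 : T.shear.app U a = T.shear.app U b := by
    refine (∐ fun _ : G ↦ T.total).sheaf.eq_of_locally_eq' (fun g : G ↦ (T.shear ⁻¹ᵁ U) ⊓ (Sigma.ι (fun _ : G ↦ T.total) g).opensRange) _
      (fun g ↦ homOfLE inf_le_left) (fun x hx ↦ ?_) _ _ fun g ↦ ?_
    · obtain ⟨i, y, hy⟩ := (sigmaOpenCover (fun _ : G ↦ T.total)).exists_eq x
      exact Opens.mem_iSup.mpr ⟨i, hx, y, hy⟩
    · obtain ⟨j, hj⟩ : ∃ j : (T.total : Scheme.{u}).Opens → (∐ fun _ : G ↦ T.total).Opens, j = fun V ↦ (Sigma.ι (fun _ : G ↦ T.total) g) ''ᵁ V := ⟨_, rfl⟩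
      let ι := Sigma.ι (fun _ : G ↦ T.total) g
      have hι : ι ≫ T.shear = T.graph g := Sigma.ι_desc _ _
      have hinj : Function.Injective (ι.app (T.shear ⁻¹ᵁ U ⊓ ι.opensRange)) := by
        have : IsIso (ι.app (T.shear ⁻¹ᵁ U ⊓ ι.opensRange)) := ι.isIso_app _ inf_le_right
        exact ((ConcreteCategory.isIso_iff_bijective _).mp this).1
      apply hinj
      have key (a : Γ(pullback T.proj T.proj, U)) :
          ι.app (T.shear ⁻¹ᵁ U ⊓ ι.opensRange) ((∐ fun _ : G ↦ T.total).presheaf.map (homOfLE inf_le_left).op (T.shear.app U a)) =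
          T.total.presheaf.map (homOfLE (by
            rw [← hι]; exact fun x hx ↦ hx.1)).op ((T.graph g).app U a) := by
        simp only [← CommRingCat.comp_apply]
        congr 2
        simp only [Scheme.Hom.app_eq_appLE, Scheme.Hom.appLE_map,
          Scheme.Hom.appLE_comp_appLE]
        exact appLE_congr_hom hι _ _
      exact (key a).trans ((congrArg _ (h g)).trans (key b).symm)
  have : Function.Injective (T.shear.app U) := ((ConcreteCategory.isIso_iff_bijective (T.shear.app U)).mp inferInstance).1
  exact this h1

/-- The shear isomorphism makes `T ×_X T` the disjoint union of the graphs of the group elements;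
the idempotent cuts out the graph of `1`, the diagonal. -/
lemma ConstTorsor.exists_idempotent [DecidableEq G] : ∃ e : Γ(pullback T.proj T.proj, ⊤),
    ∀ g, (T.graph g).appTop e = if g = 1 then 1 else 0 := by
  -- The characteristic function of a component is pulled back from the spectrum of the ring of
  -- functions `G → ℤ`, to which the component of `g` maps through evaluation at `g`.
  let R : CommRingCat.{u} := .of (G → ULift.{u} ℤ)
  let φ (g : G) : R ⟶ .of (ULift.{u} ℤ) := CommRingCat.ofHom (Pi.evalRingHom _ g)
  let F : (∐ fun _ : G ↦ T.total) ⟶ Spec R := Sigma.desc fun g ↦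
    specULiftZIsTerminal.from _ ≫ Spec.map (φ g)
  let e := (Scheme.ΓSpecIso R).inv (Pi.single 1 1)
  refine ⟨(inv T.shear).appTop (F.appTop e), fun g ↦ ?_⟩
  have hg : T.graph g = Sigma.ι (fun _ : G ↦ T.total) g ≫ T.shear := (Sigma.ι_desc _ _).symm
  have h1 : T.graph g ≫ inv T.shear ≫ F = specULiftZIsTerminal.from _ ≫ Spec.map (φ g) := by
    rw [hg, Category.assoc, IsIso.hom_inv_id_assoc]
    exact Sigma.ι_desc _ _
  have h2 : (T.graph g).appTop ((inv T.shear).appTop (F.appTop e)) =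
      (T.graph g ≫ inv T.shear ≫ F).appTop e := rfl
  rw [h2, h1]
  have h3 : (Spec.map (φ g)).appTop e = (Scheme.ΓSpecIso _).inv (φ g (Pi.single 1 1)) := by
    rw [← CommRingCat.comp_apply, ← CommRingCat.comp_apply, Scheme.ΓSpecIso_inv_naturality]
  have h4 : φ g (Pi.single 1 1) = if g = 1 then 1 else 0 := Pi.single_apply _ _ _
  rw [Scheme.Hom.comp_appTop, CommRingCat.comp_apply, h3, h4]
  split_ifs <;> simp

lemma ConstTorsor.act_comp_proj (g : G) : (T.act g).hom.left ≫ T.proj = T.proj := Over.w (T.act g).hom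

/-- The action of `G` on the functions on the torsor over `U`. -/
abbrev ConstTorsor.pull (g : G) (U : X.Opens) : Γ(T.total, T.proj ⁻¹ᵁ U) →+* Γ(T.total, T.proj ⁻¹ᵁ U) :=
  endPull T.proj (T.act_comp_proj g) U

/-- The preimage of `U` in `T ×_X T`. -/
abbrev ConstTorsor.prodOpen (U : X.Opens) : (pullback T.proj T.proj).Opens :=
  (pullback.fst T.proj T.proj ≫ T.proj) ⁻¹ᵁ U

lemma ConstTorsor.le_graph_preimage (g : G) (U : X.Opens) :
    T.proj ⁻¹ᵁ U ≤ T.graph g ⁻¹ᵁ T.prodOpen U := by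
  rw [← Scheme.Hom.comp_preimage, pullback.lift_fst_assoc, Category.id_comp]

lemma ConstTorsor.graph_fst (g : G) (U : X.Opens) (b : Γ(T.total, T.proj ⁻¹ᵁ U)) :
    (T.graph g).appLE (T.prodOpen U) (T.proj ⁻¹ᵁ U) (T.le_graph_preimage g U)
      ((pullback.fst T.proj T.proj).appLE (T.proj ⁻¹ᵁ U) (T.prodOpen U) (Scheme.Hom.comp_preimage ..).le b) = b := by
  have h1 : T.graph g ≫ pullback.fst T.proj T.proj = 𝟙 _ := pullback.lift_fst _ _ _
  rw [← CommRingCat.comp_apply, Scheme.Hom.appLE_comp_appLE]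
  have h2 := appLE_congr_hom h1 (U := T.proj ⁻¹ᵁ U) (V := T.proj ⁻¹ᵁ U) (by rw [h1]; rfl) le_rfl
  refine congr($h2 b).trans ?_
  exact congr($(T.total.presheaf.map_id (op (T.proj ⁻¹ᵁ U))) b)

lemma ConstTorsor.graph_snd (g : G) (U : X.Opens) (b : Γ(T.total, T.proj ⁻¹ᵁ U)) :
    (T.graph g).appLE (T.prodOpen U) (T.proj ⁻¹ᵁ U) (T.le_graph_preimage g U)
      ((pullback.snd T.proj T.proj).appLE (T.proj ⁻¹ᵁ U) (T.prodOpen U)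
        (by rw [← Scheme.Hom.comp_preimage, ← pullback.condition]) b) = T.pull g U b := by
  have h1 : T.graph g ≫ pullback.snd T.proj T.proj = (T.act g).hom.left := pullback.lift_snd _ _ _
  have h3 : T.proj ⁻¹ᵁ U ≤ (T.act g).hom.left ⁻¹ᵁ T.proj ⁻¹ᵁ U := by
    rw [← Scheme.Hom.comp_preimage, T.act_comp_proj]
  rw [← CommRingCat.comp_apply, Scheme.Hom.appLE_comp_appLE]
  have h2 := appLE_congr_hom h1 (U := T.proj ⁻¹ᵁ U) (V := T.proj ⁻¹ᵁ U) (by rw [h1]; exact h3) h3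
  exact congr($h2 b)

/-- Over an affine open set the idempotent of the diagonal is a tensor `∑ bᵢ ⊗ cᵢ`; pulled back
along the graph of `g` it becomes `∑ bᵢ g(cᵢ)`. This is the Galois condition from which
invertibility of the degree-one part is derived. -/
lemma ConstTorsor.exists_sum [DecidableEq G] {U : X.Opens} (hU : IsAffineOpen U) :
    ∃ (n : ℕ) (b c : Fin n → Γ(T.total, T.proj ⁻¹ᵁ U)), ∀ g,
      ∑ i, b i * T.pull g U (c i) = if g = 1 then 1 else 0 := by
  obtain ⟨e, he⟩ := T.exists_idempotent
  obtain ⟨n, b, c, hbc⟩ := CommRingCat.exists_sum_of_isPushout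
    (isPushout_preimage (IsPullback.of_hasPullback T.proj T.proj) hU)
    ((pullback T.proj T.proj).presheaf.map (homOfLE (le_top : T.prodOpen U ≤ ⊤)).op e)
  refine ⟨n, b, c, fun g ↦ ?_⟩
  have h1 := congr((T.graph g).appLE (T.prodOpen U) (T.proj ⁻¹ᵁ U) (T.le_graph_preimage g U) $hbc)
  rw [map_sum] at h1
  simp only [map_mul, graph_fst, graph_snd] at h1
  rw [← h1, ← CommRingCat.comp_apply, Scheme.Hom.map_appLE]
  have h2 : (T.graph g).appLE ⊤ (T.proj ⁻¹ᵁ U) le_top e =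
    T.total.presheaf.map (homOfLE le_top).op ((T.graph g).appTop e) := rfl
  rw [h2, he]
  split_ifs <;> simp

/-- For an invariant function the two pullbacks to `T ×_X T` agree on every graph, hence agree, and
faithfully flat descent applies. -/
lemma ConstTorsor.exists_app_eq {U : X.Opens} (hU : IsAffineOpen U)
    (b : Γ(T.total, T.proj ⁻¹ᵁ U)) (hb : ∀ g, T.pull g U b = b) : ∃ a, T.proj.app U a = b := by
  refine CommRingCat.exists_of_isPushout_of_faithfullyFlat
    (isPushout_preimage (IsPullback.of_hasPullback T.proj T.proj) hU) (faithfullyFlat_app _ hU) b ?_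
  refine T.graph_ext _ _ _ fun g ↦ ?_
  have h : T.graph g ⁻¹ᵁ T.prodOpen U = T.proj ⁻¹ᵁ U := by
    rw [← Scheme.Hom.comp_preimage, pullback.lift_fst_assoc, Category.id_comp]
  have hinj : Function.Injective (T.total.presheaf.map (homOfLE h.ge).op) := by
    have : IsIso (homOfLE h.ge) := ⟨homOfLE h.le, rfl, rfl⟩
    exact ((ConcreteCategory.isIso_iff_bijective _).mp inferInstance).1
  apply hinj
  have := (T.graph_fst g U b).trans ((hb g).symm.trans (T.graph_snd g U b).symm)
  exact this

lemma ConstTorsor.app_injective {U : X.Opens} (hU : IsAffineOpen U) :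
    Function.Injective (T.proj.app U) :=
  (faithfullyFlat_app T.proj hU).injective

end ConstTorsor

end

/-! ### Morphisms into a scheme affine over `X`, in terms of functions. -/

section

lemma ι_comp_eq_toSpecΓ {T Z : Scheme.{u}} (h : T ⟶ Z) {W : Z.Opens} (hW : IsAffineOpen W)
    {V : T.Opens} (hV : V ≤ h ⁻¹ᵁ W) :
    V.ι ≫ h = V.toSpecΓ ≫ Spec.map (h.appLE W V hV) ≫ hW.fromSpec := by
  rw [Scheme.Opens.toSpecΓ_SpecMap_appLE_assoc, hW.toSpecΓ_fromSpec, Scheme.Hom.resLE_comp_ι]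

lemma eq_of_toSpecΓ_comp_eq {T : Scheme.{u}} {V : T.Opens} {A : CommRingCat.{u}} {a b : A ⟶ Γ(T, V)}
    (h : V.toSpecΓ ≫ Spec.map a = V.toSpecΓ ≫ Spec.map b) : a = b := by
  have key (a : A ⟶ Γ(T, V)) : (Scheme.ΓSpecIso A).inv ≫ (V.toSpecΓ ≫ Spec.map a).appTop ≫
      V.topIso.hom = a := by
    rw [Scheme.Hom.comp_appTop, Scheme.Opens.toSpecΓ_appTop]
    refine Eq.trans ?_ (Category.comp_id a)
    rw [← V.topIso.inv_hom_id, Iso.inv_comp_eq, ← Scheme.ΓSpecIso_naturality_assoc,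
      Category.assoc, Category.assoc]
  rw [← key a, h, key]

section Glue

variable {X Z T : Scheme.{u}} (g : T ⟶ X)

lemma hom_ext_of_affineOpens {h h' : T ⟶ Z}
    (H : ∀ U : X.affineOpens, (g ⁻¹ᵁ U.1).ι ≫ h = (g ⁻¹ᵁ U.1).ι ≫ h') : h = h' :=
  Scheme.Cover.hom_ext (T.openCoverOfIsOpenCover _
    (.comap (iSup_affineOpens_eq_top X) g.base.1)) _ _ fun U ↦ H U

/-- A compatible family of morphisms on the preimages of affine opens glues.
It suffices to check compatibility on basic opens. -/
lemma exists_glue (ψ : ∀ U : X.affineOpens, ((g ⁻¹ᵁ U.1 : T.Opens) : Scheme.{u}) ⟶ Z)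
    (hψ : ∀ (U V : X.affineOpens) (h : V.1 ≤ U.1), (∃ r, X.basicOpen (U := U.1) r = V.1) →
      T.homOfLE (g.preimage_mono h) ≫ ψ U = ψ V) :
    ∃ h : T ⟶ Z, ∀ U : X.affineOpens, (g ⁻¹ᵁ U.1).ι ≫ h = ψ U := by
  have key (U V : X.affineOpens) (W : Scheme.{u}) (a : W ⟶ (g ⁻¹ᵁ U.1 : T.Opens))
      (b : W ⟶ (g ⁻¹ᵁ V.1 : T.Opens)) (hab : a ≫ (g ⁻¹ᵁ U.1).ι = b ≫ (g ⁻¹ᵁ V.1).ι) :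
      a ≫ ψ U = b ≫ ψ V := by
    let k : W ⟶ X := a ≫ (g ⁻¹ᵁ U.1).ι ≫ g
    have hU (w : W) : k w ∈ U.1 := (a w).2
    have hV (w : W) : k w ∈ V.1 := by
      have h1 : k = b ≫ (g ⁻¹ᵁ V.1).ι ≫ g := by
        rw [← Category.assoc, ← hab, Category.assoc]
      rw [h1]
      exact (b w).2
    -- An intersection of two affine opens is covered by sets that are basic open in both, which is
    -- why compatibility on basic opens suffices.
    have h1 (w : W) : ∃ O : X.affineOpens, k w ∈ O.1 ∧ O.1 ≤ U.1 ⊓ V.1 ∧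
        (∃ r, X.basicOpen (U := U.1) r = O.1) ∧ ∃ r, X.basicOpen (U := V.1) r = O.1 := by
      obtain ⟨r, s, e, hr⟩ := exists_basicOpen_le_affine_inter U.2 V.2 (k w) ⟨hU w, hV w⟩
      exact ⟨⟨X.basicOpen r, U.2.basicOpen r⟩, hr,
        le_inf (X.basicOpen_le r) (e.trans_le (X.basicOpen_le s)), ⟨r, rfl⟩, s, e.symm⟩
    choose O hw hle hOU hOV using h1
    refine Scheme.Cover.hom_ext (W.openCoverOfIsOpenCover (fun w ↦ k ⁻¹ᵁ (O w).1)
      (top_le_iff.mp fun w _ ↦ Opens.mem_iSup.mpr ⟨w, hw w⟩)) _ _ ?_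
    intro (w : W)
    change (k ⁻¹ᵁ (O w).1).ι ≫ a ≫ ψ U = (k ⁻¹ᵁ (O w).1).ι ≫ b ≫ ψ V
    let c : ((k ⁻¹ᵁ (O w).1 : W.Opens) : Scheme.{u}) ⟶ (g ⁻¹ᵁ (O w).1 : T.Opens) :=
      (a ≫ (g ⁻¹ᵁ U.1).ι).resLE (g ⁻¹ᵁ (O w).1) (k ⁻¹ᵁ (O w).1)
        (by rw [← Scheme.Hom.comp_preimage, Category.assoc])
    have hc : c ≫ (g ⁻¹ᵁ (O w).1).ι = (k ⁻¹ᵁ (O w).1).ι ≫ a ≫ (g ⁻¹ᵁ U.1).ι :=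
      Scheme.Hom.resLE_comp_ι _ _
    have ha : c ≫ T.homOfLE (g.preimage_mono ((hle w).trans inf_le_left)) =
        (k ⁻¹ᵁ (O w).1).ι ≫ a := by
      rw [← cancel_mono (g ⁻¹ᵁ U.1).ι, Category.assoc, Scheme.homOfLE_ι, hc, Category.assoc]
    have hb : c ≫ T.homOfLE (g.preimage_mono ((hle w).trans inf_le_right)) =
        (k ⁻¹ᵁ (O w).1).ι ≫ b := by
      rw [← cancel_mono (g ⁻¹ᵁ V.1).ι, Category.assoc, Scheme.homOfLE_ι, hc, Category.assoc, hab]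
    rw [← Category.assoc, ← ha, ← Category.assoc, ← hb, Category.assoc, Category.assoc,
      hψ U (O w) ((hle w).trans inf_le_left) (hOU w),
      hψ V (O w) ((hle w).trans inf_le_right) (hOV w)]
  let 𝒰 : T.OpenCover := T.openCoverOfIsOpenCover (fun U : X.affineOpens ↦ g ⁻¹ᵁ U.1)
    (.comap (iSup_affineOpens_eq_top X) g.base.1)
  have H (U V : X.affineOpens) : pullback.fst (𝒰.f U) (𝒰.f V) ≫ ψ U =
      pullback.snd (𝒰.f U) (𝒰.f V) ≫ ψ V :=
    key U V _ _ _ pullback.condition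
  exact ⟨Scheme.Cover.glueMorphisms 𝒰 (fun U ↦ ψ U) H,
    fun U ↦ Scheme.Cover.ι_glueMorphisms 𝒰 (fun U ↦ ψ U) H U⟩

end Glue

variable {X Z T : Scheme.{u}} {p : Z ⟶ X} {g : T ⟶ X}

lemma preimage_le_of_comp {h : T ⟶ Z} (e : h ≫ p = g) (U : X.Opens) :
    g ⁻¹ᵁ U ≤ h ⁻¹ᵁ p ⁻¹ᵁ U := by
  rw [← Scheme.Hom.comp_preimage, e]

/-- The map on sections over `U` induced by a morphism of schemes over `X`. -/
abbrev overApp {h : T ⟶ Z} (e : h ≫ p = g) (U : X.Opens) : Γ(Z, p ⁻¹ᵁ U) ⟶ Γ(T, g ⁻¹ᵁ U) :=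
  h.appLE _ _ (preimage_le_of_comp e U)

lemma overApp_app {h : T ⟶ Z} (e : h ≫ p = g) (U : X.Opens) :
    p.app U ≫ overApp e U = g.app U := by
  subst e
  rw [Scheme.Hom.app_eq_appLE, overApp, Scheme.Hom.appLE_comp_appLE, Scheme.Hom.app_eq_appLE]

lemma overApp_map {h : T ⟶ Z} (e : h ≫ p = g) {U V : X.Opens} (hVU : V ≤ U) :
    Z.presheaf.map (homOfLE (p.preimage_mono hVU)).op ≫ overApp e V =
      overApp e U ≫ T.presheaf.map (homOfLE (g.preimage_mono hVU)).op := by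
  simp [overApp]

lemma overApp_comp {T' : Scheme.{u}} {g' : T' ⟶ X} {h : T ⟶ Z} {h' : T' ⟶ T} (e : h ≫ p = g)
    (e' : h' ≫ g = g') (U : X.Opens) :
    overApp (p := p) (h := h' ≫ h) (by rw [Category.assoc, e, e']) U = overApp e U ≫ overApp e' U := by
  simp [overApp, Scheme.Hom.appLE_comp_appLE]

lemma overApp_id (U : X.Opens) :
    overApp (Category.id_comp p) U = 𝟙 _ := by
  exact Z.presheaf.map_id (op (p ⁻¹ᵁ U))

section Pullback

variable {Z' : Scheme.{u}} {p' : Z' ⟶ X} {a : T ⟶ Z} {b : T ⟶ Z'}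

lemma lift_comp_fst_comp (ha : a ≫ p = g) (hb : b ≫ p' = g) :
    pullback.lift a b (ha.trans hb.symm) ≫ pullback.fst p p' ≫ p = g := by
  rw [pullback.lift_fst_assoc, ha]

lemma overApp_lift_fst (ha : a ≫ p = g) (hb : b ≫ p' = g) (U : X.Opens) (x : Γ(Z, p ⁻¹ᵁ U)) :
    overApp (lift_comp_fst_comp ha hb) U (overApp (h := pullback.fst p p') rfl U x) =
      overApp ha U x := by
  have h1 := overApp_comp (h := pullback.fst p p') rfl (lift_comp_fst_comp ha hb) U
  exact (congr($h1 x)).symm.trans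
    congr($(appLE_congr_hom (pullback.lift_fst a b (ha.trans hb.symm)) _ _) x)

lemma overApp_lift_snd (ha : a ≫ p = g) (hb : b ≫ p' = g) (U : X.Opens) (x : Γ(Z', p' ⁻¹ᵁ U)) :
    overApp (lift_comp_fst_comp ha hb) U
      (overApp (h := pullback.snd p p') pullback.condition.symm U x) = overApp hb U x := by
  have h1 := overApp_comp (h := pullback.snd p p') pullback.condition.symm
    (lift_comp_fst_comp ha hb) U
  exact (congr($h1 x)).symm.trans
    congr($(appLE_congr_hom (pullback.lift_snd a b (ha.trans hb.symm)) _ _) x)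

variable (p p') in
lemma isPushout_overApp [IsAffineHom p] [IsAffineHom p'] {U : X.Opens} (hU : IsAffineOpen U) :
    IsPushout (p.app U) (p'.app U) (overApp (h := pullback.fst p p') rfl U)
      (overApp (h := pullback.snd p p') pullback.condition.symm U) :=
  isPushout_preimage (IsPullback.of_hasPullback p p') hU

end Pullback

variable [IsAffineHom p]

/-- Morphisms into an affine `X`-scheme are determined by sections over affine opens. -/
lemma hom_ext_of_overApp {h h' : T ⟶ Z} (e : h ≫ p = g) (e' : h' ≫ p = g)
    (H : ∀ U : X.Opens, IsAffineOpen U → overApp e U = overApp e' U) : h = h' := by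
  refine hom_ext_of_affineOpens g fun U ↦ ?_
  rw [ι_comp_eq_toSpecΓ h (U.2.preimage p) (preimage_le_of_comp e U.1),
    ι_comp_eq_toSpecΓ h' (U.2.preimage p) (preimage_le_of_comp e' U.1)]
  have := H _ U.2
  dsimp only [overApp] at this
  rw [this]

/-- The universal property of the relative spectrum: homomorphisms of algebras over the affine opens
of `X`, compatible with restriction, define morphisms to the affine charts of `Z`, and these glue.
-/
lemma exists_hom_of_overApp (φ : ∀ U : X.Opens, IsAffineOpen U → (Γ(Z, p ⁻¹ᵁ U) ⟶ Γ(T, g ⁻¹ᵁ U)))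
    (hφ : ∀ U hU, p.app U ≫ φ U hU = g.app U)
    (hφ' : ∀ U hU V hV (h : V ≤ U), Z.presheaf.map (homOfLE (p.preimage_mono h)).op ≫ φ V hV =
      φ U hU ≫ T.presheaf.map (homOfLE (g.preimage_mono h)).op) :
    ∃ (h : T ⟶ Z) (e : h ≫ p = g), ∀ U hU, overApp e U = φ U hU := by
  obtain ⟨h, hι⟩ := exists_glue g
    (fun U ↦ (g ⁻¹ᵁ U.1).toSpecΓ ≫ Spec.map (φ U.1 U.2) ≫ (U.2.preimage p).fromSpec) fun U V hVU _ ↦ by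
      rw [← Scheme.Opens.toSpecΓ_SpecMap_presheaf_map_assoc, ← Spec.map_comp_assoc]
      refine congr((g ⁻¹ᵁ V.1).toSpecΓ ≫ Spec.map $((hφ' U.1 U.2 V.1 V.2 hVU).symm) ≫
        (U.2.preimage p).fromSpec).trans ?_
      rw [Spec.map_comp_assoc, (U.2.preimage p).map_fromSpec (V.2.preimage p)]
  have e : h ≫ p = g := by
    refine hom_ext_of_affineOpens g fun U ↦ ?_
    rw [← Category.assoc, hι, Category.assoc, Category.assoc,
      ← IsAffineOpen.SpecMap_appLE_fromSpec p U.2 (U.2.preimage p) le_rfl, ← Spec.map_comp_assoc,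
      ← Scheme.Hom.app_eq_appLE, show p.app U.1 ≫ φ U.1 U.2 = g.app U.1 from hφ U.1 U.2, Scheme.Opens.toSpecΓ_naturality_assoc, U.2.toSpecΓ_fromSpec,
      morphismRestrict_ι]
  refine ⟨h, e, fun U hU ↦ eq_of_toSpecΓ_comp_eq ?_⟩
  rw [← cancel_mono (hU.preimage p).fromSpec, Category.assoc, Category.assoc]
  exact (ι_comp_eq_toSpecΓ h (hU.preimage p) (preimage_le_of_comp e U)).symm.trans (hι ⟨U, hU⟩)

/-- A morphism between schemes affine over `X` is affine, so being an isomorphism is checked on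
functions over an affine cover of `X`. -/
lemma isIso_of_bijective_overApp [IsAffineHom g] {h : T ⟶ Z} (e : h ≫ p = g)
    (H : ∀ x : X, ∃ U : X.Opens, IsAffineOpen U ∧ x ∈ U ∧ Function.Bijective (overApp e U)) :
    IsIso h := by
  have : IsAffineHom h := by
    have : IsAffineHom (h ≫ p) := e ▸ inferInstance
    exact MorphismProperty.of_postcomp (W := @IsAffineHom) (W' := @IsSeparated) _ p inferInstance this
  choose U hU hx hb using H
  have hc : ⨆ x, p ⁻¹ᵁ U x = ⊤ := by
    rw [← Scheme.Hom.preimage_iSup, show ⨆ x, U x = ⊤ from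
      top_le_iff.mp fun x _ ↦ Opens.mem_iSup.mpr ⟨x, hx x⟩]
    rfl
  rw [← MorphismProperty.isomorphisms.iff,
    IsZariskiLocalAtTarget.iff_of_iSup_eq_top (P := .isomorphisms Scheme) _ hc]
  intro x
  refine (isIso_morphismRestrict_iff_isIso_app _ ((hU x).preimage p)).mpr ?_
  have h1 : h ⁻¹ᵁ p ⁻¹ᵁ U x = g ⁻¹ᵁ U x := by rw [← Scheme.Hom.comp_preimage, e]
  rw [Scheme.Hom.app_eq_appLE]
  refine (h.appLE_congr _ rfl h1 (fun φ ↦ IsIso φ)).mpr ?_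
  exact (ConcreteCategory.isIso_iff_bijective _).mpr (hb x)

end

/-! ### The relative spectrum of a quasi-coherent subalgebra of `f_* 𝒪_Y`. -/

section

open Scheme.AffineZariskiSite

variable {X Y : Scheme.{u}} (f : Y ⟶ X)

lemma isLocalization_preimage_basicOpen [QuasiCompact f] [QuasiSeparated f] {U : X.Opens}
    (hU : IsAffineOpen U) (r : Γ(X, U)) :
    letI : Algebra Γ(Y, f ⁻¹ᵁ U) Γ(Y, f ⁻¹ᵁ X.basicOpen r) :=
      (Y.presheaf.map (homOfLE (f.preimage_mono (X.basicOpen_le r))).op).hom.toAlgebra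
    IsLocalization.Away (f.app U r) Γ(Y, f ⁻¹ᵁ X.basicOpen r) := by
  let : Algebra Γ(Y, f ⁻¹ᵁ U) Γ(Y, Y.basicOpen (f.app _ r)) :=
    (Y.presheaf.map (homOfLE (Y.basicOpen_le _)).op).hom.toAlgebra
  dsimp +instances
  rw! (castMode := .all) [f.preimage_basicOpen r]
  exact isLocalization_basicOpen_of_qcqs (f.isCompact_preimage hU.isCompact)
      (f.isQuasiSeparated_preimage hU.isQuasiSeparated) (f.app _ r)

/-- A quasi-coherent sheaf of subalgebras of `f_* 𝒪_Y`. -/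
structure QcohSubalgebra where
  obj (U : X.Opens) : Subring Γ(Y, f ⁻¹ᵁ U)
  app_mem {U : X.Opens} (a : Γ(X, U)) : f.app U a ∈ obj U
  map_mem {U V : X.Opens} (h : V ≤ U) {b : Γ(Y, f ⁻¹ᵁ U)} (hb : b ∈ obj U) :
    Y.presheaf.map (homOfLE (f.preimage_mono h)).op b ∈ obj V
  exists_mul {U : X.Opens} (hU : IsAffineOpen U) (r : Γ(X, U))
    {b : Γ(Y, f ⁻¹ᵁ X.basicOpen r)} (hb : b ∈ obj (X.basicOpen r)) :
    ∃ (n : ℕ), ∃ c ∈ obj U, Y.presheaf.map (homOfLE (f.preimage_mono (X.basicOpen_le r))).op c =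
      f.app _ (X.presheaf.map (homOfLE (X.basicOpen_le r)).op r) ^ n * b

namespace QcohSubalgebra

variable {f} (S : QcohSubalgebra f)

/-- The presheaf of rings underlying `S`. -/
def diagram : X.Opensᵒᵖ ⥤ CommRingCat.{u} where
  obj U := .of (S.obj U.unop)
  map {U V} i := CommRingCat.ofHom
    ((Y.presheaf.map (homOfLE (f.preimage_mono i.unop.le)).op).hom.restrict _ _
      fun _ hx ↦ S.map_mem i.unop.le hx)
  map_id U := by
    ext x
    exact congr($(Y.presheaf.map_id (op (f ⁻¹ᵁ U.unop))) x.1)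
  map_comp {U V W} i j := by
    ext x
    exact (Scheme.res_res (f.preimage_mono i.unop.le) (f.preimage_mono j.unop.le) x.1).symm

/-- The structure map of `S` as a presheaf of algebras. -/
def diagramMap : X.presheaf ⟶ S.diagram where
  app U := CommRingCat.ofHom ((f.app U.unop).hom.codRestrict _ S.app_mem)
  naturality {U V} i := by ext x; exact Subtype.ext congr($(f.naturality i) x)

/-- The inclusion of the sections of `S` into the sections of `f_* 𝒪_Y`. -/
def incl (U : X.Opens) : S.diagram.obj (op U) ⟶ Γ(Y, f ⁻¹ᵁ U) :=
  CommRingCat.ofHom (S.obj U).subtype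

lemma diagramMap_incl (U : X.Opens) : S.diagramMap.app (op U) ≫ S.incl U = f.app U := rfl

lemma incl_map {U V : X.Opens} (h : V ≤ U) :
    S.incl U ≫ Y.presheaf.map (homOfLE (f.preimage_mono h)).op =
      S.diagram.map (homOfLE h).op ≫ S.incl V := rfl

/-- The sections over a basic open set are a localization of those over `U`: numerators are supplied
by `exists_mul`, the inverse of `r` comes from `X`, and equality after multiplying by a power of `r`
is inherited from `f_* 𝒪_Y`. -/
lemma coequifibered [QuasiCompact f] [QuasiSeparated f] :
    ((toOpensFunctor X).op.whiskerLeft S.diagramMap).Coequifibered := by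
  refine coequifibered_iff_forall_isLocalizationAway.mpr fun U r ↦ ?_
  let inst : Algebra Γ(Y, f ⁻¹ᵁ U.1) Γ(Y, f ⁻¹ᵁ X.basicOpen r) :=
    (Y.presheaf.map (homOfLE (f.preimage_mono (X.basicOpen_le r))).op).hom.toAlgebra
  have : IsLocalization.Away ((f.app U.1) r) Γ(Y, f ⁻¹ᵁ X.basicOpen r) :=
    isLocalization_preimage_basicOpen f U.2 r
  let : Algebra (S.obj U.1) (S.obj (X.basicOpen r)) :=
    (S.diagram.map (homOfLE (X.basicOpen_le r)).op).hom.toAlgebra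
  change IsLocalization.Away (⟨f.app U.1 r, S.app_mem r⟩ : S.obj U.1) (S.obj (X.basicOpen r))
  have halg (x : S.obj U.1) : (algebraMap (S.obj U.1) (S.obj (X.basicOpen r)) x).1 =
    algebraMap Γ(Y, f ⁻¹ᵁ U.1) Γ(Y, f ⁻¹ᵁ X.basicOpen r) x.1 := rfl
  have hr : algebraMap Γ(Y, f ⁻¹ᵁ U.1) Γ(Y, f ⁻¹ᵁ X.basicOpen r) (f.app U.1 r) =
     f.app _ (X.presheaf.map (homOfLE (X.basicOpen_le r)).op r) := (app_map f (X.basicOpen_le r) r).symm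
  obtain ⟨v, hv⟩ : ∃ v : Γ(X, X.basicOpen r),
      X.presheaf.map (homOfLE (X.basicOpen_le r)).op r * v = 1 :=
    isUnit_iff_exists_inv.mp (RingedSpace.isUnit_res_basicOpen X.toRingedSpace r)
  refine IsLocalization.Away.mk _ ?_ ?_ ?_
  · refine isUnit_iff_exists_inv.mpr ⟨⟨f.app _ v, S.app_mem v⟩, Subtype.ext ?_⟩
    refine (congr($hr * f.app _ v)).trans ?_
    rw [← map_mul, hv, map_one]
    rfl
  · intro b
    obtain ⟨n, c, hc, e⟩ := S.exists_mul U.2 r b.2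
    refine ⟨n, ⟨c, hc⟩, Subtype.ext ?_⟩
    refine Eq.trans ?_ e.symm
    rw [mul_comm, ← hr]
    rfl
  · intro a b e
    obtain ⟨n, h⟩ := IsLocalization.Away.exists_of_eq (f.app U.1 r)
      (S := Γ(Y, f ⁻¹ᵁ X.basicOpen r)) (congrArg Subtype.val e :
        algebraMap Γ(Y, f ⁻¹ᵁ U.1) Γ(Y, f ⁻¹ᵁ X.basicOpen r) a.1 = algebraMap _ _ b.1)
    exact ⟨n, Subtype.ext h⟩

variable [QuasiCompact f] [QuasiSeparated f]

/-- The gluing datum of the relative spectrum. -/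
def glueData := relativeGluingData S.coequifibered

instance : (S.glueData.functor ⋙ Scheme.forget).IsLocallyDirected :=
  Scheme.Cover.RelativeGluingData.instIsLocallyDirectedI₀CompFunctorForgetOfIsThin ..

/-- The relative spectrum of a quasi-coherent sheaf of subalgebras. -/
def spec : Scheme.{u} := S.glueData.glued

/-- The structure morphism of the relative spectrum. -/
def toBase : S.spec ⟶ X := S.glueData.toBase

/-- The affine charts of the relative spectrum. -/
def ι (U : X.affineOpens) : Spec (S.diagram.obj (op U.1)) ⟶ S.spec := S.glueData.cover.f U

instance (U : X.affineOpens) : IsOpenImmersion (S.ι U) :=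
  S.glueData.cover.map_prop U

lemma ι_toBase (U : X.affineOpens) (hU : IsAffineOpen U.1) :
    S.ι U ≫ S.toBase = Spec.map (S.diagramMap.app (op U.1)) ≫ hU.fromSpec :=
  colimit.ι_desc _ _

lemma toBase_preimage (U : X.affineOpens) :
    S.toBase ⁻¹ᵁ U = (S.ι U).opensRange := by
  simpa using! S.glueData.toBase_preimage_eq_opensRange_ι U

lemma map_ι {U V : X.affineOpens} (h : V.1 ≤ U.1) (hr : ∃ r, X.basicOpen (U := U.1) r = V.1) :
    Spec.map (S.diagram.map (homOfLE h).op) ≫ S.ι U = S.ι V :=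
  colimit.w S.glueData.functor (homOfLE (X := X.AffineZariskiSite) (x := V) (y := U) hr)

instance : IsAffineHom S.toBase where
  isAffine_preimage U hU := by
    rw [S.toBase_preimage ⟨U, hU⟩]
    exact isAffineOpen_opensRange (S.ι ⟨U, hU⟩)

lemma exists_fromTotal : ∃ h : Y ⟶ S.spec, ∀ U : X.affineOpens, (f ⁻¹ᵁ U.1).ι ≫ h =
    (f ⁻¹ᵁ U.1).toSpecΓ ≫ Spec.map (S.incl U.1) ≫ S.ι U := by
  refine exists_glue f _ fun U V hVU hr ↦ ?_
  rw [← Scheme.Opens.toSpecΓ_SpecMap_presheaf_map_assoc, ← Spec.map_comp_assoc, S.incl_map,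
    ← S.map_ι hVU hr, Spec.map_comp_assoc]

/-- The morphism from the ambient scheme to the relative spectrum. -/
def fromTotal : Y ⟶ S.spec := S.exists_fromTotal.choose

lemma ι_fromTotal (U : X.affineOpens) :
    (f ⁻¹ᵁ U.1).ι ≫ S.fromTotal = (f ⁻¹ᵁ U.1).toSpecΓ ≫
      Spec.map (S.incl U.1) ≫ S.ι U :=
  S.exists_fromTotal.choose_spec U

lemma fromTotal_toBase : S.fromTotal ≫ S.toBase = f := by
  refine hom_ext_of_affineOpens f fun U ↦ ?_
  have hU : IsAffineOpen U.1 := U.2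
  rw [← Category.assoc, S.ι_fromTotal, Category.assoc, Category.assoc, S.ι_toBase U hU,
    ← Spec.map_comp_assoc, diagramMap_incl, Scheme.Opens.toSpecΓ_naturality_assoc,
    hU.toSpecΓ_fromSpec, morphismRestrict_ι]

/-- The chart identifies the preimage of `U` with the spectrum of the sections over `U`; under this
identification pullback to `Y` is the inclusion of the subalgebra. -/
lemma exists_overApp_eq {U : X.Opens} (hU : IsAffineOpen U) :
    ∃ θ : Γ(S.spec, S.toBase ⁻¹ᵁ U) ⟶ S.diagram.obj (op U), IsIso θ ∧
      overApp S.fromTotal_toBase U = θ ≫ S.incl U := by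
  have hW : IsAffineOpen (S.toBase ⁻¹ᵁ U) := hU.preimage _
  have hr : Set.range (S.ι ⟨U, hU⟩) = Set.range hW.fromSpec := by
    rw [hW.range_fromSpec, S.toBase_preimage ⟨U, hU⟩]
    rfl
  let i := IsOpenImmersion.isoOfRangeEq (S.ι ⟨U, hU⟩) hW.fromSpec hr
  have hi : i.hom ≫ hW.fromSpec = S.ι ⟨U, hU⟩ := IsOpenImmersion.isoOfRangeEq_hom_fac _ _ hr
  have hθ : Spec.map (Spec.preimage i.hom) = i.hom := Spec.map_preimage _
  have hθi : IsIso (Spec.preimage i.hom) := by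
    exact (ConcreteCategory.isIso_iff_bijective _).mpr
      (isIso_SpecMap_iff.mp (by rw [hθ]; infer_instance))
  refine ⟨Spec.preimage i.hom, hθi, eq_of_toSpecΓ_comp_eq ?_⟩
  rw [← cancel_mono hW.fromSpec, Category.assoc, Category.assoc, Spec.map_comp, Category.assoc, hθ,
    hi]
  exact (ι_comp_eq_toSpecΓ S.fromTotal hW (preimage_le_of_comp S.fromTotal_toBase U)).symm.trans
    (S.ι_fromTotal ⟨U, hU⟩)

lemma overApp_fromTotal_injective {U : X.Opens} (hU : IsAffineOpen U) :
    Function.Injective (overApp S.fromTotal_toBase U) := by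
  obtain ⟨θ, hθ, h⟩ := S.exists_overApp_eq hU
  rw [h]
  exact Subtype.val_injective.comp (ConcreteCategory.bijective_of_isIso θ).1

lemma mem_range_overApp_fromTotal {U : X.Opens} (hU : IsAffineOpen U) (b : Γ(Y, f ⁻¹ᵁ U)) :
    (∃ z, overApp S.fromTotal_toBase U z = b) ↔ b ∈ S.obj U := by
  obtain ⟨θ, hθ, h⟩ := S.exists_overApp_eq hU
  rw [h]
  refine ⟨fun ⟨z, hz⟩ ↦ hz ▸ (θ z).2, fun hb ↦ ?_⟩
  obtain ⟨z, hz⟩ := (ConcreteCategory.bijective_of_isIso θ).2 ⟨b, hb⟩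
  exact ⟨z, congrArg Subtype.val hz⟩

end QcohSubalgebra

end

/-! ### Eigenspace decomposition for an action of `ℤ/m` on a ring in which `m` is invertible. -/

section

lemma sum_pow_mul_of_not_dvd {R : Type*} [CommRing R] [IsDomain R] {ζ : R} {m : ℕ}
    (hζ : IsPrimitiveRoot ζ m) {l : ℕ} (hl : ¬ m ∣ l) : ∑ k ∈ Finset.range m, ζ ^ (k * l) = 0 := by
  have h1 : ζ ^ l - 1 ≠ 0 := fun h ↦ hl (hζ.dvd_of_pow_eq_one l (sub_eq_zero.mp h))
  have h2 := mul_geom_sum (ζ ^ l) m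
  rw [← pow_mul, mul_comm l m, pow_mul, hζ.pow_eq_one, one_pow, sub_self] at h2
  simp only [← pow_mul, mul_comm l] at h2
  exact (mul_eq_zero.mp h2).resolve_left h1

/-- An `m`-th root of unity all of whose nontrivial character sums vanish, in a ring in which
`m` is invertible. -/
structure RootDatum (m : ℕ) (B : Type*) [CommRing B] where
  z : B
  w : B
  z_pow : z ^ m = 1
  -- Orthogonality of characters stands in for primitivity: it is preserved by ring homomorphisms,
  -- even into rings with zero divisors.
  sum_pow : ∀ k, ¬ m ∣ k → ∑ j ∈ Finset.range m, z ^ (k * j) = 0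
  w_mul : w * m = 1

/-- The image of a root datum under a ring homomorphism. -/
def RootDatum.map {m : ℕ} {B C : Type*} [CommRing B] [CommRing C] (D : RootDatum m B)
    (φ : B →+* C) : RootDatum m C where
  z := φ D.z
  w := φ D.w
  z_pow := by rw [← map_pow, D.z_pow, map_one]
  sum_pow k hk := by
    simp only [← map_pow]
    rw [← map_sum, D.sum_pow k hk, map_zero]
  w_mul := by rw [← map_natCast φ, ← map_mul, D.w_mul, map_one]

/-- A primitive root of unity in a field of characteristic zero. -/
def RootDatum.ofPrimitiveRoot {m : ℕ} [NeZero m] {K : Type*} [Field K] [CharZero K] {ζ : K}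
    (hζ : IsPrimitiveRoot ζ m) : RootDatum m K where
  z := ζ
  w := (m : K)⁻¹
  z_pow := hζ.pow_eq_one
  sum_pow k hk := by
    simpa only [mul_comm k] using sum_pow_mul_of_not_dvd hζ hk
  w_mul := inv_mul_cancel₀ (NeZero.ne _)

/-- An action of `ℤ/m` on a ring in which `m` is invertible, together with an invariant `m`-th
root of unity all of whose nontrivial character sums vanish. -/
structure CyclicAction (m : ℕ) (B : Type*) [CommRing B] extends RootDatum m B where
  σ : B →+* B
  σ_z : σ z = z
  iterate : ∀ b, σ^[m] b = b

namespace CyclicAction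

variable {m : ℕ} {B : Type*} [CommRing B] (S : CyclicAction m B)

/-- Elements of degree `i`. -/
def Homog (i : ℕ) (b : B) : Prop := S.σ b = S.z ^ i * b

/-- The projection to degree `i`. -/
def proj (i : ℕ) (b : B) : B :=
  -- The exponent `(m - 1) * i * j` represents `-i * j`, since `z ^ m = 1`.
  S.w * ∑ j ∈ Finset.range m, S.z ^ ((m - 1) * i * j) * S.σ^[j] b

variable {S}

lemma z_pow_of_dvd {k : ℕ} (h : m ∣ k) : S.z ^ k = 1 := by
  obtain ⟨l, rfl⟩ := h
  rw [pow_mul, S.z_pow, one_pow]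

lemma z_pow_congr {i k : ℕ} (h : i ≡ k [MOD m]) : S.z ^ i = S.z ^ k := by
  rw [← Nat.mod_add_div i m, ← Nat.mod_add_div k m, pow_add, pow_add,
    z_pow_of_dvd (dvd_mul_right _ _), z_pow_of_dvd (dvd_mul_right _ _), h]

lemma Homog.congr {i k : ℕ} {b : B} (hb : S.Homog i b) (h : i ≡ k [MOD m]) : S.Homog k b := by
  rw [Homog, ← z_pow_congr h]
  exact hb

lemma Homog.mul {i k : ℕ} {b c : B} (hb : S.Homog i b) (hc : S.Homog k c) :
    S.Homog (i + k) (b * c) := by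
  rw [Homog] at *
  rw [map_mul, hb, hc]
  ring

lemma Homog.pow {i : ℕ} {b : B} (hb : S.Homog i b) (k : ℕ) : S.Homog (i * k) (b ^ k) := by
  rw [Homog] at *
  rw [map_pow, hb]
  ring

/-- The factor `σ c = z ^ k * c` is a unit and can be cancelled; this determines degrees of inverses
and quotients by homogeneous units. -/
lemma Homog.of_mul {i k : ℕ} {b c : B} (hc : S.Homog k c) (hcu : IsUnit c)
    (h : S.Homog (i + k) (b * c)) : S.Homog i b := by
  rw [Homog] at *
  have hu : IsUnit (S.z ^ k * c) := by
    rw [← hc]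
    exact hcu.map S.σ
  refine hu.mul_right_cancel ?_
  rw [map_mul, hc] at h
  rw [h]
  ring

lemma homog_zero_iff {b : B} : S.Homog 0 b ↔ S.σ b = b := by rw [Homog, pow_zero, one_mul]

lemma homog_one : S.Homog 0 1 := by simp [homog_zero_iff]

lemma Homog.pow_card {i : ℕ} {b : B} (hb : S.Homog i b) : S.Homog 0 (b ^ m) :=
  (hb.pow m).congr (by simp [Nat.ModEq])

lemma Homog.iterate {i : ℕ} {b : B} (hb : S.Homog i b) (j : ℕ) :
    S.σ^[j] b = S.z ^ (i * j) * b := by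
  induction j with
  | zero => simp
  | succ j ih =>
    rw [Function.iterate_succ_apply', ih, map_mul, map_pow, S.σ_z, hb]
    ring

lemma iterate_of_fixed {b : B} (hb : S.σ b = b) (j : ℕ) : S.σ^[j] b = b :=
  Function.iterate_fixed hb j

lemma proj_add (i : ℕ) (b c : B) : S.proj i (b + c) = S.proj i b + S.proj i c := by
  simp only [proj, iterate_map_add, mul_add, Finset.sum_add_distrib]

lemma proj_zero (i : ℕ) : S.proj i 0 = 0 := by
  simp [proj, iterate_map_zero]

lemma proj_sum {ι : Type*} (i : ℕ) (s : Finset ι) (b : ι → B) :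
    S.proj i (∑ k ∈ s, b k) = ∑ k ∈ s, S.proj i (b k) :=
  map_sum (⟨⟨S.proj i, proj_zero i⟩, proj_add i⟩ : B →+ B) b s

lemma proj_neg (i : ℕ) (b : B) : S.proj i (-b) = -S.proj i b :=
  map_neg (⟨⟨S.proj i, proj_zero i⟩, proj_add i⟩ : B →+ B) b

/-- On an element of degree `i` the projection multiplies by the average of `z ^ ((i - k) * j)` over
`j`, which is `1` or `0` by orthogonality. -/
lemma proj_of_homog [NeZero m] {i : ℕ} {b : B} (hb : S.Homog i b) (k : ℕ) :
    S.proj k b = if i ≡ k [MOD m] then b else 0 := by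
  have hm : 1 ≤ m := NeZero.one_le
  have h1 : S.proj k b = S.w * ((∑ j ∈ Finset.range m, S.z ^ (((m - 1) * k + i) * j)) * b) := by
    rw [proj, Finset.sum_mul]
    congr 1
    refine Finset.sum_congr rfl fun j _ ↦ ?_
    rw [hb.iterate]
    ring
  have h2 : (m ∣ (m - 1) * k + i) ↔ i ≡ k [MOD m] := by
    have h3 : (m - 1) * k + i + k = m * k + i := by
      obtain ⟨n, rfl⟩ := Nat.exists_eq_add_of_le hm
      rw [Nat.add_sub_cancel_left]
      ring
    rw [← Nat.modEq_zero_iff_dvd]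
    have h5 : m * k + i ≡ i [MOD m] := by simp [Nat.ModEq]
    constructor
    · intro h
      have := h.add_right k
      rw [h3, zero_add] at this
      exact h5.symm.trans this
    · intro h
      refine Nat.ModEq.add_right_cancel' k ?_
      rw [h3, zero_add]
      exact h5.trans h
  rw [h1]
  split_ifs with h
  · have h4 : ∀ j ∈ Finset.range m, S.z ^ (((m - 1) * k + i) * j) = 1 := fun j _ ↦
      z_pow_of_dvd ((h2.mpr h).mul_right j)
    rw [Finset.sum_congr rfl h4, Finset.sum_const, Finset.card_range, nsmul_eq_mul, mul_one,
      ← mul_assoc, S.w_mul, one_mul]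
  · rw [S.sum_pow _ (fun hh ↦ h (h2.mp hh)), zero_mul, mul_zero]

lemma σ_w : S.σ S.w = S.w := by
  have h := congr(S.σ $(S.w_mul))
  rw [map_mul, map_natCast, map_one] at h
  calc S.σ S.w = S.σ S.w * (S.w * m) := by rw [S.w_mul, mul_one]
    _ = (S.σ S.w * m) * S.w := by ring
    _ = S.w := by rw [h, one_mul]

lemma homog_proj [NeZero m] (i : ℕ) (b : B) : S.Homog i (S.proj i b) := by
  have hm : 1 ≤ m := NeZero.one_le
  let g (j : ℕ) : B := S.z ^ ((m - 1) * i * j) * S.σ^[j] b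
  have hg : g m = g 0 := by
    simp only [g]
    rw [S.iterate, z_pow_of_dvd (dvd_mul_left _ _), mul_zero, pow_zero, Function.iterate_zero_apply]
  -- Applying `σ` shifts the summation index, and the shift is cyclic because `g m = g 0`.
  have h1 : ∑ j ∈ Finset.range m, g (j + 1) = ∑ j ∈ Finset.range m, g j := by
    have := (Finset.sum_range_succ g m).symm.trans (Finset.sum_range_succ' g m)
    rw [hg] at this
    exact (add_right_cancel this).symm
  have h2 (j : ℕ) : S.σ (g j) = S.z ^ i * g (j + 1) := by
    have h3 : i + (m - 1) * i * (j + 1) = (m - 1) * i * j + m * i := by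
      obtain ⟨n, hn⟩ := Nat.exists_eq_add_of_le hm
      subst hn
      rw [Nat.add_sub_cancel_left]
      ring
    simp only [g]
    rw [map_mul, map_pow, S.σ_z, ← mul_assoc, ← pow_add, h3, pow_add,
      z_pow_of_dvd (dvd_mul_right m i), mul_one, Function.iterate_succ_apply']
  rw [Homog, proj, map_mul, map_sum, σ_w]
  change S.w * ∑ j ∈ Finset.range m, S.σ (g j) = S.z ^ i * (S.w * ∑ j ∈ Finset.range m, g j)
  rw [← h1, Finset.sum_congr rfl fun j _ ↦ h2 j, ← Finset.mul_sum]
  ring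

/-- Summing over the degree first, orthogonality kills every term except `j = 0`. -/
lemma sum_proj [NeZero m] (b : B) : ∑ i ∈ Finset.range m, S.proj i b = b := by
  have hm : 1 ≤ m := NeZero.one_le
  have h1 (j : ℕ) (hj : j ∈ Finset.range m) (h0 : j ≠ 0) :
      ∑ i ∈ Finset.range m, S.z ^ ((m - 1) * i * j) * S.σ^[j] b = 0 := by
    rw [← Finset.sum_mul]
    have h2 : ∑ i ∈ Finset.range m, S.z ^ ((m - 1) * i * j) = 0 := by
      rw [← S.sum_pow ((m - 1) * j)]
      · refine Finset.sum_congr rfl fun i _ ↦ ?_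
        congr 1
        ring
      · intro h
        have h3 : (m - 1) * j + j = m * j := by
          obtain ⟨n, hn⟩ := Nat.exists_eq_add_of_le hm
          subst hn
          rw [Nat.add_sub_cancel_left]
          ring
        have h4 : m ∣ j := (Nat.dvd_add_right h).mp (h3 ▸ dvd_mul_right m j)
        exact absurd (Nat.le_of_dvd (Nat.pos_of_ne_zero h0) h4) (not_le.mpr (Finset.mem_range.mp hj))
    rw [h2, zero_mul]
  simp only [proj]
  rw [← Finset.mul_sum, Finset.sum_comm, Finset.sum_eq_single_of_mem 0 (Finset.mem_range.mpr hm) h1]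
  simp only [mul_zero, pow_zero, one_mul, Function.iterate_zero_apply, Finset.sum_const,
    Finset.card_range, nsmul_eq_mul, ← mul_assoc, S.w_mul]

lemma proj_eq_of_sum [NeZero m] (x : ℕ → B) (hx : ∀ i, S.Homog i (x i)) {k : ℕ} (hk : k < m) :
    S.proj k (∑ i ∈ Finset.range m, x i) = x k := by
  rw [proj_sum, Finset.sum_eq_single_of_mem k (Finset.mem_range.mpr hk), proj_of_homog (hx k),
    if_pos (Nat.ModEq.refl k)]
  intro i hi hik
  rw [proj_of_homog (hx i), if_neg]
  intro h
  exact hik (Nat.ModEq.eq_of_lt_of_lt h (Finset.mem_range.mp hi) hk)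

lemma proj_map {C : Type*} [CommRing C] {S' : CyclicAction m C} (φ : B →+* C)
    (hφ : ∀ b, φ (S.σ b) = S'.σ (φ b)) (hz : φ S.z = S'.z) (i : ℕ) (b : B) :
    φ (S.proj i b) = S'.proj i (φ b) := by
  have hw : φ S.w = S'.w := by
    have h := congr(φ $(S.w_mul))
    rw [map_mul, map_natCast, map_one] at h
    calc φ S.w = φ S.w * (S'.w * m) := by rw [S'.w_mul, mul_one]
      _ = (φ S.w * m) * S'.w := by ring
      _ = S'.w := by rw [h, one_mul]
  have hi (j : ℕ) : φ (S.σ^[j] b) = S'.σ^[j] (φ b) :=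
    (Function.Semiconj.iterate_right (f := φ) (ga := S.σ) (gb := S'.σ) hφ j) b
  simp only [proj, map_mul, map_sum, map_pow, hw, hz, hi]

/-- If `∑ bᵢ gᵏ(cᵢ)` is `1` for `k = 0` and vanishes otherwise, then
the product of the parts of degree `1` and `-1` contains `1`. -/
lemma exists_sum_homog [NeZero m] {n : ℕ} {b c : Fin n → B}
    (h : ∀ k < m, ∑ i, b i * S.σ^[k] (c i) = if k = 0 then 1 else 0) :
    ∃ b' c' : Fin n → B, (∀ i, S.Homog (m - 1) (b' i)) ∧ (∀ i, S.Homog 1 (c' i)) ∧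
      ∑ i, b' i * c' i = 1 := by
  have hm : 1 ≤ m := NeZero.one_le
  -- Averaging the relations over `k` leaves only `k = 0`, weighted by the inverse `w` of `m`.
  have h1 : ∑ i, b i * S.proj 1 (c i) = S.w := by
    have h2 : ∑ i, b i * S.proj 1 (c i) =
        S.w * ∑ j ∈ Finset.range m, S.z ^ ((m - 1) * 1 * j) * ∑ i, b i * S.σ^[j] (c i) := by
      simp only [proj, Finset.mul_sum]
      rw [Finset.sum_comm]
      exact Finset.sum_congr rfl fun j _ ↦ Finset.sum_congr rfl fun i _ ↦ by ring
    rw [h2, Finset.sum_eq_single_of_mem 0 (Finset.mem_range.mpr hm), h 0 hm]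
    · simp
    · intro j hj h0
      rw [h j (Finset.mem_range.mp hj), if_neg h0, mul_zero]
  -- Only the part of `b i` of degree `m - 1`, that is `-1`, contributes to the degree-zero part of
  -- the product.
  have h3 (i : Fin n) : S.proj 0 (b i * S.proj 1 (c i)) = S.proj (m - 1) (b i) * S.proj 1 (c i) := by
    conv_lhs => rw [← sum_proj (S := S) (b i), Finset.sum_mul, proj_sum]
    rw [Finset.sum_eq_single_of_mem (m - 1) (Finset.mem_range.mpr (Nat.sub_lt hm one_pos)),
      proj_of_homog ((homog_proj _ _).mul (homog_proj _ _)), if_pos]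
    · rw [Nat.sub_add_cancel hm]
      simp [Nat.ModEq]
    · intro j hj h0
      rw [proj_of_homog ((homog_proj _ _).mul (homog_proj _ _)), if_neg]
      intro hh
      have h4 : m ∣ j + 1 := (Nat.modEq_zero_iff_dvd).mp hh
      have h5 := Nat.le_of_dvd (Nat.succ_pos _) h4
      have h6 := Finset.mem_range.mp hj
      omega
  -- The factor `m` compensates for the value `w` of the sum in `h1`.
  refine ⟨fun i ↦ m * S.proj (m - 1) (b i), fun i ↦ S.proj 1 (c i), fun i ↦ ?_,
    fun i ↦ homog_proj _ _, ?_⟩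
  · have h7 : S.Homog 0 (m : B) := homog_zero_iff.mpr (map_natCast _ _)
    simpa only [zero_add] using h7.mul (homog_proj (m - 1) (b i))
  · have h8 := congr(S.proj 0 $h1)
    rw [proj_sum, Finset.sum_congr rfl fun i _ ↦ h3 i, proj_of_homog (homog_zero_iff.mpr σ_w),
      if_pos (Nat.ModEq.refl 0)] at h8
    simp only [mul_assoc]
    rw [← Finset.mul_sum, h8, mul_comm, S.w_mul]

section Integral

variable {A : Type*} [CommRing A] (φ : A →+* B)

/-- The subring generated by the homogeneous elements integral over `A`. -/
def integralSubring [NeZero m] (_ : ∀ a, S.σ (φ a) = φ a) : Subring B where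
  -- This is not the integral closure of `A`: the projections divide by `m`, which need not be
  -- invertible in `A`, so an integral element can have non-integral components.
  carrier := {b | ∀ i, φ.IsIntegralElem (S.proj i b)}
  zero_mem' i := by rw [proj_zero]; exact φ.isIntegralElem_zero
  one_mem' i := by
    rw [proj_of_homog homog_one]
    split_ifs
    exacts [φ.isIntegralElem_one, φ.isIntegralElem_zero]
  add_mem' ha hb i := by rw [proj_add]; exact (ha i).add φ (hb i)
  neg_mem' ha i := by rw [proj_neg]; exact (ha i).neg φ
  mul_mem' {a b} ha hb k := by
    let : Algebra A B := φ.toAlgebra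
    conv => enter [2]; rw [← sum_proj (S := S) a, ← sum_proj (S := S) b, Finset.sum_mul_sum, proj_sum]
    refine IsIntegral.sum (R := A) _ fun i _ ↦ ?_
    rw [proj_sum]
    refine IsIntegral.sum (R := A) _ fun j _ ↦ ?_
    rw [proj_of_homog ((homog_proj _ _).mul (homog_proj _ _))]
    split_ifs
    exacts [(ha i).mul φ (hb j), φ.isIntegralElem_zero]

variable [NeZero m] (hφ : ∀ a, S.σ (φ a) = φ a)

lemma Homog.mem_integralSubring {i : ℕ} {b : B} (hb : S.Homog i b) (h : φ.IsIntegralElem b) :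
    b ∈ S.integralSubring φ hφ := fun k ↦ by
  rw [proj_of_homog hb]
  split_ifs
  exacts [h, φ.isIntegralElem_zero]

lemma map_mem_integralSubring (a : A) : φ a ∈ S.integralSubring φ hφ :=
  Homog.mem_integralSubring φ hφ (homog_zero_iff.mpr (hφ a)) (φ.isIntegralElem_map)

lemma proj_mem_integralSubring {b : B} (hb : b ∈ S.integralSubring φ hφ) (i : ℕ) :
    S.proj i b ∈ S.integralSubring φ hφ :=
  (homog_proj i b).mem_integralSubring φ hφ (hb i)

end Integral

end CyclicAction

end

/-! ### Functions defined by a morphism to an affine scheme; points of `μ_m` and their coordinates.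
-/

section

section SecOf

variable {A : Type u} [CommRing A] {Z : Scheme.{u}}

lemma le_preimage_top {W : Scheme.{u}} (s : Z ⟶ W) (U : Z.Opens) : U ≤ s ⁻¹ᵁ ⊤ := le_top

/-- The functions on open subsets of `Z` defined by a morphism to `Spec A`. -/
def secOf (s : Z ⟶ Spec (.of A)) (U : Z.Opens) : A →+* Γ(Z, U) :=
  ((Scheme.ΓSpecIso (.of A)).inv ≫ s.appLE ⊤ U (le_preimage_top s U)).hom

lemma appLE_secOf {W : Scheme.{u}} (h : W ⟶ Z) (s : Z ⟶ Spec (.of A)) {U : Z.Opens} {V : W.Opens}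
    (e : V ≤ h ⁻¹ᵁ U) (a : A) : h.appLE U V e (secOf s U a) = secOf (h ≫ s) V a := by
  have : ((Scheme.ΓSpecIso (.of A)).inv ≫ s.appLE ⊤ U (le_preimage_top s U)) ≫ h.appLE U V e =
      (Scheme.ΓSpecIso (.of A)).inv ≫ (h ≫ s).appLE ⊤ V (le_preimage_top _ _) := by
    rw [Category.assoc, Scheme.Hom.appLE_comp_appLE]
  exact congr($this a)

lemma app_secOf {W : Scheme.{u}} (h : W ⟶ Z) (s : Z ⟶ Spec (.of A)) (U : Z.Opens)
    (a : A) : h.app U (secOf s U a) = secOf (h ≫ s) (h ⁻¹ᵁ U) a := by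
  rw [Scheme.Hom.app_eq_appLE, appLE_secOf]

lemma map_secOf (s : Z ⟶ Spec (.of A)) {U V : Z.Opens} (e : V ≤ U) (a : A) :
    Z.presheaf.map (homOfLE e).op (secOf s U a) = secOf s V a := by
  have : ((Scheme.ΓSpecIso (.of A)).inv ≫ s.appLE ⊤ U (le_preimage_top s U)) ≫ Z.presheaf.map (homOfLE e).op =
      (Scheme.ΓSpecIso (.of A)).inv ≫ s.appLE ⊤ V (le_preimage_top _ _) := by
    rw [Category.assoc, Scheme.Hom.appLE_map]
  exact congr($this a)

lemma secOf_comp_specMap {B : Type u} [CommRing B] (φ : A →+* B) (s : Z ⟶ Spec (.of B))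
    (U : Z.Opens) (a : A) : secOf (s ≫ Spec.map (CommRingCat.ofHom φ)) U a = secOf s U (φ a) := by
  have : (Scheme.ΓSpecIso (.of A)).inv ≫ (s ≫ Spec.map (CommRingCat.ofHom φ)).appLE ⊤ U (le_preimage_top _ _) =
      CommRingCat.ofHom φ ≫ (Scheme.ΓSpecIso (.of B)).inv ≫ s.appLE ⊤ U (le_preimage_top s U) := by
    rw [Scheme.ΓSpecIso_inv_naturality_assoc, ← Scheme.Hom.appLE_comp_appLE _ _ ⊤ ⊤ U (le_preimage_top _ _) (le_preimage_top _ _)]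
    congr 2
  exact congr($this a)

end SecOf

section MuGrp

open MonoidalCategory CartesianMonoidalCategory

variable (m : ℕ) (R : Type u) [CommRing R]

/-- The Hopf algebra of `μ_m`. -/
abbrev MuAlgebra : Type u := MonoidAlgebra R (Multiplicative (ZMod m))

/-- The coordinate function on `μ_m`. -/
abbrev muCoord : MuAlgebra m R := MonoidAlgebra.of R _ (Multiplicative.ofAdd 1)

lemma muCoord_pow (k : ℕ) :
    muCoord m R ^ k = MonoidAlgebra.of R _ (Multiplicative.ofAdd (k : ZMod m)) := by
  rw [← map_pow, ← ofAdd_nsmul, nsmul_one]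

lemma muCoord_pow_card : muCoord m R ^ m = 1 := by
  rw [muCoord_pow, ZMod.natCast_self, ofAdd_zero, map_one]

lemma exists_sum_muCoord [NeZero m] (x : MuAlgebra m R) :
    ∃ r : ℕ → R, x = ∑ i ∈ Finset.range m, algebraMap R _ (r i) * muCoord m R ^ i := by
  induction x using MonoidAlgebra.induction_on with
  | of g =>
    refine ⟨fun i ↦ if i = (Multiplicative.toAdd g).val then 1 else 0, ?_⟩
    rw [Finset.sum_eq_single_of_mem (Multiplicative.toAdd g).val
      (Finset.mem_range.mpr (ZMod.val_lt _))]
    · dsimp only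
      rw [if_pos rfl, map_one, one_mul, muCoord_pow, ZMod.natCast_zmod_val, ofAdd_toAdd]
    · intro i _ h
      dsimp only
      rw [if_neg h, map_zero, zero_mul]
  | add x y hx hy =>
    obtain ⟨r, hr⟩ := hx
    obtain ⟨r', hr'⟩ := hy
    refine ⟨r + r', ?_⟩
    simp only [Pi.add_apply, map_add, add_mul, Finset.sum_add_distrib]
    rw [← hr, ← hr']
  | smul a x hx =>
    obtain ⟨r, hr⟩ := hx
    refine ⟨a • r, ?_⟩
    simp only [Pi.smul_apply, smul_eq_mul, map_mul, mul_assoc]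
    rw [← Finset.mul_sum, ← hr, Algebra.smul_def]

variable {m R}

/-- A point of `μ_m`, as a morphism of schemes. -/
abbrev muLeft {Z : Over (Spec (.of R))} (f : Z ⟶ (muGrp m R).X) :
    Z.left ⟶ Spec (.of (MuAlgebra m R)) := f.left

/-- The value of the coordinate of `μ_m` at a point. -/
def coord {Z : Over (Spec (.of R))} (f : Z ⟶ (muGrp m R).X) (U : Z.left.Opens) : Γ(Z.left, U) :=
  secOf (muLeft f) U (muCoord m R)

lemma coord_pow_card {Z : Over (Spec (.of R))} (f : Z ⟶ (muGrp m R).X) (U : Z.left.Opens) :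
    coord f U ^ m = 1 := by
  rw [coord, ← map_pow, muCoord_pow_card, map_one]

lemma appLE_coord {Z W : Over (Spec (.of R))} (h : W ⟶ Z) (f : Z ⟶ (muGrp m R).X)
    {U : Z.left.Opens} {V : W.left.Opens} (e : V ≤ h.left ⁻¹ᵁ U) :
    h.left.appLE U V e (coord f U) = coord (h ≫ f) V :=
  appLE_secOf h.left _ e _

lemma coord_one {Z : Over (Spec (.of R))} (h : Z ⟶ 𝟙_ _) (U : Z.left.Opens) :
    coord (h ≫ MonObj.one (X := (muGrp m R).X)) U = 1 := by
  have h1 : (MonObj.one (X := (muGrp m R).X)).left =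
      Spec.map (CommRingCat.ofHom (Bialgebra.counitAlgHom R (MuAlgebra m R)).toRingHom) := rfl
  refine (congrArg (fun k ↦ secOf (A := MuAlgebra m R) (h.left ≫ k) U (muCoord m R)) h1).trans ?_
  refine (secOf_comp_specMap _ h.left U _).trans ?_
  have : Bialgebra.counitAlgHom R (MuAlgebra m R) (muCoord m R) = 1 := by simp
  exact (congrArg _ this).trans (map_one _)

lemma coord_muSection {Z : Over (Spec (.of R))} (h : Z ⟶ 𝟙_ _) (ζ : rootsOfUnity m R)
    (U : Z.left.Opens) : coord (h ≫ muSection ζ) U = secOf h.left U ((ζ : Rˣ) : R) := by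
  refine (secOf_comp_specMap _ h.left U _).trans ?_
  congr 1
  change MonoidAlgebra.lift R R (Multiplicative (ZMod m))
      ((Units.coeHom R).comp (zmodPowHom ζ)) (MonoidAlgebra.of R _ (Multiplicative.ofAdd 1)) = _
  rw [MonoidAlgebra.lift_of]
  change ((zmodPowHom ζ (Multiplicative.ofAdd 1) : Rˣ) : R) = _
  refine congrArg Units.val ?_
  have h2 := ZMod.lift_coe m ⟨zmultiplesHom (Additive Rˣ) (Additive.ofMul (ζ : Rˣ)), by
      have h : (ζ : Rˣ) ^ m = 1 := (mem_rootsOfUnity m _).1 ζ.2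
      rw [zmultiplesHom_apply, natCast_zsmul, ← ofMul_pow, h, ofMul_one]⟩ 1
  rw [Int.cast_one] at h2
  exact congrArg Additive.toMul (h2.trans (one_zsmul _))

/-- Comultiplication sends `T` to `T ⊗ T`. The group law of `μ_m` thereby becomes multiplication of
functions, the only form in which it is used later. -/
lemma coord_mul {Z : Over (Spec (.of R))} (f g : Z ⟶ (muGrp m R).X) (U : Z.left.Opens) :
    coord (lift f g ≫ MonObj.mul) U = coord f U * coord g U := by
  have h1 : (MonObj.mul (X := (muGrp m R).X)).left =
      (pullbackSpecIso R (MuAlgebra m R) (MuAlgebra m R)).hom ≫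
      Spec.map (CommRingCat.ofHom (Bialgebra.comulAlgHom R (MuAlgebra m R)).toRingHom) := rfl
  let k := (lift f g).left ≫ (pullbackSpecIso R (MuAlgebra m R) (MuAlgebra m R)).hom
  have h2 : coord (lift f g ≫ MonObj.mul) U =
    secOf k U (Bialgebra.comulAlgHom R (MuAlgebra m R) (muCoord m R)) := by
    refine (congrArg (fun k ↦ secOf (A := MuAlgebra m R) ((lift f g).left ≫ k) U (muCoord m R)) h1).trans ?_
    refine (congrArg (fun k ↦ secOf (A := MuAlgebra m R) k U (muCoord m R))
      (Category.assoc _ _ _).symm).trans ?_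
    exact secOf_comp_specMap _ k U _
  have h3 : Bialgebra.comulAlgHom R (MuAlgebra m R) (muCoord m R) =
    Algebra.TensorProduct.includeLeftRingHom (muCoord m R) *
    (Algebra.TensorProduct.includeRight (R := R) (A := MuAlgebra m R)).toRingHom (muCoord m R) := by
    simp
  rw [h2, h3, map_mul]
  congr 1
  · refine (secOf_comp_specMap _ k U _).symm.trans ?_
    refine congrArg (fun k ↦ secOf (A := MuAlgebra m R) k U (muCoord m R)) ?_
    refine (Category.assoc _ _ _).trans ?_
    refine (congrArg ((lift f g).left ≫ ·)
      (pullbackSpecIso_hom_fst R (MuAlgebra m R) (MuAlgebra m R))).trans ?_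
    exact congr($(lift_fst f g).left)
  · refine (secOf_comp_specMap _ k U _).symm.trans ?_
    refine congrArg (fun k ↦ secOf (A := MuAlgebra m R) k U (muCoord m R)) ?_
    refine (Category.assoc _ _ _).trans ?_
    refine (congrArg ((lift f g).left ≫ ·)
      (pullbackSpecIso_hom_snd R (MuAlgebra m R) (MuAlgebra m R))).trans ?_
    exact congr($(lift_snd f g).left)

end MuGrp

end

/-! ### Functions on the generic and the special fibre over a discrete valuation ring. -/

section

lemma CommRingCat.inl_injective_of_isPushout {A B C D : CommRingCat.{u}} {f : A ⟶ B} {g : A ⟶ C}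
    {inl : B ⟶ D} {inr : C ⟶ D} (h : IsPushout f g inl inr) (hf : f.hom.Flat)
    (hg : Function.Injective g) : Function.Injective inl := by
  rw [← h.inl_isoPushout_inv]
  exact (ConcreteCategory.bijective_of_isIso h.isoPushout.inv).1.comp
    (CommRingCat.inl_injective_of_flat f g hf hg)

/-- The element `y` is a fraction of elements of `A` inside the fraction field of `A'`; as such it
is integral over `A`, hence lies in `A`. -/
lemma exists_of_isIntegralElem {A A' : Type*} [CommRing A] [IsDomain A] [IsIntegrallyClosed A]
    [CommRing A'] [IsDomain A'] {φ : A →+* A'} (hφ : Function.Injective φ)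
    (hφ' : ∀ y, ∃ r a, φ r ≠ 0 ∧ φ r * y = φ a) {y : A'} (hy : φ.IsIntegralElem y) :
    ∃ a, φ a = y := by
  let _ := φ.toAlgebra
  obtain ⟨r, a, hr, hra⟩ := hφ' y
  let F := FractionRing A
  let F' := FractionRing A'
  have hinj : Function.Injective (algebraMap A F') := (IsFractionRing.injective A' F').comp hφ
  let ψ : F →ₐ[A] F' := IsFractionRing.liftAlgHom (g := Algebra.ofId A F') hinj
  have hψ : Function.Injective ψ := ψ.toRingHom.injective
  have hr' : algebraMap A F' r ≠ 0 := fun h ↦ hr (by rw [hinj (h.trans (map_zero _).symm), map_zero])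
  have h1 : ψ (algebraMap A F a / algebraMap A F r) = algebraMap A' F' y := by
    rw [map_div₀, AlgHom.commutes, AlgHom.commutes, div_eq_iff hr', mul_comm]
    exact (congrArg (algebraMap A' F') hra.symm).trans (map_mul _ _ _)
  have h2 : IsIntegral A (algebraMap A' F' y) :=
    IsIntegral.map (IsScalarTower.toAlgHom A A' F') (show IsIntegral A y from hy)
  rw [← h1, isIntegral_algHom_iff ψ hψ] at h2
  obtain ⟨c, hc⟩ := IsIntegrallyClosed.algebraMap_eq_of_integral h2
  refine ⟨c, IsFractionRing.injective A' F' ?_⟩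
  rw [← h1, ← hc, AlgHom.commutes]
  rfl

lemma isPushout_secOf {R A : Type u} [CommRing R] [CommRing A] {φ : R →+* A} {Z P : Scheme.{u}}
    {s : Z ⟶ Spec (.of R)} {a : P ⟶ Z} {b : P ⟶ Spec (.of A)}
    (H : IsPullback a b s (Spec.map (CommRingCat.ofHom φ))) {U : Z.Opens} (hU : IsAffineOpen U) :
    IsPushout (CommRingCat.ofHom (secOf s U)) (CommRingCat.ofHom φ) (a.app U)
      (CommRingCat.ofHom (secOf b (a ⁻¹ᵁ U))) := by
  have h1 := (isIso_pushoutSection_iff H (US := ⊤) (UT := ⊤) (UX := U)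
    (UY := a ⁻¹ᵁ U) (le_preimage_top _ _) (le_preimage_top _ _)
    (inf_eq_left.mpr (le_preimage_top _ _)).symm).mp
    (isIso_pushoutSection_of_isAffineOpen H _ _ _ (isAffineOpen_top _) (isAffineOpen_top _) hU)
  refine IsPushout.of_iso h1 (Scheme.ΓSpecIso _) (Iso.refl _) (Scheme.ΓSpecIso _) (Iso.refl _)
    ?_ ?_ ?_ ?_
  · rw [← Iso.inv_comp_eq]
    exact (Category.comp_id _).symm
  · have := Scheme.ΓSpecIso_naturality (CommRingCat.ofHom φ)
    rw [← this]
    congr 1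
  · rw [Scheme.Hom.app_eq_appLE]
    exact (Category.comp_id _).trans (Category.id_comp _).symm
  · rw [← Iso.inv_comp_eq]
    exact (Category.comp_id _).symm

section BaseChange

variable {R : Type u} [CommRing R] {Z : Scheme.{u}} (s : Z ⟶ Spec (.of R))
  (A : Type u) [CommRing A] [Algebra R A]

/-- The projection of a base change to the spectrum of the new base. -/
abbrev baseChangeSnd : baseChange s A ⟶ Spec (.of A) := pullback.snd _ _

lemma baseChangeFst_comp : baseChangeFst s A ≫ s =
    baseChangeSnd s A ≫ Spec.map (CommRingCat.ofHom (algebraMap R A)) := pullback.condition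

lemma secOf_baseChangeFst (U : (baseChange s A).Opens) (r : R) :
    secOf (baseChangeFst s A ≫ s) U r = secOf (baseChangeSnd s A) U (algebraMap R A r) := by
  rw [baseChangeFst_comp, secOf_comp_specMap]

instance : IsAffineHom (baseChangeFst s A) :=
  isAffineHom_isStableUnderBaseChange.of_isPullback (IsPullback.of_hasPullback _ _).flip
    inferInstance

lemma isPushout_baseChange {U : Z.Opens} (hU : IsAffineOpen U) :
    IsPushout (CommRingCat.ofHom (secOf s U)) (CommRingCat.ofHom (algebraMap R A))
      ((baseChangeFst s A).app U)
      (CommRingCat.ofHom (secOf (baseChangeSnd s A) (baseChangeFst s A ⁻¹ᵁ U))) :=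
  isPushout_secOf (IsPullback.of_hasPullback _ _) hU

end BaseChange

section DVR

variable {R : Type u} [CommRing R] {Z : Scheme.{u}} (s : Z ⟶ Spec (.of R)) {U : Z.Opens}

lemma secOf_flat [Flat s] (hU : IsAffineOpen U) : (secOf s U).Flat := by
  rw [secOf, CommRingCat.hom_comp]
  refine RingHom.Flat.comp ?_ (s.flat_appLE (isAffineOpen_top _) hU _)
  exact .of_bijective (ConcreteCategory.bijective_of_isIso (Scheme.ΓSpecIso (.of R)).inv)

variable {K : Type u} [Field K] [Algebra R K] [IsFractionRing R K]

lemma baseChangeFst_app_injective [Flat s] (hU : IsAffineOpen U) :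
    Function.Injective ((baseChangeFst s K).app U) :=
  CommRingCat.inl_injective_of_isPushout (isPushout_baseChange s K hU) (secOf_flat s hU)
    (IsFractionRing.injective R K)

variable [IsDomain R] [IsDiscreteValuationRing R]

/-- A nonzero denominator is a unit times a power of `ϖ`, so `K = R[1/ϖ]`. -/
lemma exists_smul_eq_algebraMap {ϖ : R} (hϖ : Irreducible ϖ) (k : K) :
    ∃ n r, algebraMap R K ϖ ^ n * k = algebraMap R K r := by
  obtain ⟨a, b, hb, rfl⟩ := IsFractionRing.div_surjective (A := R) k
  have hb0 : b ≠ 0 := nonZeroDivisors.ne_zero hb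
  obtain ⟨n, v, rfl⟩ := IsDiscreteValuationRing.eq_unit_mul_pow_irreducible hb0 hϖ
  refine ⟨n, (v⁻¹).1 * a, ?_⟩
  have h1 : algebraMap R K (v.1 * ϖ ^ n) ≠ 0 := by
    rwa [Ne, IsFractionRing.to_map_eq_zero_iff]
  rw [← mul_div_assoc, div_eq_iff h1, ← map_pow, ← map_mul, ← map_mul]
  congr 1
  linear_combination (-a * ϖ ^ n) * v.inv_mul

lemma exists_secOf_mul_eq {ϖ : R} (hϖ : Irreducible ϖ) (hU : IsAffineOpen U)
    (y : Γ(baseChange s K, baseChangeFst s K ⁻¹ᵁ U)) :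
    ∃ n a, (baseChangeFst s K).app U (secOf s U ϖ ^ n) * y = (baseChangeFst s K).app U a := by
  obtain ⟨l, b, c, rfl⟩ := CommRingCat.exists_sum_of_isPushout (isPushout_baseChange s K hU) y
  choose n r hr using fun i ↦ exists_smul_eq_algebraMap hϖ (c i)
  -- The sum of the exponents serves as a common denominator exponent.
  refine ⟨∑ i, n i, ∑ i, b i * secOf s U (ϖ ^ (∑ j, n j - n i) * r i), ?_⟩
  rw [Finset.mul_sum, map_sum]
  refine Finset.sum_congr rfl fun i _ ↦ ?_
  rw [map_mul, mul_left_comm, ← map_pow]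
  congr 1
  have hn : n i ≤ ∑ j, n j := Finset.single_le_sum (fun _ _ ↦ Nat.zero_le _) (Finset.mem_univ i)
  rw [app_secOf, app_secOf, secOf_baseChangeFst, secOf_baseChangeFst]
  refine (map_mul (secOf (baseChangeSnd s K) (baseChangeFst s K ⁻¹ᵁ U)) _ _).symm.trans ?_
  congr 1
  rw [map_mul, ← hr, ← mul_assoc, ← map_pow, ← map_mul, ← pow_add, Nat.sub_add_cancel hn]

/-- Reduction modulo `ϖ` is a map to an algebra over the residue field, so it factors through the
functions on the special fibre. A function vanishing there is therefore zero modulo `ϖ`. -/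
lemma exists_eq_secOf_mul {ϖ : R} (hϖ : Irreducible ϖ) (hU : IsAffineOpen U) (a : Γ(Z, U))
    (ha : (baseChangeFst s (IsLocalRing.ResidueField R)).app U a = 0) :
    ∃ b, a = secOf s U ϖ * b := by
  let I : Ideal Γ(Z, U) := Ideal.span {secOf s U ϖ}
  let q : Γ(Z, U) ⟶ CommRingCat.of (Γ(Z, U) ⧸ I) := CommRingCat.ofHom (Ideal.Quotient.mk I)
  let l : IsLocalRing.ResidueField R →+* Γ(Z, U) ⧸ I :=
    Ideal.Quotient.lift _ ((Ideal.Quotient.mk I).comp (secOf s U)) fun r hr ↦ by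
      rw [hϖ.maximalIdeal_eq, Ideal.mem_span_singleton] at hr
      obtain ⟨c, rfl⟩ := hr
      rw [map_mul, RingHom.comp_apply, Ideal.Quotient.eq_zero_iff_mem.mpr (Ideal.mem_span_singleton_self _), zero_mul]
  have hl : CommRingCat.ofHom (secOf s U) ≫ q =
      CommRingCat.ofHom (algebraMap R (IsLocalRing.ResidueField R)) ≫ CommRingCat.ofHom l := by
    ext r
    rfl
  have h := congr($((isPushout_baseChange s (IsLocalRing.ResidueField R) hU).inl_desc q _ hl) a)
  rw [CommRingCat.comp_apply, ha, map_zero] at h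
  exact Ideal.mem_span_singleton'.mp (Ideal.Quotient.eq_zero_iff_mem.mp h.symm) |>.imp
    fun b hb ↦ by rw [mul_comm, hb]

lemma secOf_irreducible_map_eq_zero {ϖ : R} (hϖ : Irreducible ϖ) :
    (baseChangeFst s (IsLocalRing.ResidueField R)).app U (secOf s U ϖ) = 0 := by
  rw [app_secOf, secOf_baseChangeFst]
  have : algebraMap R (IsLocalRing.ResidueField R) ϖ = 0 :=
    (IsLocalRing.residue_eq_zero_iff ϖ).mpr hϖ.not_isUnit
  rw [this, map_zero]

/-- Functions on the generic fibre of a normal scheme that are integral over the functions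
on the scheme extend. -/
lemma exists_app_eq_of_isIntegralElem [Flat s] (hZ : IsNormalScheme Z)
    [IsIntegral (baseChange s K)] (hU : IsAffineOpen U)
    {y : Γ(baseChange s K, baseChangeFst s K ⁻¹ᵁ U)}
    (hy : ((baseChangeFst s K).app U).hom.IsIntegralElem y) :
    ∃ a, (baseChangeFst s K).app U a = y := by
  by_cases hne : (baseChangeFst s K ⁻¹ᵁ U) = ⊥
  · have : Subsingleton Γ(baseChange s K, baseChangeFst s K ⁻¹ᵁ U) := by
      rw [hne]
      infer_instance
    exact ⟨0, Subsingleton.elim _ _⟩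
  obtain ⟨x, hx⟩ : ∃ x, x ∈ baseChangeFst s K ⁻¹ᵁ U := by
    by_contra! h
    exact hne (Opens.ext (Set.eq_empty_of_forall_notMem h))
  have : Nonempty (baseChangeFst s K ⁻¹ᵁ U) := ⟨⟨x, hx⟩⟩
  have hinj := baseChangeFst_app_injective (K := K) s hU
  have : IsDomain Γ(Z, U) := hinj.isDomain ((baseChangeFst s K).app U).hom
  -- Localizations of the functions on `U` at maximal ideals are stalks of `Z`, and integral
  -- closedness is local.
  have : IsIntegrallyClosed Γ(Z, U) := by
    refine IsIntegrallyClosed.of_localization_maximal fun p _ hp ↦ ?_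
    let y : PrimeSpectrum Γ(Z, U) := ⟨p, hp.isPrime⟩
    have hy : hU.fromSpec y ∈ U := hU.range_fromSpec.le ⟨y, rfl⟩
    let _ := TopCat.Presheaf.algebra_section_stalk Z.presheaf (⟨hU.fromSpec y, hy⟩ : U)
    have hloc : IsLocalization p.primeCompl (Z.presheaf.stalk (hU.fromSpec y)) :=
      hU.isLocalization_stalk' y hy
    have := (hZ (hU.fromSpec y)).1
    have := (hZ (hU.fromSpec y)).2
    exact IsIntegrallyClosed.of_equiv (R := Z.presheaf.stalk (hU.fromSpec y))
      (IsLocalization.algEquiv p.primeCompl (Z.presheaf.stalk (hU.fromSpec y)) (Localization.AtPrime p)).toRingEquiv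
  obtain ⟨ϖ, hϖ⟩ := IsDiscreteValuationRing.exists_irreducible R
  refine exists_of_isIntegralElem hinj (fun y ↦ ?_) hy
  obtain ⟨n, a, h⟩ := exists_secOf_mul_eq s hϖ hU y
  refine ⟨_, a, ?_, h⟩
  intro h0
  rw [← map_pow] at h0
  change (baseChangeFst s K).app U (secOf s U (ϖ ^ n)) = 0 at h0
  rw [app_secOf, secOf_baseChangeFst, map_eq_zero] at h0
  exact pow_ne_zero n hϖ.ne_zero ((IsFractionRing.to_map_eq_zero_iff (K := K)).mp h0)

end DVR

end

/-! ### The action of `ℤ/m` on functions on a constant torsor over an arbitrary open set. -/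

section

section

variable {X : Scheme.{u}} {G : Type} [Group G] [Finite G] (T : ConstTorsor G X)

lemma ConstTorsor.pull_pull (g h : G) (U : X.Opens) (b : Γ(T.total, T.proj ⁻¹ᵁ U)) :
    T.pull h U (T.pull g U b) = T.pull (g * h) U b := by
  have h1 : (T.act (g * h)).hom.left = (T.act h).hom.left ≫ (T.act g).hom.left := by
    rw [map_mul]
    rfl
  simp only [pull, endPull]
  rw [← CommRingCat.comp_apply, Scheme.Hom.appLE_comp_appLE]
  rw [appLE_congr_hom h1]

lemma ConstTorsor.pull_one (U : X.Opens) (b : Γ(T.total, T.proj ⁻¹ᵁ U)) : T.pull 1 U b = b := by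
  have h1 : (T.act 1).hom.left = 𝟙 _ := by
    rw [map_one]
    rfl
  have h2 := appLE_congr_hom h1 (U := T.proj ⁻¹ᵁ U) (V := T.proj ⁻¹ᵁ U)
    (by rw [h1]; exact le_rfl) le_rfl
  exact congr($h2 b).trans congr($(T.total.presheaf.map_id (op (T.proj ⁻¹ᵁ U))) b)

lemma ConstTorsor.pull_iterate (g : G) (U : X.Opens) (k : ℕ) (b : Γ(T.total, T.proj ⁻¹ᵁ U)) :
    (T.pull g U)^[k] b = T.pull (g ^ k) U b := by
  induction k with
  | zero => rw [pow_zero, pull_one]; rfl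
  | succ k ih => rw [Function.iterate_succ_apply', ih, pull_pull, pow_succ]

lemma ConstTorsor.app_injective' (U : X.Opens) : Function.Injective (T.proj.app U) := by
  intro a b hab
  have h (x : U) : ∃ V : X.Opens, IsAffineOpen V ∧ V ≤ U ∧ x.1 ∈ V := by
    obtain ⟨V, hV, hx, hVU⟩ := Opens.isBasis_iff_nbhd.mp X.isBasis_affineOpens x.2
    exact ⟨V, hV, hVU, hx⟩
  choose V hV hVU hx using h
  refine X.sheaf.eq_of_locally_eq' V U (fun x ↦ homOfLE (hVU x))
    (fun x hx' ↦ Opens.mem_iSup.mpr ⟨⟨x, hx'⟩, hx _⟩) _ _ fun x ↦ ?_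
  refine T.app_injective (hV x) ?_
  refine (app_map T.proj (hVU x) a).trans (Eq.trans ?_ (app_map T.proj (hVU x) b).symm)
  rw [hab]

/-- Functions descended over affine opens agree on overlaps by injectivity of pullback to the
torsor, hence glue. -/
lemma ConstTorsor.exists_app_eq' (U : X.Opens)
    (b : Γ(T.total, T.proj ⁻¹ᵁ U)) (hb : ∀ g, T.pull g U b = b) : ∃ a, T.proj.app U a = b := by
  have h (x : U) : ∃ V : X.Opens, IsAffineOpen V ∧ V ≤ U ∧ x.1 ∈ V := by
    obtain ⟨V, hV, hx, hVU⟩ := Opens.isBasis_iff_nbhd.mp X.isBasis_affineOpens x.2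
    exact ⟨V, hV, hVU, hx⟩
  choose V hV hVU hx using h
  have h1 (x : U) := T.exists_app_eq (hV x)
    (T.total.presheaf.map (homOfLE (T.proj.preimage_mono (hVU x))).op b) fun g ↦ by
      rw [endPull_map T.proj (T.act_comp_proj g) (hVU x), hb]
  choose a ha using h1
  obtain ⟨a', ha', -⟩ := X.sheaf.existsUnique_gluing' V U (fun x ↦ homOfLE (hVU x))
    (fun x hx' ↦ Opens.mem_iSup.mpr ⟨⟨x, hx'⟩, hx _⟩) a (by
      intro x y
      refine T.app_injective' _ ?_
      refine (app_map T.proj inf_le_left _).trans (Eq.trans ?_ (app_map T.proj inf_le_right _).symm)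
      rw [ha, ha, Scheme.res_res (T.proj.preimage_mono (hVU x)) (T.proj.preimage_mono inf_le_left), Scheme.res_res (T.proj.preimage_mono (hVU y)) (T.proj.preimage_mono inf_le_right)])
  refine ⟨a', ?_⟩
  refine T.total.sheaf.eq_of_locally_eq' (fun x ↦ T.proj ⁻¹ᵁ V x) _
    (fun x ↦ homOfLE (T.proj.preimage_mono (hVU x)))
    (fun y hy ↦ Opens.mem_iSup.mpr ⟨⟨_, hy⟩, hx _⟩) _ _ fun x ↦ ?_
  refine (app_map T.proj (hVU x) a').symm.trans ?_
  exact (congrArg _ (ha' x)).trans (ha x)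

end

section

variable {X : Scheme.{u}} {m : ℕ} [NeZero m] (T : ConstTorsor (Multiplicative (ZMod m)) X)
  (D : RootDatum m Γ(X, ⊤))

/-- The action of `ℤ/m` on the functions on a `ℤ/m`-torsor. -/
def ConstTorsor.action (U : X.Opens) : CyclicAction m Γ(T.total, T.proj ⁻¹ᵁ U) where
  toRootDatum := D.map ((T.proj.app U).hom.comp (X.presheaf.map (homOfLE le_top).op).hom)
  σ := T.pull (Multiplicative.ofAdd 1) U
  σ_z := endPull_app T.proj _ U _
  iterate b := by
    rw [pull_iterate, ← ofAdd_nsmul, nsmul_one, ZMod.natCast_self, ofAdd_zero, pull_one]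

lemma ConstTorsor.action_z (U : X.Opens) :
    (T.action D U).z = T.proj.app U (X.presheaf.map (homOfLE le_top).op D.z) := rfl

lemma ConstTorsor.action_σ (U : X.Opens) :
    (T.action D U).σ = T.pull (Multiplicative.ofAdd 1) U := rfl

lemma ConstTorsor.map_action_z {U V : X.Opens} (h : V ≤ U) :
    T.total.presheaf.map (homOfLE (T.proj.preimage_mono h)).op (T.action D U).z =
      (T.action D V).z := by
  rw [action_z, action_z, ← app_map T.proj h, Scheme.res_res]

lemma ConstTorsor.map_action_proj {U V : X.Opens} (h : V ≤ U) (i : ℕ)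
    (b : Γ(T.total, T.proj ⁻¹ᵁ U)) :
    T.total.presheaf.map (homOfLE (T.proj.preimage_mono h)).op ((T.action D U).proj i b) =
      (T.action D V).proj i (T.total.presheaf.map (homOfLE (T.proj.preimage_mono h)).op b) :=
  CyclicAction.proj_map (S := T.action D U) (S' := T.action D V)
    (T.total.presheaf.map (homOfLE (T.proj.preimage_mono h)).op).hom
    (fun b ↦ (endPull_map T.proj (T.act_comp_proj _) h b).symm) (T.map_action_z D h) i b

lemma ConstTorsor.action_σ_app (U : X.Opens) (a : Γ(X, U)) :
    (T.action D U).σ (T.proj.app U a) = T.proj.app U a :=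
  endPull_app T.proj (T.act_comp_proj _) U a

variable {T D}

lemma ConstTorsor.homog_one_iff {U : X.Opens} {b : Γ(T.total, T.proj ⁻¹ᵁ U)} :
    (T.action D U).Homog 1 b ↔ b ∈ eigen T.proj (T.act_comp_proj (Multiplicative.ofAdd 1)) D.z U := by
  rw [CyclicAction.Homog, pow_one]
  rfl

lemma ConstTorsor.exists_app_eq_of_homog {U : X.Opens} {b : Γ(T.total, T.proj ⁻¹ᵁ U)}
    (hb : (T.action D U).Homog 0 b) : ∃ a, T.proj.app U a = b := by
  refine T.exists_app_eq' U b fun g ↦ ?_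
  have h1 : g = Multiplicative.ofAdd 1 ^ (Multiplicative.toAdd g).val := by
    rw [← ofAdd_nsmul, nsmul_one, ZMod.natCast_zmod_val, ofAdd_toAdd]
  rw [h1, ← pull_iterate]
  exact CyclicAction.iterate_of_fixed (S := T.action D U) (CyclicAction.homog_zero_iff.mp hb) _

variable (T D)

/-- Here the Galois condition becomes the statement that the parts of degree `1` and `-1` multiply
onto the unit ideal, for among the powers of the generator with exponent below `m` only the zeroth
is trivial. -/
lemma ConstTorsor.exists_sum_homog {U : X.Opens} (hU : IsAffineOpen U) :
    ∃ (n : ℕ) (b c : Fin n → Γ(T.total, T.proj ⁻¹ᵁ U)),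
      (∀ i, (T.action D U).Homog (m - 1) (b i)) ∧ (∀ i, (T.action D U).Homog 1 (c i)) ∧
      ∑ i, b i * c i = 1 := by
  obtain ⟨n, b, c, h⟩ := T.exists_sum hU
  refine ⟨n, CyclicAction.exists_sum_homog (S := T.action D U) (b := b) (c := c) fun k hk ↦ ?_⟩
  rw [action_σ]
  simp only [pull_iterate]
  rw [h, ← ofAdd_nsmul, nsmul_one, ← ofAdd_zero]
  congr 1
  rw [Multiplicative.ofAdd.injective.eq_iff, ZMod.natCast_eq_zero_iff, eq_iff_iff]
  exact ⟨fun h ↦ Nat.eq_zero_of_dvd_of_lt h hk, fun h ↦ h ▸ dvd_zero m⟩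

end

end

/-! ### The degree-one part of a constant torsor is an `m`-torsion line bundle. -/

section

section

variable {X : Scheme.{u}} {m : ℕ} [NeZero m] (T : ConstTorsor (Multiplicative (ZMod m)) X)
  (D : RootDatum m Γ(X, ⊤))

/-- The sheaf of functions of degree one on a `ℤ/m`-torsor. -/
abbrev ConstTorsor.degreeOne : X.Modules :=
  eigenModule T.proj (T.act_comp_proj (Multiplicative.ofAdd 1)) D.z

variable {T D}

lemma ConstTorsor.map_homog {U V : X.Opens} (h : V ≤ U) {i : ℕ} {b : Γ(T.total, T.proj ⁻¹ᵁ U)}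
    (hb : (T.action D U).Homog i b) :
    (T.action D V).Homog i (T.total.presheaf.map (homOfLE (T.proj.preimage_mono h)).op b) := by
  rw [CyclicAction.Homog] at *
  refine (endPull_map T.proj (T.act_comp_proj _) h b).trans ?_
  refine (congrArg _ hb).trans ?_
  rw [map_mul, map_pow, T.map_action_z D h]

/-- The quotient of a degree-one function by the unit `t` has degree zero, so it is a function on
the base. -/
lemma ConstTorsor.isGenerator_degreeOne {U : X.Opens} {t : Γ(T.total, T.proj ⁻¹ᵁ U)}
    (ht : (T.action D U).Homog 1 t) (htu : IsUnit t) :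
    IsGenerator (T.degreeOne D) (eigenModule.mk t (homog_one_iff.mp ht)) := by
  intro V hV
  set t' := T.total.presheaf.map (homOfLE (T.proj.preimage_mono hV)).op t with ht'
  have htu' : IsUnit t' := htu.map (T.total.presheaf.map (homOfLE (T.proj.preimage_mono hV)).op).hom
  have hh := map_homog hV ht
  have hval (a : Γ(X, V)) : eigenModule.val _ _ _
      (a • (T.degreeOne D).presheaf.map (homOfLE hV).op (eigenModule.mk t (homog_one_iff.mp ht))) =
      T.proj.app V a * t' := by
    rw [eigenModule.val_smul, eigenModule.val_map, eigenModule.val_mk]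
  refine ⟨fun a b hab ↦ T.app_injective' V ?_, fun b ↦ ?_⟩
  · have h1 := congrArg (eigenModule.val _ _ _) hab
    simp only [hval] at h1
    exact htu'.mul_right_cancel h1
  · obtain ⟨ti, hti⟩ := htu'.exists_left_inv
    have hb := homog_one_iff.mpr (eigenModule.val_mem b)
    have h2 : (T.action D V).Homog 0 (eigenModule.val _ _ _ b * ti) := by
      refine CyclicAction.Homog.of_mul hh htu' ?_
      rw [mul_assoc, hti, mul_one, zero_add]
      exact hb
    obtain ⟨a, ha⟩ := exists_app_eq_of_homog h2
    refine ⟨a, eigenModule.val_injective ?_⟩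
    rw [hval, ha, mul_assoc, hti, mul_one]

/-- All degree-one functions are multiples of the generator, so a relation `∑ bᵢ cᵢ = 1` with `cᵢ`
of degree one exhibits its inverse. -/
lemma ConstTorsor.isUnit_of_isGenerator {U : X.Opens} (hU : IsAffineOpen U)
    {t : Γ(T.degreeOne D, U)} (ht : IsGenerator _ t) : IsUnit (eigenModule.val _ _ _ t) := by
  obtain ⟨n, b, c, -, hc, h⟩ := T.exists_sum_homog D hU
  have h1 (i : Fin n) : ∃ a, T.proj.app U a * eigenModule.val _ _ _ t = c i := by
    obtain ⟨a, ha⟩ := (ht U le_rfl).2 (eigenModule.mk (c i) (homog_one_iff.mp (hc i)))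
    refine ⟨a, ?_⟩
    have h2 := congrArg (eigenModule.val _ _ _) ha
    rw [eigenModule.val_mk, eigenModule.val_smul, eigenModule.val_map] at h2
    rw [← h2]
    congr 1
    exact congr($(T.total.presheaf.map_id (op (T.proj ⁻¹ᵁ U))) (eigenModule.val _ _ _ t)).symm
  choose a ha using h1
  refine IsUnit.of_mul_eq_one (∑ i, b i * T.proj.app U (a i)) ?_
  rw [← h, Finset.mul_sum]
  exact Finset.sum_congr rfl fun i _ ↦ by rw [← ha]; ring

variable (T D) in
-- In `∑ bᵢ cᵢ = 1` each term has degree zero and comes from the base. Some term is a unit in the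
-- local ring at `x`, hence on a basic open neighbourhood, where `cᵢ` is invertible.
lemma ConstTorsor.exists_isUnit_homog (x : X) : ∃ (U : X.Opens) (_ : x ∈ U)
    (t : Γ(T.total, T.proj ⁻¹ᵁ U)), (T.action D U).Homog 1 t ∧ IsUnit t := by
  obtain ⟨U, hU, hx, -⟩ := Opens.isBasis_iff_nbhd.mp X.isBasis_affineOpens (Opens.mem_top x)
  obtain ⟨n, b, c, hb, hc, h⟩ := T.exists_sum_homog D hU
  have h1 (i : Fin n) : (T.action D U).Homog 0 (b i * c i) := by
    refine ((hb i).mul (hc i)).congr ?_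
    rw [Nat.sub_add_cancel NeZero.one_le]
    simp [Nat.ModEq]
  choose a ha using fun i ↦ exists_app_eq_of_homog (h1 i)
  have h2 : ∑ i, a i = 1 := T.app_injective' U (by rw [map_sum, map_one, ← h]; simp only [ha])
  obtain ⟨i, hi⟩ : ∃ i, IsUnit (X.presheaf.germ U x hx (a i)) := by
    by_contra! hn
    have h3 : X.presheaf.germ U x hx (∑ i, a i) ∈ IsLocalRing.maximalIdeal (X.presheaf.stalk x) := by
      rw [map_sum]
      exact Ideal.sum_mem _ fun i _ ↦ hn i
    rw [h2, map_one] at h3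
    exact h3 isUnit_one
  have hle := X.basicOpen_le (a i)
  refine ⟨X.basicOpen (a i), (X.mem_basicOpen (a i) x hx).mpr hi,
    T.total.presheaf.map (homOfLE (T.proj.preimage_mono hle)).op (c i), map_homog hle (hc i), ?_⟩
  refine isUnit_of_mul_isUnit_right
    (x := T.total.presheaf.map (homOfLE (T.proj.preimage_mono hle)).op (b i)) ?_
  rw [← map_mul, ← ha, ← app_map T.proj hle]
  exact (RingedSpace.isUnit_res_basicOpen X.toRingedSpace (a i)).map (T.proj.app _).hom

lemma ConstTorsor.exists_unit_of_isUnit_homog {U : X.Opens} {t : Γ(T.total, T.proj ⁻¹ᵁ U)}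
    (ht : (T.action D U).Homog 1 t) (htu : IsUnit t) :
    ∃ u : (Γ(X, U))ˣ, T.proj.app U u = t ^ m := by
  obtain ⟨ti, hti⟩ := htu.exists_left_inv
  have h1 : (T.action D U).Homog 0 (ti ^ m) := by
    refine CyclicAction.Homog.of_mul ht.pow_card (htu.pow m) ?_
    rw [← mul_pow, hti, one_pow]
    exact CyclicAction.homog_one
  obtain ⟨u, hu⟩ := exists_app_eq_of_homog ht.pow_card
  obtain ⟨v, hv⟩ := exists_app_eq_of_homog h1
  have h2 : u * v = 1 := T.app_injective' U (by
    rw [map_mul, hu, hv, map_one, ← mul_pow, mul_comm, hti, one_pow])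
  exact ⟨⟨u, v, h2, by rw [mul_comm, h2]⟩, hu⟩

variable (T D)

lemma ConstTorsor.isInvertibleModule_degreeOne : IsInvertibleModule (T.degreeOne D) := by
  rw [isInvertibleModule_iff]
  intro x
  obtain ⟨U, hx, t, ht, htu⟩ := T.exists_isUnit_homog D x
  exact ⟨U, hx, _, isGenerator_degreeOne ht htu⟩

/-- If `t_y = a t_x` then `t_y^m = a^m t_x^m`, and these powers are units of the base: exactly the
cocycle condition of `nonempty_tensorPower_iso_unit`. -/
lemma ConstTorsor.degreeOne_mem_picTorsion :
    (Quotient.mk _ (T.degreeOne D) : ModuleClass X) ∈ picTorsion m X := by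
  refine ⟨_, T.isInvertibleModule_degreeOne D, ?_, rfl⟩
  choose U hx t ht htu using T.exists_isUnit_homog D
  choose u hu using fun x ↦ exists_unit_of_isUnit_homog (ht x) (htu x)
  refine nonempty_tensorPower_iso_unit m U hx _ (fun x ↦ isGenerator_degreeOne (ht x) (htu x)) u
    fun x y a h ↦ T.app_injective' _ ?_
  have h1 := congrArg (eigenModule.val _ _ _) h
  rw [eigenModule.val_smul, eigenModule.val_map, eigenModule.val_map, eigenModule.val_mk,
    eigenModule.val_mk] at h1
  rw [app_map T.proj inf_le_right, hu, map_mul, map_pow, map_pow, app_map T.proj inf_le_left, hu,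
    h1, map_pow, mul_pow]

end

end

/-! ### Functions on the normalization; the uniformizer as a prime element. -/

section

section

variable {X Y : Scheme.{u}} (f : Y ⟶ X) [QuasiCompact f] [QuasiSeparated f]

/-- Functions on the normalization of `X` in `Y`, as functions on `Y`. -/
abbrev normalizationVal (U : X.Opens) :
    Γ(f.normalization, f.fromNormalization ⁻¹ᵁ U) ⟶ Γ(Y, f ⁻¹ᵁ U) :=
  overApp f.toNormalization_fromNormalization U

lemma normalizationVal_injective {U : X.Opens} (hU : IsAffineOpen U) :
    Function.Injective (normalizationVal f U) := by
  have := f.normalizationObjIso_hom_val hU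
  rw [normalizationVal, overApp, ← this]
  exact Subtype.val_injective.comp
    (ConcreteCategory.bijective_of_isIso (f.normalizationObjIso hU).hom).1

lemma exists_normalizationVal_eq {U : X.Opens} (hU : IsAffineOpen U) {b : Γ(Y, f ⁻¹ᵁ U)}
    (hb : (f.app U).hom.IsIntegralElem b) : ∃ c, normalizationVal f U c = b := by
  have := f.normalizationObjIso_hom_val hU
  rw [normalizationVal, overApp, ← this]
  let _ := (f.app U).hom.toAlgebra
  obtain ⟨c, hc⟩ := (ConcreteCategory.bijective_of_isIso (f.normalizationObjIso hU).hom).2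
    ⟨b, show IsIntegral Γ(X, U) b from hb⟩
  exact ⟨c, congrArg Subtype.val hc⟩

lemma normalizationVal_isIntegralElem {U : X.Opens} (hU : IsAffineOpen U)
    (c : Γ(f.normalization, f.fromNormalization ⁻¹ᵁ U)) :
    (f.app U).hom.IsIntegralElem (normalizationVal f U c) := by
  have := f.normalizationObjIso_hom_val hU
  rw [normalizationVal, overApp, ← this]
  let _ := (f.app U).hom.toAlgebra
  exact ((f.normalizationObjIso hU).hom c).2

end

variable {R : Type u} [CommRing R] {K : Type u} [Field K] [Algebra R K] [IsFractionRing R K]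
  {X : Scheme.{u}} (s : X ⟶ Spec (.of R))

/-- By flatness the nonzero ring of functions on `U` embeds into the functions on `U_K`. -/
lemma nonempty_preimage_baseChangeFst [Flat s] {U : X.Opens} (hU : IsAffineOpen U)
    (hne : (U : Set X).Nonempty) : Nonempty (baseChangeFst s K ⁻¹ᵁ U) := by
  by_contra hemp
  have h1 : (baseChangeFst s K ⁻¹ᵁ U) = ⊥ :=
    Opens.ext (Set.eq_empty_of_forall_notMem fun x hx ↦ hemp ⟨⟨x, hx⟩⟩)
  have h2 : Subsingleton Γ(baseChange s K, baseChangeFst s K ⁻¹ᵁ U) := by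
    rw [h1]
    infer_instance
  have : Nonempty U := hne.to_subtype
  have h3 := (baseChangeFst_app_injective (K := K) s hU).subsingleton
  exact not_subsingleton Γ(X, U) h3

lemma isUnit_app_secOf {ϖ : R} (hϖ : Irreducible ϖ) (U : X.Opens) :
    IsUnit ((baseChangeFst s K).app U (secOf s U ϖ)) := by
  rw [app_secOf, secOf_baseChangeFst]
  refine IsUnit.map _ (IsUnit.mk0 _ ?_)
  rw [Ne, IsFractionRing.to_map_eq_zero_iff]
  exact hϖ.ne_zero

variable [IsDomain R] [IsDiscreteValuationRing R] {ϖ : R} (hϖ : Irreducible ϖ)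

variable (R K) in
-- Since `K = R[1/ϖ]`, the generic fibre is an open subscheme, and pullback of modules to it is mere
-- restriction.
lemma isOpenImmersion_specMap_fractionField :
    IsOpenImmersion (Spec.map (CommRingCat.ofHom (algebraMap R K))) := by
  obtain ⟨ϖ, hϖ⟩ := IsDiscreteValuationRing.exists_irreducible R
  have hϖ0 : algebraMap R K ϖ ≠ 0 := by
    rw [Ne, IsFractionRing.to_map_eq_zero_iff]
    exact hϖ.ne_zero
  have : IsLocalization.Away ϖ K := by
    refine IsLocalization.Away.mk _ hϖ0.isUnit (fun k ↦ ?_) fun a b h ↦ ⟨0, ?_⟩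
    · obtain ⟨n, r, h⟩ := exists_smul_eq_algebraMap hϖ k
      exact ⟨n, r, by rw [mul_comm, h]⟩
    · rw [IsFractionRing.injective R K h]
  exact IsOpenImmersion.of_isLocalization ϖ

instance isOpenImmersion_baseChangeFst : IsOpenImmersion (baseChangeFst s K) :=
  have := isOpenImmersion_specMap_fractionField R K
  inferInstanceAs (IsOpenImmersion (pullback.fst _ _))

include hϖ

/-- A product divisible by `ϖ` vanishes on the special fibre of `U`. That fibre is integral, and
nonempty since `ϖ` is not a unit; so one factor vanishes there and is divisible by `ϖ`. -/
lemma prime_secOf [Flat s] [IsIntegral (baseChange s (IsLocalRing.ResidueField R))]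
    [IsIntegral (baseChange s K)] {U : X.Opens} (hU : IsAffineOpen U) (hne : (U : Set X).Nonempty)
    (hu : ¬ IsUnit (secOf s U ϖ)) : Prime (secOf s U ϖ) := by
  have := nonempty_preimage_baseChangeFst (K := K) s hU hne
  refine ⟨?_, hu, fun a b h ↦ ?_⟩
  · intro h0
    have := isUnit_app_secOf (K := K) s hϖ U
    rw [h0, map_zero] at this
    exact not_isUnit_zero this
  · let j := baseChangeFst s (IsLocalRing.ResidueField R)
    have hne' : Nonempty (j ⁻¹ᵁ U) := by
      by_contra hemp
      have h1 : (j ⁻¹ᵁ U) = ⊥ :=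
        Opens.ext (Set.eq_empty_of_forall_notMem fun x hx ↦ hemp ⟨⟨x, hx⟩⟩)
      have h2 : Subsingleton Γ(baseChange s (IsLocalRing.ResidueField R), j ⁻¹ᵁ U) := by
        rw [h1]
        infer_instance
      obtain ⟨c, hc⟩ := exists_eq_secOf_mul s hϖ hU 1 (Subsingleton.elim _ _)
      exact hu (IsUnit.of_mul_eq_one c hc.symm)
    obtain ⟨c, hc⟩ := h
    have h1 : j.app U a * j.app U b = 0 := by
      rw [← map_mul, hc, map_mul, secOf_irreducible_map_eq_zero s hϖ, zero_mul]
    rcases mul_eq_zero.mp h1 with h2 | h2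
    · exact .inl (exists_eq_secOf_mul s hϖ hU a h2)
    · exact .inr (exists_eq_secOf_mul s hϖ hU b h2)

/-- Up to powers of the uniformizer, invertible functions on the generic fibre extend to
invertible functions. -/
lemma exists_pow_mul_eq [Flat s] [IsIntegral (baseChange s (IsLocalRing.ResidueField R))]
    [IsIntegral (baseChange s K)] {U : X.Opens} (hU : IsAffineOpen U) (hne : (U : Set X).Nonempty)
    (v : (Γ(baseChange s K, baseChangeFst s K ⁻¹ᵁ U))ˣ) :
    ∃ (n k : ℕ) (u : (Γ(X, U))ˣ), (baseChangeFst s K).app U (secOf s U ϖ) ^ n * v =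
      (baseChangeFst s K).app U (secOf s U ϖ ^ k * u) := by
  have := nonempty_preimage_baseChangeFst (K := K) s hU hne
  have hinj := baseChangeFst_app_injective (K := K) s hU
  have : IsDomain Γ(X, U) := hinj.isDomain ((baseChangeFst s K).app U).hom
  obtain ⟨n, a, ha⟩ := exists_secOf_mul_eq s hϖ hU v.1
  obtain ⟨n', a', ha'⟩ := exists_secOf_mul_eq s hϖ hU (v⁻¹).1
  -- With the denominators of `v` and of its inverse cleared, the product of the numerators is a
  -- power of `ϖ`, whose divisors are powers of `ϖ` up to units when `ϖ` is prime.
  have h1 : a * a' = secOf s U ϖ ^ (n + n') := hinj (by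
    rw [map_mul, ← ha, ← ha', pow_add, map_mul]
    linear_combination ((baseChangeFst s K).app U (secOf s U ϖ ^ n) *
      (baseChangeFst s K).app U (secOf s U ϖ ^ n')) * v.mul_inv)
  rw [map_pow] at ha
  -- If `ϖ` is invertible on `U`, then `a` itself is a unit and no power of `ϖ` is split off.
  by_cases hu : IsUnit (secOf s U ϖ)
  · have h2 : IsUnit a := isUnit_of_mul_isUnit_left (h1 ▸ hu.pow _)
    exact ⟨n, 0, h2.unit, by rw [ha, pow_zero, one_mul]; rfl⟩
  · obtain ⟨i, -, u, hu⟩ := (dvd_prime_pow (prime_secOf (K := K) s hϖ hU hne hu) _).mp ⟨a', h1.symm⟩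
    refine ⟨n, i, u⁻¹, ?_⟩
    rw [ha, ← hu, mul_assoc, u.mul_inv, mul_one]

end

/-! ### Invertible functions of degree one whose `m`-th power is a unit on `X`. -/

section

variable {R : Type u} [CommRing R] {K : Type u} [Field K] [Algebra R K] [IsFractionRing R K]
  [CharZero K] {X : Scheme.{u}} {s : X ⟶ Spec (.of R)} {m : ℕ} [NeZero m] {ζ : R}
  (hζ : IsPrimitiveRoot ζ m)
  (Y : ConstTorsor (Multiplicative (ZMod m)) (baseChange s K))

/-- The root datum on the generic fibre given by a primitive root of unity. -/
def rootDatum (K : Type u) [Field K] [Algebra R K] [IsFractionRing R K] [CharZero K]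
    {X : Scheme.{u}} (s : X ⟶ Spec (.of R)) {m : ℕ} [NeZero m] {ζ : R}
    (hζ : IsPrimitiveRoot ζ m) : RootDatum m Γ(baseChange s K, ⊤) :=
  (RootDatum.ofPrimitiveRoot (hζ.map_of_injective (IsFractionRing.injective R K))).map
    (secOf (baseChangeSnd s K) ⊤)

/-- The structure morphism to `X` of a torsor on the generic fibre. -/
abbrev totalHom : Y.total ⟶ X := Y.proj ≫ baseChangeFst s K

/-- The action of `ℤ/m` on functions on a torsor on the generic fibre. -/
abbrev totalAction (U : X.Opens) : CyclicAction m Γ(Y.total, totalHom Y ⁻¹ᵁ U) :=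
  Y.action (rootDatum K s hζ) (baseChangeFst s K ⁻¹ᵁ U)

lemma totalHom_app (U : X.Opens) (a : Γ(X, U)) :
    (totalHom Y).app U a = Y.proj.app _ ((baseChangeFst s K).app U a) := rfl

lemma totalAction_z (U : X.Opens) :
    (totalAction hζ Y U).z = (totalHom Y).app U (secOf s U ζ) := by
  rw [totalHom_app, app_secOf]
  rw [secOf_baseChangeFst]
  change Y.proj.app _ ((baseChange s K).presheaf.map (homOfLE le_top).op
    (secOf (baseChangeSnd s K) ⊤ (algebraMap R K ζ))) = _
  rw [map_secOf]

lemma totalAction_σ_app (U : X.Opens) (a : Γ(X, U)) :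
    (totalAction hζ Y U).σ ((totalHom Y).app U a) = (totalHom Y).app U a :=
  Y.action_σ_app (rootDatum K s hζ) _ _

lemma map_totalAction_proj {U V : X.Opens} (h : V ≤ U) (i : ℕ)
    (b : Γ(Y.total, totalHom Y ⁻¹ᵁ U)) :
    Y.total.presheaf.map (homOfLE ((totalHom Y).preimage_mono h)).op
      ((totalAction hζ Y U).proj i b) = (totalAction hζ Y V).proj i
        (Y.total.presheaf.map (homOfLE ((totalHom Y).preimage_mono h)).op b) :=
  Y.map_action_proj (rootDatum K s hζ) ((baseChangeFst s K).preimage_mono h) i b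

lemma totalHom_app_injective [Flat s] {U : X.Opens} (hU : IsAffineOpen U) :
    Function.Injective ((totalHom Y).app U) :=
  (Y.app_injective' _).comp (baseChangeFst_app_injective s hU)

variable [IsDomain R] [IsDiscreteValuationRing R]

/-- Integral functions of degree zero on the torsor come from the base. -/
lemma exists_totalHom_app_eq [Flat s] (hX : IsNormalScheme X) [IsIntegral (baseChange s K)]
    {U : X.Opens} (hU : IsAffineOpen U) {b : Γ(Y.total, totalHom Y ⁻¹ᵁ U)}
    (hb : (totalAction hζ Y U).Homog 0 b) (hb' : ((totalHom Y).app U).hom.IsIntegralElem b) :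
    ∃ a, (totalHom Y).app U a = b := by
  obtain ⟨y, rfl⟩ := ConstTorsor.exists_app_eq_of_homog hb
  have h1 : ((baseChangeFst s K).app U).hom.IsIntegralElem y := by
    obtain ⟨p, hp, hpy⟩ := hb'
    exact ⟨p, hp, Y.app_injective' _
      ((Polynomial.hom_eval₂ p ((baseChangeFst s K).app U).hom (Y.proj.app _).hom y).trans
        (hpy.trans (map_zero _).symm))⟩
  obtain ⟨a, rfl⟩ := exists_app_eq_of_isIntegralElem s hX hU h1
  exact ⟨a, rfl⟩

lemma isIntegralElem_of_pow {A B : Type*} [CommRing A] [CommRing B] (φ : A →+* B) {b : B} {m : ℕ}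
    (hm : m ≠ 0) (h : φ.IsIntegralElem (b ^ m)) : φ.IsIntegralElem b := by
  let _ := φ.toAlgebra
  exact IsIntegral.of_pow (R := A) (Nat.pos_of_ne_zero hm) h

/-- The degree-one bundle on `X_K` is the restriction of an invertible module on `X`. A generator of
the latter near `x`, where `x` may lie in the special fibre, restricts to a generator of degree-one
functions over the whole of `U_K`, and such a generator is a unit. -/
lemma exists_isUnit_homog_totalAction
    (hPic : Set.SurjOn (pullbackClass (baseChangeFst s K)) (picTorsion m X)
      (picTorsion m (baseChange s K))) (x : X) :
    ∃ U : X.Opens, IsAffineOpen U ∧ x ∈ U ∧ ∃ t, (totalAction hζ Y U).Homog 1 t ∧ IsUnit t := by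
  obtain ⟨_, ⟨L, hL, -, rfl⟩, hc⟩ := hPic (Y.degreeOne_mem_picTorsion (rootDatum K s hζ))
  obtain ⟨e⟩ : Nonempty ((Scheme.Modules.pullback (baseChangeFst s K)).obj L ≅
    Y.degreeOne (rootDatum K s hζ)) := Quotient.exact hc
  let e' : L.restrict (baseChangeFst s K) ≅ Y.degreeOne (rootDatum K s hζ) :=
    (Scheme.Modules.restrictFunctorIsoPullback _).app L ≪≫ e
  obtain ⟨U', hx', g, hg⟩ := isInvertibleModule_iff.mp hL x
  obtain ⟨U, hU, hx, hUU'⟩ := Opens.isBasis_iff_nbhd.mp X.isBasis_affineOpens hx'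
  have hle : baseChangeFst s K ''ᵁ baseChangeFst s K ⁻¹ᵁ U ≤ U' := by
    rw [Scheme.Hom.image_preimage_eq_opensRange_inf]
    exact inf_le_right.trans hUU'
  have h1 := ((isGenerator_restrict_iff (baseChangeFst s K) _).mpr (hg.res hle)).map_iso e'
  exact ⟨U, hU, hx, _, ConstTorsor.homog_one_iff.mpr (eigenModule.val_mem _),
    ConstTorsor.isUnit_of_isGenerator (hU.preimage _) h1⟩

/-- If the special fibre of the normalization is reduced, an integral function some power of which
is divisible by the uniformizer is itself divisible by the uniformizer. -/
lemma exists_eq_mul_of_pow_eq_mul {ϖ : R} (hϖ : Irreducible ϖ)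
    (hY : IsReduced (baseChange (normalizationHom Y) (IsLocalRing.ResidueField R)))
    {U : X.Opens} (hU : IsAffineOpen U) {b c : Γ(Y.total, totalHom Y ⁻¹ᵁ U)} {n : ℕ}
    (hb : ((totalHom Y).app U).hom.IsIntegralElem b)
    (hc : ((totalHom Y).app U).hom.IsIntegralElem c)
    (h : b ^ n = (totalHom Y).app U (secOf s U ϖ) * c) :
    ∃ d, ((totalHom Y).app U).hom.IsIntegralElem d ∧ b = (totalHom Y).app U (secOf s U ϖ) * d := by
  let f := totalHom Y
  let W := f.fromNormalization ⁻¹ᵁ U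
  have hW : IsAffineOpen W := hU.preimage _
  let j := baseChangeFst (normalizationHom Y) (IsLocalRing.ResidueField R)
  obtain ⟨b, rfl⟩ := exists_normalizationVal_eq f hU hb
  obtain ⟨c, rfl⟩ := exists_normalizationVal_eq f hU hc
  have hv (r : R) : normalizationVal f U (secOf (normalizationHom Y) W r) =
      f.app U (secOf s U r) := by
    rw [app_secOf, normalizationVal, overApp, appLE_secOf]
    congr 2
    exact f.toNormalization_fromNormalization_assoc s
  have h1 : b ^ n = secOf (normalizationHom Y) W ϖ * c := normalizationVal_injective f hU (by
    rw [map_pow, map_mul, hv]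
    exact h)
  -- On the special fibre of the normalization `b` becomes nilpotent, hence zero by reducedness.
  have h2 : j.app W b ^ n = 0 := by
    rw [← map_pow, h1, map_mul, secOf_irreducible_map_eq_zero _ hϖ, zero_mul]
  have h3 : j.app W b = 0 := eq_zero_of_pow_eq_zero h2
  obtain ⟨d, hd⟩ := exists_eq_secOf_mul _ hϖ hW b h3
  refine ⟨normalizationVal f U d, normalizationVal_isIntegralElem f hU d, ?_⟩
  rw [hd, map_mul, hv]

/-- The key point: locally on `X`, there is an invertible function of degree one on the torsor
whose `m`-th power is an invertible function on `X`. -/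
theorem exists_homog_pow_eq [Flat s] (hX : IsNormalScheme X)
    [IsIntegral (baseChange s K)] [IsIntegral (baseChange s (IsLocalRing.ResidueField R))]
    (hPic : Set.SurjOn (pullbackClass (baseChangeFst s K)) (picTorsion m X)
      (picTorsion m (baseChange s K)))
    (hY : IsReduced (baseChange (normalizationHom Y) (IsLocalRing.ResidueField R))) (x : X) :
    ∃ U : X.Opens, IsAffineOpen U ∧ x ∈ U ∧ ∃ (t : Γ(Y.total, totalHom Y ⁻¹ᵁ U)) (u : (Γ(X, U))ˣ),
      (totalAction hζ Y U).Homog 1 t ∧ t ^ m = (totalHom Y).app U u := by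
  obtain ⟨ϖ, hϖ⟩ := IsDiscreteValuationRing.exists_irreducible R
  obtain ⟨U, hU, hx, t, ht, htu⟩ := exists_isUnit_homog_totalAction hζ Y hPic x
  refine ⟨U, hU, hx, ?_⟩
  let φ := ((totalHom Y).app U).hom
  obtain ⟨v, hv⟩ := ConstTorsor.exists_unit_of_isUnit_homog ht htu
  obtain ⟨n, k, u, hu⟩ := exists_pow_mul_eq (K := K) s hϖ hU ⟨x, hx⟩ v
  have hϖu : IsUnit (φ (secOf s U ϖ)) := (isUnit_app_secOf s hϖ U).map (Y.proj.app _).hom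
  obtain ⟨ϖi, hϖi⟩ := hϖu.exists_left_inv
  have hhom (a : Γ(X, U)) : (totalAction hζ Y U).Homog 0 (φ a) :=
    CyclicAction.homog_zero_iff.mpr (totalAction_σ_app hζ Y U a)
  have hϖih : (totalAction hζ Y U).Homog 0 ϖi := by
    refine CyclicAction.Homog.of_mul (hhom (secOf s U ϖ)) hϖu ?_
    rw [hϖi]
    exact CyclicAction.homog_one
  have h1 : φ (secOf s U ϖ) ^ n * t ^ m = φ (secOf s U ϖ ^ k * u) := by
    refine (congrArg (φ (secOf s U ϖ) ^ n * ·) hv.symm).trans ?_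
    refine Eq.trans ?_ (congrArg (Y.proj.app _) hu)
    rw [map_mul, map_pow]
    rfl
  -- From `ϖ^n t^m = ϖ^k u` one gets `(ϖ^n t)^m = ϖ^c u`; passing to `ϖ^n t` avoids a negative
  -- exponent.
  set c := k + n * (m - 1) with hc
  -- Dividing by `ϖ^(c / m)` leaves the exponent `c % m`, which is less than `m`.
  let t1 := t * φ (secOf s U ϖ) ^ n * ϖi ^ (c / m)
  have h2 : t1 ^ m = φ (secOf s U ϖ ^ (c % m) * u) := by
    have h3 : (t * φ (secOf s U ϖ) ^ n) ^ m = φ (secOf s U ϖ) ^ c * φ u := by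
      have h4 : n * m = n + n * (m - 1) := by
        obtain ⟨l, hl⟩ := Nat.exists_eq_add_of_le (NeZero.one_le (n := m))
        rw [hl, Nat.add_sub_cancel_left]
        ring
      rw [mul_pow, ← pow_mul, h4, pow_add, hc, pow_add]
      rw [map_mul, map_pow] at h1
      linear_combination φ (secOf s U ϖ) ^ (n * (m - 1)) * h1
    have h5 : φ (secOf s U ϖ) ^ c * ϖi ^ (m * (c / m)) = φ (secOf s U ϖ) ^ (c % m) := by
      conv_lhs => enter [1]; rw [← Nat.mod_add_div c m, pow_add]
      rw [mul_assoc, ← mul_pow, mul_comm _ ϖi, hϖi, one_pow, mul_one]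
    rw [mul_pow, h3, map_mul, map_pow, ← h5, ← pow_mul, mul_comm m]
    ring
  have ht1 : (totalAction hζ Y U).Homog 1 t1 := by
    have h3 := (ht.mul ((hhom (secOf s U ϖ)).pow n)).mul (hϖih.pow (c / m))
    simpa only [zero_mul, add_zero] using h3
  suffices h0 : c % m = 0 ∨ IsUnit (secOf s U ϖ) by
    rcases h0 with h0 | h0
    · exact ⟨t1, u, ht1, by rw [h2, h0, pow_zero, one_mul]⟩
    · exact ⟨t1, h0.unit ^ (c % m) * u, ht1, by rw [h2]; rfl⟩
  -- If `0 < c % m` and `ϖ` is not a unit on `U`, then `t1` is integral and `ϖ` divides `t1^m`, so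
  -- `t1 = ϖ d` with `d` integral.
  by_contra! hcon
  obtain ⟨hr, hnu⟩ := hcon
  have hrm : c % m < m := Nat.mod_lt _ (NeZero.pos m)
  have hti : φ.IsIntegralElem t1 :=
    isIntegralElem_of_pow φ (NeZero.ne m) (h2 ▸ φ.isIntegralElem_map)
  obtain ⟨d, hd, htd⟩ := exists_eq_mul_of_pow_eq_mul Y hϖ hY hU hti
    (c := φ (secOf s U ϖ ^ (c % m - 1) * u)) φ.isIntegralElem_map (n := m) (by
      rw [h2]
      refine Eq.trans ?_ (map_mul φ _ _)
      rw [← mul_assoc, ← pow_succ', Nat.sub_add_cancel (Nat.pos_of_ne_zero hr)])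
  have hdh : (totalAction hζ Y U).Homog 1 d := by
    refine CyclicAction.Homog.of_mul (hhom (secOf s U ϖ)) hϖu ?_
    rw [mul_comm, add_zero]
    exact htd ▸ ht1
  let _ := φ.toAlgebra
  obtain ⟨a, ha⟩ := exists_totalHom_app_eq hζ Y hX hU hdh.pow_card (IsIntegral.pow hd m)
  -- By normality `d^m` is a function `a` on `U`. Cancelling `ϖ^(c % m)` from `ϖ^m d^m = ϖ^(c % m)
  -- u` shows that `ϖ` divides the unit `u`.
  have h6 : secOf s U ϖ ^ (m - c % m) * a = u := by
    refine totalHom_app_injective Y hU ?_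
    rw [map_mul, map_pow, ha]
    have h7 : φ (secOf s U ϖ) ^ (c % m) * (φ (secOf s U ϖ) ^ (m - c % m) * d ^ m) =
        φ (secOf s U ϖ) ^ (c % m) * φ u := by
      rw [← mul_assoc, ← pow_add, Nat.add_sub_cancel' hrm.le, ← mul_pow]
      refine (congrArg (· ^ m) htd.symm).trans ?_
      rw [h2, map_mul, map_pow]
    exact (hϖu.pow _).mul_left_cancel h7
  refine hnu (isUnit_of_dvd_unit ?_ u.isUnit)
  rw [← h6]
  exact (dvd_pow_self _ (Nat.sub_ne_zero_of_lt hrm)).mul_right a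

end

/-! ### Quasi-coherence of the algebra of functions with integral components. -/

section

section Localization

variable {X Z : Scheme.{u}} (f : Z ⟶ X) [QuasiCompact f] [QuasiSeparated f] {U : X.Opens}

lemma exists_res_eq_pow_mul (hU : IsAffineOpen U) (r : Γ(X, U))
    (b : Γ(Z, f ⁻¹ᵁ X.basicOpen r)) :
    ∃ (n : ℕ) (y : Γ(Z, f ⁻¹ᵁ U)),
      Z.presheaf.map (homOfLE (f.preimage_mono (X.basicOpen_le r))).op y =
        f.app _ (X.presheaf.map (homOfLE (X.basicOpen_le r)).op r) ^ n * b := by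
  let _ : Algebra Γ(Z, f ⁻¹ᵁ U) Γ(Z, f ⁻¹ᵁ X.basicOpen r) :=
    (Z.presheaf.map (homOfLE (f.preimage_mono (X.basicOpen_le r))).op).hom.toAlgebra
  have := isLocalization_preimage_basicOpen f hU r
  obtain ⟨n, y, h⟩ := IsLocalization.Away.surj (f.app U r) b
  refine ⟨n, y, h.symm.trans ?_⟩
  rw [mul_comm]
  congr 2
  exact (app_map f (X.basicOpen_le r) r).symm

lemma exists_pow_mul_eq_of_res_eq (hU : IsAffineOpen U) (r : Γ(X, U)) {x y : Γ(Z, f ⁻¹ᵁ U)}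
    (h : Z.presheaf.map (homOfLE (f.preimage_mono (X.basicOpen_le r))).op x =
      Z.presheaf.map (homOfLE (f.preimage_mono (X.basicOpen_le r))).op y) :
    ∃ n : ℕ, f.app U r ^ n * x = f.app U r ^ n * y := by
  let _ : Algebra Γ(Z, f ⁻¹ᵁ U) Γ(Z, f ⁻¹ᵁ X.basicOpen r) :=
    (Z.presheaf.map (homOfLE (f.preimage_mono (X.basicOpen_le r))).op).hom.toAlgebra
  have := isLocalization_preimage_basicOpen f hU r
  exact IsLocalization.Away.exists_of_eq (f.app U r) h

end Localization

variable {R : Type u} [CommRing R] [IsDomain R] [IsDiscreteValuationRing R]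
  {K : Type u} [Field K] [Algebra R K] [IsFractionRing R K]
  [CharZero K] {X : Scheme.{u}} {s : X ⟶ Spec (.of R)} {m : ℕ} [NeZero m] {ζ : R}
  (hζ : IsPrimitiveRoot ζ m)
  (Y : ConstTorsor (Multiplicative (ZMod m)) (baseChange s K))

/-- The functions on the torsor all of whose homogeneous components are integral over the base. -/
abbrev integralSections (U : X.Opens) : Subring Γ(Y.total, totalHom Y ⁻¹ᵁ U) :=
  (totalAction hζ Y U).integralSubring ((totalHom Y).app U).hom (totalAction_σ_app hζ Y U)

lemma map_isIntegralElem {U V : X.Opens} (h : V ≤ U) {b : Γ(Y.total, totalHom Y ⁻¹ᵁ U)}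
    (hb : ((totalHom Y).app U).hom.IsIntegralElem b) :
    ((totalHom Y).app V).hom.IsIntegralElem
      (Y.total.presheaf.map (homOfLE ((totalHom Y).preimage_mono h)).op b) := by
  obtain ⟨p, hp, hpb⟩ := hb
  refine ⟨p.map (X.presheaf.map (homOfLE h).op).hom, hp.map _, ?_⟩
  rw [Polynomial.eval₂_map]
  have h1 : ((totalHom Y).app V).hom.comp (X.presheaf.map (homOfLE h).op).hom =
      (Y.total.presheaf.map (homOfLE ((totalHom Y).preimage_mono h)).op).hom.comp
        ((totalHom Y).app U).hom := RingHom.ext (app_map (totalHom Y) h)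
  rw [h1]
  refine (Polynomial.hom_eval₂ _ _ _ _).symm.trans ?_
  rw [hpb, map_zero]

variable [Flat s] (hX : IsNormalScheme X) [IsIntegral (baseChange s K)]

include hX in
-- The power `b^m` is integral of degree zero, so it comes from `U` by normality. Integrality of a
-- homogeneous function is thus the same as its `m`-th power coming from the base.
lemma exists_pow_eq_of_isIntegralElem {U : X.Opens} (hU : IsAffineOpen U)
    {i : ℕ} {b : Γ(Y.total, totalHom Y ⁻¹ᵁ U)} (hb : (totalAction hζ Y U).Homog i b)
    (hb' : ((totalHom Y).app U).hom.IsIntegralElem b) : ∃ a, (totalHom Y).app U a = b ^ m := by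
  let _ := ((totalHom Y).app U).hom.toAlgebra
  exact exists_totalHom_app_eq hζ Y hX hU hb.pow_card (IsIntegral.pow hb' m)

include hX in
lemma exists_mem_integralSections_of_homog {U : X.Opens} (hU : IsAffineOpen U) (r : Γ(X, U))
    {i : ℕ} {b : Γ(Y.total, totalHom Y ⁻¹ᵁ X.basicOpen r)}
    (hb : (totalAction hζ Y (X.basicOpen r)).Homog i b)
    (hb' : ((totalHom Y).app _).hom.IsIntegralElem b) :
    ∃ (n : ℕ), ∃ c ∈ integralSections hζ Y U,
      Y.total.presheaf.map (homOfLE ((totalHom Y).preimage_mono (X.basicOpen_le r))).op c =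
        (totalHom Y).app _ (X.presheaf.map (homOfLE (X.basicOpen_le r)).op r) ^ n * b := by
  let f := totalHom Y
  let V := X.basicOpen r
  have hle : V ≤ U := X.basicOpen_le r
  let φ := (f.app U).hom
  let φ' := (f.app V).hom
  let ρ := (Y.total.presheaf.map (homOfLE (f.preimage_mono hle)).op).hom
  let ρ' := (X.presheaf.map (homOfLE hle).op).hom
  have hρ (a : Γ(X, U)) : ρ (φ a) = φ' (ρ' a) := (app_map f hle a).symm
  obtain ⟨a, ha⟩ := exists_pow_eq_of_isIntegralElem hζ Y hX (hU.basicOpen r) hb hb'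
  obtain ⟨l, a', ha'⟩ : ∃ (l : ℕ) (a' : Γ(X, U)), ρ' a' = ρ' r ^ l * a := by
    have := hU.isLocalization_basicOpen r
    obtain ⟨l, a', h⟩ := IsLocalization.Away.surj r a
    exact ⟨l, a', h.symm.trans (mul_comm _ _)⟩
  -- Denominators are cleared separately for `b^m` on `X` and for `b` on the torsor; the numerator
  -- `y` is then projected to degree `i`.
  obtain ⟨n, y, hy⟩ := exists_res_eq_pow_mul f hU r b
  set y' := (totalAction hζ Y U).proj i y with hy'
  have h1 : ρ y' = φ' (ρ' r) ^ n * b := by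
    refine (map_totalAction_proj hζ Y hle i y).trans ?_
    rw [hy]
    refine (CyclicAction.proj_of_homog (i := i) ?_ i).trans (if_pos (Nat.ModEq.refl i))
    have := (CyclicAction.homog_zero_iff.mpr (totalAction_σ_app hζ Y V (ρ' r))).pow n |>.mul hb
    rwa [zero_mul, zero_add] at this
  have h2 : ρ (φ r ^ l * y' ^ m) = ρ (φ (r ^ (n * m) * a')) := by
    rw [hρ, map_mul, map_mul, map_pow, map_pow, h1, hρ, map_mul, map_pow, ha', map_mul, map_pow,
      map_pow]
    have : φ' a = b ^ m := ha
    rw [this]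
    ring
  -- The relation between `y'^m` and `a'` holds only over the basic open set, and needs a further
  -- power of `r` to hold over `U`.
  obtain ⟨N, hN⟩ := exists_pow_mul_eq_of_res_eq f hU r h2
  have hN' : φ r ^ N * (φ r ^ l * y' ^ m) = φ r ^ N * φ (r ^ (n * m) * a') := hN
  -- Multiplication by `r^(l + N)` brings the `m`-th power of `y'` into the functions on `U`; since
  -- `m ≥ 1`, the `m`-th power of this factor contains `r^(l + N)`.
  refine ⟨l + N + n, φ r ^ (l + N) * y', ?_, ?_⟩
  · refine CyclicAction.Homog.mem_integralSubring (i := i) _ _ ?_ ?_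
    · have := (CyclicAction.homog_zero_iff.mpr (totalAction_σ_app hζ Y U r)).pow (l + N) |>.mul
        (CyclicAction.homog_proj (S := totalAction hζ Y U) i y)
      rwa [zero_mul, zero_add] at this
    · refine isIntegralElem_of_pow φ (NeZero.ne m) ?_
      have h3 : (φ r ^ (l + N) * y') ^ m =
          φ (r ^ ((l + N) * (m - 1)) * (r ^ N * (r ^ (n * m) * a'))) := by
        have h4 : (l + N) * m = (l + N) * (m - 1) + (l + N) := by
          obtain ⟨k, hk⟩ := Nat.exists_eq_add_of_le' (NeZero.one_le (n := m))
          rw [hk, Nat.add_sub_cancel]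
          ring
        rw [map_mul, map_mul, map_pow, map_pow, ← hN', mul_pow, ← pow_mul, h4, pow_add, pow_add]
        ring
      rw [h3]
      exact φ.isIntegralElem_map
  · change ρ _ = φ' (ρ' r) ^ _ * b
    rw [map_mul, map_pow, hρ, h1]
    ring

/-- The quasi-coherent algebra of functions on the torsor with integral homogeneous components. -/
def integralAlgebra : QcohSubalgebra (totalHom Y) where
  obj := integralSections hζ Y
  app_mem a := CyclicAction.map_mem_integralSubring _ _ a
  map_mem h b hb i := by
    have := map_isIntegralElem Y h (hb i)
    rwa [map_totalAction_proj hζ Y h] at this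
  exists_mul {U} hU r b hb := by
    choose n c hc h using fun i ↦ exists_mem_integralSections_of_homog hζ Y hX hU r
      (CyclicAction.homog_proj (S := totalAction hζ Y _) i b) (hb i)
    refine ⟨∑ i ∈ Finset.range m, n i, ∑ i ∈ Finset.range m,
      (totalHom Y).app U r ^ (∑ j ∈ Finset.range m, n j - n i) * c i, ?_, ?_⟩
    · exact sum_mem fun i _ ↦ mul_mem (pow_mem (CyclicAction.map_mem_integralSubring _ _ r) _) (hc i)
    · rw [map_sum]
      conv_rhs => rw [← CyclicAction.sum_proj (S := totalAction hζ Y _) b, Finset.mul_sum]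
      refine Finset.sum_congr rfl fun i hi ↦ ?_
      have hn : n i ≤ ∑ j ∈ Finset.range m, n j := Finset.single_le_sum (fun _ _ ↦ Nat.zero_le _) hi
      refine (map_mul _ _ _).trans ((congrArg₂ (· * ·) (map_pow _ _ _) (h i)).trans ?_)
      rw [← app_map (totalHom Y) (X.basicOpen_le r), ← mul_assoc, ← pow_add, Nat.sub_add_cancel hn]

end

/-! ### Functions on `μ_m × Z` and their values at the powers of `ζ`. -/

section

open MonoidalCategory CartesianMonoidalCategory

/-- Fourier inversion for the group of `m`-th roots of unity. -/
lemma eq_zero_of_forall_sum_pow_mul {R B : Type*} [CommRing R] [IsDomain R] [CommRing B]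
    (φ : R →+* B) {ζ : R} {m : ℕ} (hζ : IsPrimitiveRoot ζ m)
    (hB : ∀ b : B, (m : B) * b = 0 → b = 0) {y : ℕ → B}
    (h : ∀ k < m, ∑ i ∈ Finset.range m, φ (ζ ^ k) ^ i * y i = 0) {j : ℕ} (hj : j < m) : y j = 0 := by
  refine hB _ ?_
  -- The weight `ζ^(k(m - j))` is `ζ^(-kj)`; summing over `k` isolates `m y_j`.
  have h1 : ∑ k ∈ Finset.range m, φ (ζ ^ (k * (m - j))) *
      ∑ i ∈ Finset.range m, φ (ζ ^ k) ^ i * y i = 0 :=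
    Finset.sum_eq_zero fun k hk ↦ by rw [h k (Finset.mem_range.mp hk), mul_zero]
  have h2 (i : ℕ) : ∑ k ∈ Finset.range m, φ (ζ ^ (k * (m - j))) * (φ (ζ ^ k) ^ i * y i) =
      φ (∑ k ∈ Finset.range m, ζ ^ (k * (m - j + i))) * y i := by
    rw [map_sum, Finset.sum_mul]
    refine Finset.sum_congr rfl fun k _ ↦ ?_
    rw [← mul_assoc, ← map_pow, ← map_mul]
    congr 2
    ring
  simp only [Finset.mul_sum] at h1
  rw [Finset.sum_comm, Finset.sum_congr rfl fun i _ ↦ h2 i,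
    Finset.sum_eq_single_of_mem j (Finset.mem_range.mpr hj)] at h1
  · rw [Nat.sub_add_cancel hj.le] at h1
    rw [← h1]
    congr 1
    simp only [mul_comm _ m, pow_mul, hζ.pow_eq_one, one_pow, Finset.sum_const, Finset.card_range,
      nsmul_one, map_natCast]
  · intro i hi hij
    rw [sum_pow_mul_of_not_dvd hζ, map_zero, zero_mul]
    rintro ⟨c, hc⟩
    rw [Finset.mem_range] at hi
    -- The number `m - j + i` lies strictly between `0` and `2 m`, so it is divisible by `m` only
    -- for `i = j`.
    obtain rfl | rfl | hc2 : c = 0 ∨ c = 1 ∨ 2 ≤ c := by omega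
    · omega
    · omega
    · have := Nat.mul_le_mul_left m hc2
      omega

variable {R : Type u} [CommRing R] {X Z : Scheme.{u}} (s : X ⟶ Spec (.of R)) (m : ℕ)
  (p : Z ⟶ X)

/-- The product `μ_m ×_R Z`. -/
abbrev muProd : Over (Spec (.of R)) := (muGrp m R).X ⊗ Over.mk (p ≫ s)

/-- The projection `μ_m ×_R Z ⟶ Z`. -/
abbrev muProdSnd : (muProd s m p).left ⟶ Z := (snd (muGrp m R).X (Over.mk (p ≫ s))).left

/-- The morphism `μ_m ×_R Z ⟶ X`. -/
abbrev muProdHom : (muProd s m p).left ⟶ X := muProdSnd s m p ≫ p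

lemma isPullback_muProd : IsPullback (muProdSnd s m p)
    (muLeft (fst (muGrp m R).X (Over.mk (p ≫ s)))) (p ≫ s)
    (Spec.map (CommRingCat.ofHom (algebraMap R (MuAlgebra m R)))) :=
  (IsPullback.of_hasPullback _ _).flip

instance : IsAffineHom (muProdSnd s m p) :=
  isAffineHom_isStableUnderBaseChange.of_isPullback (isPullback_muProd s m p).flip
    (inferInstanceAs (IsAffineHom (Spec.map (CommRingCat.ofHom (algebraMap R (MuAlgebra m R))))))

/-- Pullback of functions along `μ_m ×_R Z ⟶ Z`. -/
abbrev muSndApp (U : X.Opens) : Γ(Z, p ⁻¹ᵁ U) ⟶ Γ((muProd s m p).left, muProdHom s m p ⁻¹ᵁ U) :=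
  overApp (h := muProdSnd s m p) rfl U

/-- The coordinate of `μ_m` on `μ_m ×_R Z`. -/
abbrev muProdCoord (U : X.Opens) : Γ((muProd s m p).left, muProdHom s m p ⁻¹ᵁ U) :=
  coord (fst (muGrp m R).X (Over.mk (p ≫ s))) (muProdHom s m p ⁻¹ᵁ U)

variable {s m p}

/-- A base change of `R[T]/(T^m - 1)`, which is generated over `R` by the powers of `T` below `m`.
-/
lemma exists_sum_muProdCoord [NeZero m] [IsAffineHom p] {U : X.Opens} (hU : IsAffineOpen U)
    (x : Γ((muProd s m p).left, muProdHom s m p ⁻¹ᵁ U)) :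
    ∃ y : ℕ → Γ(Z, p ⁻¹ᵁ U),
      x = ∑ i ∈ Finset.range m, muProdCoord s m p U ^ i * muSndApp s m p U (y i) := by
  have H := isPushout_secOf (isPullback_muProd s m p) (hU.preimage p)
  obtain ⟨n, b, c, hx⟩ := CommRingCat.exists_sum_of_isPushout H x
  choose r hr using fun k ↦ exists_sum_muCoord m R (c k)
  refine ⟨fun i ↦ ∑ k, b k * secOf (p ≫ s) _ (r k i), ?_⟩
  have h1 (a : Γ(Z, p ⁻¹ᵁ U)) : (muProdSnd s m p).app _ a = muSndApp s m p U a := by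
    rw [Scheme.Hom.app_eq_appLE]
    rfl
  have h2 (a : R) : secOf (muLeft (fst (muGrp m R).X (Over.mk (p ≫ s))))
      (muProdSnd s m p ⁻¹ᵁ p ⁻¹ᵁ U) (algebraMap R (MuAlgebra m R) a) =
      muSndApp s m p U (secOf (p ≫ s) _ a) := by
    refine Eq.trans ?_ (h1 _)
    exact congr($(H.w) a).symm
  refine hx.trans ?_
  simp only [map_sum, Finset.mul_sum]
  rw [Finset.sum_comm]
  refine Finset.sum_congr rfl fun k _ ↦ ?_
  conv_lhs => enter [2]; rw [hr k]
  refine (congrArg₂ (· * ·) (h1 (b k)) (map_sum (secOf (muLeft (fst (muGrp m R).X (Over.mk (p ≫ s))))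
      (muProdSnd s m p ⁻¹ᵁ p ⁻¹ᵁ U)) _ _)).trans ?_
  refine (Finset.mul_sum _ _ _).trans (Finset.sum_congr rfl fun i _ ↦ ?_)
  refine (congrArg (muSndApp s m p U (b k) * ·) ((map_mul _ _ _).trans
    (congrArg₂ (· * ·) (h2 _) (map_pow _ _ _)))).trans ?_
  rw [map_mul, ← mul_assoc]
  exact mul_comm _ _

section Lift

variable {W : Over (Spec (.of R))} (f : W ⟶ (muGrp m R).X) (h : W ⟶ Over.mk (p ≫ s))

lemma lift_comp_muProdHom {w : W.left ⟶ X} (hw : h.left ≫ p = w) :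
    (lift f h).left ≫ muProdHom s m p = w := by
  rw [← hw]
  exact (Category.assoc _ _ _).symm.trans congr($(lift_snd f h).left ≫ p)

lemma overApp_lift_muSndApp {w : W.left ⟶ X} (hw : h.left ≫ p = w) (U : X.Opens)
    (x : Γ(Z, p ⁻¹ᵁ U)) :
    overApp (lift_comp_muProdHom f h hw) U (muSndApp s m p U x) = overApp hw U x := by
  have h1 : (lift f h).left ≫ muProdSnd s m p = h.left := congr($(lift_snd f h).left)
  subst hw
  have h2 := Scheme.Hom.appLE_comp_appLE (lift f h).left (muProdSnd s m p) (p ⁻¹ᵁ U)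
    (muProdHom s m p ⁻¹ᵁ U) ((h.left ≫ p) ⁻¹ᵁ U) le_rfl
    (preimage_le_of_comp (lift_comp_muProdHom f h rfl) U)
  refine (congr($h2 x)).trans ?_
  have h3 := appLE_congr_hom h1 (U := p ⁻¹ᵁ U) (V := (h.left ≫ p) ⁻¹ᵁ U) (by rw [h1]; exact le_rfl)
    le_rfl
  exact congr($h3 x)

lemma overApp_lift_muProdCoord {w : W.left ⟶ X} (hw : h.left ≫ p = w) (U : X.Opens) :
    overApp (lift_comp_muProdHom f h hw) U (muProdCoord s m p U) = coord f (w ⁻¹ᵁ U) := by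
  refine (appLE_coord (lift f h) (fst (muGrp m R).X (Over.mk (p ≫ s))) _).trans ?_
  rw [lift_fst]

/-- If the pullback of a function `x` along `a : μ_m × Z ⟶ Z` is `∑ Tⁱ xᵢ`, its pullback along
`(f, h) : W ⟶ μ_m × Z` composed with `a` is `∑ T(f)ⁱ h^* xᵢ`. -/
lemma overApp_lift_comp {a : muProd s m p ⟶ Over.mk (p ≫ s)} (ha : a.left ≫ p = muProdHom s m p)
    {U : X.Opens} {x : Γ(Z, p ⁻¹ᵁ U)} {y : ℕ → Γ(Z, p ⁻¹ᵁ U)}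
    (hx : overApp ha U x = ∑ i ∈ Finset.range m, muProdCoord s m p U ^ i * muSndApp s m p U (y i))
    {w : W.left ⟶ X} (hw : h.left ≫ p = w) {g : W ⟶ Over.mk (p ≫ s)} (hg : lift f h ≫ a = g)
    (hgw : g.left ≫ p = w) :
    overApp hgw U x = ∑ i ∈ Finset.range m, coord f (w ⁻¹ᵁ U) ^ i * overApp hw U (y i) := by
  subst hg
  have h1 := overApp_comp ha (lift_comp_muProdHom f h hw) U
  refine (congr($h1 x)).trans ?_
  refine (congrArg (overApp (lift_comp_muProdHom f h hw) U) hx).trans ?_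
  rw [map_sum]
  refine Finset.sum_congr rfl fun i _ ↦ ?_
  rw [map_mul, map_pow]
  exact congrArg₂ (· * ·) (congrArg (· ^ i) (overApp_lift_muProdCoord f h hw U))
    (overApp_lift_muSndApp f h hw U (y i))

end Lift

section Eval

variable (s p) in
/-- The constant section of `μ_m × Z ⟶ Z` given by an `m`-th root of unity. -/
abbrev muEval (g : rootsOfUnity m R) : Over.mk (p ≫ s) ⟶ muProd s m p :=
  lift (toUnit (Over.mk (p ≫ s)) ≫ muSection g) (𝟙 _)

lemma muEval_comp (g : rootsOfUnity m R) : (muEval s p g).left ≫ muProdHom s m p = p :=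
  lift_comp_muProdHom _ _ (Category.id_comp p)

lemma muEval_muSndApp (g : rootsOfUnity m R) (U : X.Opens) (x : Γ(Z, p ⁻¹ᵁ U)) :
    overApp (muEval_comp (s := s) g) U (muSndApp s m p U x) = x := by
  refine (overApp_lift_muSndApp _ _ (Category.id_comp p) U x).trans ?_
  exact congr($(overApp_id U) x)

lemma coord_toUnit_muSection (g : rootsOfUnity m R) (U : Z.Opens) :
    coord (toUnit (Over.mk (p ≫ s)) ≫ muSection g) U = secOf (p ≫ s) U ((g : Rˣ) : R) := by
  refine (coord_muSection _ _ _).trans ?_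
  have := Over.w (toUnit (Over.mk (p ≫ s)))
  exact congrArg (secOf · U _) ((Category.comp_id _).symm.trans this)

lemma muEval_muProdCoord (g : rootsOfUnity m R) (U : X.Opens) :
    overApp (muEval_comp (s := s) g) U (muProdCoord s m p U) =
      secOf (p ≫ s) (p ⁻¹ᵁ U) ((g : Rˣ) : R) :=
  (overApp_lift_muProdCoord _ _ (Category.id_comp p) U).trans (coord_toUnit_muSection g _)

variable [IsDomain R] {ζ : R} [NeZero m] (hζ : IsPrimitiveRoot ζ m)

include hζ in
-- Fourier inversion. The points `ζ^k` of `μ_m` may coincide on the special fibre; it suffices that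
-- multiplication by `m` is injective on functions on `Z`.
lemma eq_zero_of_sum_muProdCoord {U : X.Opens}
    (hU : ∀ x : Γ(Z, p ⁻¹ᵁ U), (m : Γ(Z, p ⁻¹ᵁ U)) * x = 0 → x = 0) {y : ℕ → Γ(Z, p ⁻¹ᵁ U)}
    (h : ∀ k, overApp (muEval_comp (s := s) (hζ.toRootsOfUnity ^ k)) U
      (∑ i ∈ Finset.range m, muProdCoord s m p U ^ i * muSndApp s m p U (y i)) = 0)
    {j : ℕ} (hj : j < m) : y j = 0 := by
  refine eq_zero_of_forall_sum_pow_mul (secOf (p ≫ s) (p ⁻¹ᵁ U)) hζ hU (fun k _ ↦ ?_) hj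
  rw [← h k, map_sum]
  refine Finset.sum_congr rfl fun i _ ↦ ?_
  refine Eq.trans ?_ ((map_mul _ _ _).trans (congrArg₂ (· * ·) ((map_pow _ _ _).trans
    (congrArg (· ^ i) (muEval_muProdCoord _ U))) (muEval_muSndApp _ U (y i)))).symm
  simp

include hζ in
/-- A function on `μ_m × Z` whose values at all powers of a primitive root vanish is zero. -/
lemma eq_zero_of_muEval [IsAffineHom p] {U : X.Opens} (hU : IsAffineOpen U)
    (hm : ∀ x : Γ(Z, p ⁻¹ᵁ U), (m : Γ(Z, p ⁻¹ᵁ U)) * x = 0 → x = 0)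
    {x : Γ((muProd s m p).left, muProdHom s m p ⁻¹ᵁ U)}
    (h : ∀ k, overApp (muEval_comp (s := s) (hζ.toRootsOfUnity ^ k)) U x = 0) : x = 0 := by
  obtain ⟨y, rfl⟩ := exists_sum_muProdCoord hU x
  refine Finset.sum_eq_zero fun i hi ↦ ?_
  rw [eq_zero_of_sum_muProdCoord hζ hm h (Finset.mem_range.mp hi), map_zero, mul_zero]

include hζ in
lemma eq_of_sum_muProdCoord_eq {U : X.Opens}
    (hU : ∀ x : Γ(Z, p ⁻¹ᵁ U), (m : Γ(Z, p ⁻¹ᵁ U)) * x = 0 → x = 0) {y z : ℕ → Γ(Z, p ⁻¹ᵁ U)}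
    (h : ∑ i ∈ Finset.range m, muProdCoord s m p U ^ i * muSndApp s m p U (y i) =
      ∑ i ∈ Finset.range m, muProdCoord s m p U ^ i * muSndApp s m p U (z i))
    {j : ℕ} (hj : j < m) : y j = z j := by
  refine sub_eq_zero.mp (eq_zero_of_sum_muProdCoord (s := s) (y := fun i ↦ y i - z i) hζ hU
    (fun k ↦ ?_) hj)
  simp only [map_sub, mul_sub, Finset.sum_sub_distrib]
  rw [h, sub_self]

end Eval

end

/-! ### The coaction of a `μ_m`-torsor; integral models and their uniqueness. -/

section

open MonoidalCategory CartesianMonoidalCategory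

namespace CyclicAction

variable {m : ℕ} {B : Type*} [CommRing B] {S : CyclicAction m B}

lemma proj_congr {i k : ℕ} (h : i ≡ k [MOD m]) (b : B) : S.proj i b = S.proj k b := by
  simp only [proj]
  congr 1
  refine Finset.sum_congr rfl fun j _ ↦ ?_
  rw [z_pow_congr ((h.mul_left (m - 1)).mul_right j)]

lemma proj_mul_of_homog [NeZero m] {i : ℕ} {a : B} (ha : S.Homog i a) (k : ℕ) (b : B) :
    S.proj (i + k) (a * b) = a * S.proj k b := by
  conv_lhs => rw [← sum_proj (S := S) b, Finset.mul_sum, proj_sum]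
  conv_rhs => rw [← sum_proj (S := S) b, proj_sum, Finset.mul_sum]
  refine Finset.sum_congr rfl fun l _ ↦ ?_
  rw [proj_of_homog (ha.mul (homog_proj l b)), proj_of_homog (homog_proj l b), mul_ite, mul_zero]
  congr 1
  exact propext ⟨fun h ↦ Nat.ModEq.add_left_cancel' i h, fun h ↦ h.add_left i⟩

lemma eq_zero_of_card_mul (S : CyclicAction m B) {b : B} (h : (m : B) * b = 0) : b = 0 := by
  rw [← one_mul b, ← S.w_mul, mul_assoc, h, mul_zero]

/-- Homogeneous components are determined by the orbit. -/
lemma proj_eq_of_iterate [NeZero m] {R : Type*} [CommRing R] [IsDomain R] {ζ : R}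
    (hζ : IsPrimitiveRoot ζ m) (φ : R →+* B) (hφ : φ ζ = S.z) {b : B} {y : ℕ → B}
    (h : ∀ k, S.σ^[k] b = ∑ i ∈ Finset.range m, φ (ζ ^ k) ^ i * y i) {i : ℕ} (hi : i < m) :
    S.proj i b = y i := by
  refine sub_eq_zero.mp (eq_zero_of_forall_sum_pow_mul φ hζ
    (fun _ ↦ S.eq_zero_of_card_mul) (y := fun i ↦ S.proj i b - y i) (fun k _ ↦ ?_) hi)
  simp only [mul_sub, Finset.sum_sub_distrib]
  rw [← h k, sub_eq_zero]
  conv_rhs => rw [← sum_proj (S := S) b, ← RingHom.coe_pow, map_sum]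
  simp only [RingHom.coe_pow]
  refine Finset.sum_congr rfl fun l _ ↦ ?_
  rw [(homog_proj l b).iterate, map_pow, hφ, ← pow_mul, mul_comm k]

end CyclicAction

section Torsor

variable {R : Type u} [CommRing R] {X : Scheme.{u}} {s : X ⟶ Spec (.of R)} {m : ℕ}
  (T : Torsor (muGrp m R) s)

attribute [instance] Torsor.affine

/-- Pullback of functions along the action of `μ_m`. -/
abbrev Torsor.actApp (U : X.Opens) :
    Γ(T.total, T.proj ⁻¹ᵁ U) ⟶ Γ((muProd s m T.proj).left, muProdHom s m T.proj ⁻¹ᵁ U) :=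
  overApp (g := muProdHom s m T.proj) (h := T.act.left) T.act_proj U

lemma Torsor.lift_mul_act {W : Over (Spec (.of R))} (f g : W ⟶ (muGrp m R).X) (h : W ⟶ T.over) :
    lift (lift f g ≫ MonObj.mul) h ≫ T.act = lift f (lift g h ≫ T.act) ≫ T.act := by
  simpa using congr(lift (lift f g) h ≫ $(T.mul_act))

lemma Torsor.lift_one_act {W : Over (Spec (.of R))} (h : W ⟶ T.over) :
    lift (toUnit W ≫ MonObj.one) h ≫ T.act = h := by
  have h1 := congr(h ≫ $(T.one_act))
  rw [comp_lift_assoc, Category.comp_id, ← Category.assoc, comp_toUnit] at h1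
  exact h1

lemma Torsor.translate_proj (g : rootsOfUnity m R) :
    T.translate (muSection g) ≫ T.proj = T.proj :=
  ((Category.assoc _ _ _).trans (congrArg (_ ≫ ·) T.act_proj)).trans
    (muEval_comp (s := s) (p := T.proj) g)

variable {T}

/-- If `act^* x = ∑ Tⁱ yᵢ`, then `(gh)^* x = h^* g^* x` for roots of unity `g` and `h`. -/
lemma Torsor.overApp_translate {U : X.Opens} {x : Γ(T.total, T.proj ⁻¹ᵁ U)}
    {y : ℕ → Γ(T.total, T.proj ⁻¹ᵁ U)}
    (hx : T.actApp U x =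
      ∑ i ∈ Finset.range m, muProdCoord s m T.proj U ^ i * muSndApp s m T.proj U (y i))
    (g h : rootsOfUnity m R) :
    overApp (T.translate_proj h) U
      (∑ i ∈ Finset.range m, secOf (T.proj ≫ s) (T.proj ⁻¹ᵁ U) ((g : Rˣ) : R) ^ i * y i) =
    ∑ i ∈ Finset.range m, secOf (T.proj ≫ s) (T.proj ⁻¹ᵁ U) ((g : Rˣ) * (h : Rˣ) : R) ^ i * y i := by
  -- Both expansions compute the pullback of `x` along `y ↦ g (h y)`: here through the point `g h`,
  -- in `h2` through the translate by `h`.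
  have h1 := overApp_lift_comp (lift (toUnit _ ≫ muSection g) (toUnit _ ≫ muSection h) ≫ MonObj.mul)
    (𝟙 T.over) T.act_proj hx (Category.id_comp T.proj) (T.lift_mul_act _ _ _) (by
      rw [← T.lift_mul_act]
      exact ((Category.assoc _ _ _).trans (congrArg (_ ≫ ·) T.act_proj)).trans
        (lift_comp_muProdHom _ _ (Category.id_comp T.proj)))
  have h2 := overApp_lift_comp (toUnit _ ≫ muSection g) (lift (toUnit _ ≫ muSection h) (𝟙 T.over) ≫ T.act)
    T.act_proj hx (T.translate_proj h) rfl (by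
      rw [← T.lift_mul_act]
      exact ((Category.assoc _ _ _).trans (congrArg (_ ≫ ·) T.act_proj)).trans
        (lift_comp_muProdHom _ _ (Category.id_comp T.proj)))
  have h3 := h2.symm.trans h1
  rw [map_sum]
  refine Eq.trans (Finset.sum_congr rfl fun i _ ↦ ?_) (h3.trans (Finset.sum_congr rfl fun i _ ↦ ?_))
  · rw [map_mul, map_pow, appLE_secOf]
    refine congrArg₂ (· * ·) (congrArg (· ^ i) ?_) rfl
    refine Eq.trans ?_ (coord_toUnit_muSection g _).symm
    rw [← Category.assoc, T.translate_proj]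
  · refine congrArg₂ (fun a b : Γ(T.total, T.proj ⁻¹ᵁ U) ↦ a * b)
      (congrArg (fun a : Γ(T.total, T.proj ⁻¹ᵁ U) ↦ a ^ i) ?_) congr($(overApp_id U) (y i))
    refine (coord_mul _ _ _).trans ?_
    rw [map_mul]
    exact congrArg₂ (· * ·) (coord_toUnit_muSection g _) (coord_toUnit_muSection h _)

/-- The unit axiom: evaluation of the coaction at `T = 1` is the identity. -/
lemma Torsor.sum_eq_of_actApp_eq {U : X.Opens} {x : Γ(T.total, T.proj ⁻¹ᵁ U)}
    {y : ℕ → Γ(T.total, T.proj ⁻¹ᵁ U)}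
    (hx : T.actApp U x =
      ∑ i ∈ Finset.range m, muProdCoord s m T.proj U ^ i * muSndApp s m T.proj U (y i)) :
    ∑ i ∈ Finset.range m, y i = x := by
  have h1 := overApp_lift_comp (toUnit _ ≫ MonObj.one) (𝟙 T.over) T.act_proj hx
    (Category.id_comp T.proj) (T.lift_one_act _) (Category.id_comp T.proj)
  refine Eq.trans (Finset.sum_congr rfl fun i _ ↦ ?_) (h1.symm.trans congr($(overApp_id U) x))
  refine ((congrArg₂ (fun a b : Γ(T.total, T.proj ⁻¹ᵁ U) ↦ a * b)
    ((congrArg (fun a : Γ(T.total, T.proj ⁻¹ᵁ U) ↦ a ^ i) (coord_one _ _)).trans (one_pow i))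
    congr($(overApp_id U) (y i))).trans (one_mul _)).symm

end Torsor

variable {R : Type u} [CommRing R]
  {K : Type u} [Field K] [Algebra R K] [IsFractionRing R K]
  [CharZero K] {X : Scheme.{u}} {s : X ⟶ Spec (.of R)} {m : ℕ} [NeZero m] {ζ : R}
  (hζ : IsPrimitiveRoot ζ m)
  {Y : ConstTorsor (Multiplicative (ZMod m)) (baseChange s K)}

/-- An `X`-scheme `Z` with a morphism `Y ⟶ Z` is an integral model of the torsor `Y` if functions
on `Z` are the functions on `Y` with integral homogeneous components. -/
structure IsIntegralModel {Z : Scheme.{u}} {p : Z ⟶ X} {q : Y.total ⟶ Z}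
    (e : q ≫ p = totalHom Y) : Prop where
  injective {U : X.Opens} (hU : IsAffineOpen U) : Function.Injective (overApp e U)
  exists_iff {U : X.Opens} (hU : IsAffineOpen U) (b : Γ(Y.total, totalHom Y ⁻¹ᵁ U)) :
    (∃ x, overApp e U x = b) ↔ b ∈ integralSections hζ Y U

include hζ in
lemma eq_zero_of_card_mul_of_injective {Z : Scheme.{u}} {p : Z ⟶ X} {q : Y.total ⟶ Z}
    (e : q ≫ p = totalHom Y) {U : X.Opens} (h : Function.Injective (overApp e U))
    (x : Γ(Z, p ⁻¹ᵁ U)) (hx : (m : Γ(Z, p ⁻¹ᵁ U)) * x = 0) : x = 0 := by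
  refine h ?_
  rw [map_zero]
  refine (totalAction hζ Y U).eq_zero_of_card_mul ?_
  rw [← map_natCast (overApp e U).hom m]
  refine (map_mul (overApp e U).hom _ _).symm.trans ?_
  rw [hx, map_zero]

namespace IsIntegralModel

variable {hζ} {Z Z' : Scheme.{u}} {p : Z ⟶ X} {q : Y.total ⟶ Z} {e : q ≫ p = totalHom Y}
  {p' : Z' ⟶ X} {q' : Y.total ⟶ Z'} {e' : q' ≫ p' = totalHom Y}

/-- There is a morphism between any two integral models. -/
lemma exists_hom [IsAffineHom p'] (h : IsIntegralModel hζ e) (h' : IsIntegralModel hζ e') :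
    ∃ g : Z ⟶ Z', g ≫ p' = p ∧ q ≫ g = q' := by
  have H (U : X.Opens) (hU : IsAffineOpen U) (x : Γ(Z', p' ⁻¹ᵁ U)) :
      ∃ y, overApp e U y = overApp e' U x :=
    (h.exists_iff hU _).mpr ((h'.exists_iff hU _).mp ⟨x, rfl⟩)
  choose φ hφ using H
  let φ' (U : X.Opens) (hU : IsAffineOpen U) : Γ(Z', p' ⁻¹ᵁ U) ⟶ Γ(Z, p ⁻¹ᵁ U) :=
    CommRingCat.ofHom
    { toFun := φ U hU
      map_zero' := h.injective hU (by rw [hφ, map_zero, map_zero])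
      map_one' := h.injective hU (by rw [hφ, map_one, map_one])
      map_add' a b := h.injective hU (by rw [hφ, map_add, map_add, hφ, hφ])
      map_mul' a b := h.injective hU (by rw [hφ, map_mul, map_mul, hφ, hφ]) }
  have hφ' (U : X.Opens) (hU : IsAffineOpen U) : φ' U hU ≫ overApp e U = overApp e' U :=
    CommRingCat.hom_ext (RingHom.ext fun x ↦ hφ U hU x)
  have hcancel {U : X.Opens} (hU : IsAffineOpen U) {A : CommRingCat.{u}} {a b : A ⟶ Γ(Z, p ⁻¹ᵁ U)}
      (hab : a ≫ overApp e U = b ≫ overApp e U) : a = b :=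
    CommRingCat.hom_ext (RingHom.ext fun x ↦ h.injective hU congr($hab x))
  obtain ⟨g, hg, hgφ⟩ := exists_hom_of_overApp (p := p') (g := p) φ'
    (fun U hU ↦ hcancel hU (by rw [Category.assoc, hφ', overApp_app, overApp_app]))
    (fun U hU V hV hVU ↦ hcancel hV (by
      rw [Category.assoc, hφ', Category.assoc, overApp_map e hVU, overApp_map e' hVU, ← hφ' U hU,
        Category.assoc]))
  refine ⟨g, hg, hom_ext_of_overApp (by rw [Category.assoc, hg, e]) e' fun U hU ↦ ?_⟩
  rw [← hφ' U hU, ← hgφ U hU]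
  exact overApp_comp hg e U

lemma hom_ext [IsAffineHom p'] (h : IsIntegralModel hζ e) {g g' : Z ⟶ Z'} (hg : g ≫ p' = p)
    (hg' : g' ≫ p' = p) (hq : q ≫ g = q ≫ g') : g = g' := by
  refine hom_ext_of_overApp hg hg' fun U hU ↦ CommRingCat.hom_ext (RingHom.ext fun x ↦
    h.injective hU ?_)
  have h1 : overApp hg U ≫ overApp e U = overApp hg' U ≫ overApp e U := by
    rw [← overApp_comp hg e U, ← overApp_comp hg' e U]
    exact appLE_congr_hom hq _ _
  exact congr($h1 x)

/-- Integral models are unique up to isomorphism. -/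
lemma exists_iso [IsAffineHom p] [IsAffineHom p'] (h : IsIntegralModel hζ e)
    (h' : IsIntegralModel hζ e') : ∃ g : Z ≅ Z', g.hom ≫ p' = p ∧ q ≫ g.hom = q' := by
  obtain ⟨g, hg, hgq⟩ := h.exists_hom h'
  obtain ⟨g', hg', hgq'⟩ := h'.exists_hom h
  refine ⟨⟨g, g', h.hom_ext (p' := p) (by rw [Category.assoc, hg', hg]) (Category.id_comp p) ?_,
    h'.hom_ext (p' := p') (by rw [Category.assoc, hg, hg']) (Category.id_comp p') ?_⟩, hg, hgq⟩
  · rw [← Category.assoc, hgq, hgq', Category.comp_id]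
  · rw [← Category.assoc, hgq', hgq, Category.comp_id]

end IsIntegralModel

end

/-! ### Every extension is an integral model. -/

section

open MonoidalCategory CartesianMonoidalCategory

namespace Torsor

variable {R : Type u} [CommRing R] {X : Scheme.{u}} {s : X ⟶ Spec (.of R)} {m : ℕ}
  (T : Torsor (muGrp m R) s) {U : X.Opens}

/-- The map `G × T ⟶ T ×_X T` of a torsor. -/
abbrev shear : (muProd s m T.proj).left ⟶ pullback T.proj T.proj :=
  pullback.lift (f := T.proj) (g := T.proj) T.act.left (muProdSnd s m T.proj) T.act_proj

lemma shear_comp : T.shear ≫ pullback.fst T.proj T.proj ≫ T.proj = muProdHom s m T.proj :=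
  lift_comp_fst_comp T.act_proj rfl

lemma shear_fst (x : Γ(T.total, T.proj ⁻¹ᵁ U)) :
    overApp T.shear_comp U (overApp (h := pullback.fst T.proj T.proj) rfl U x) = T.actApp U x :=
  overApp_lift_fst T.act_proj rfl U x

lemma shear_snd (x : Γ(T.total, T.proj ⁻¹ᵁ U)) :
    overApp T.shear_comp U (overApp (h := pullback.snd T.proj T.proj) pullback.condition.symm U x) =
      muSndApp s m T.proj U x :=
  overApp_lift_snd T.act_proj rfl U x

lemma bijective_shear : Function.Bijective (overApp T.shear_comp U) := by
  have : IsIso T.shear := T.isIso_shear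
  have h1 : muProdHom s m T.proj ⁻¹ᵁ U =
      T.shear ⁻¹ᵁ (pullback.fst T.proj T.proj ≫ T.proj) ⁻¹ᵁ U := by
    rw [← Scheme.Hom.comp_preimage, T.shear_comp]
  refine (ConcreteCategory.isIso_iff_bijective _).mp ?_
  refine (T.shear.appLE_congr _ rfl h1 (fun φ ↦ IsIso φ)).mpr ?_
  rw [← Scheme.Hom.app_eq_appLE]
  infer_instance

/-- Functions invariant under the coaction come from the base. -/
lemma exists_app_eq (hU : IsAffineOpen U) {x : Γ(T.total, T.proj ⁻¹ᵁ U)}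
    (hx : T.actApp U x = muSndApp s m T.proj U x) : ∃ a, T.proj.app U a = x := by
  have := T.flat
  have := T.surjective
  refine CommRingCat.exists_of_isPushout_of_faithfullyFlat (isPushout_overApp T.proj T.proj hU)
    (faithfullyFlat_app T.proj hU) x (T.bijective_shear.1 ?_)
  rw [shear_fst, shear_snd, hx]

/-- By the shear isomorphism, functions on `μ_m × T` are functions on `T ×_X T`, that is, sums of
products of functions on the two factors. Applied to powers of `T`, this replaces the Galois
condition of constant torsors. -/
lemma exists_sum_actApp (hU : IsAffineOpen U)
    (x : Γ((muProd s m T.proj).left, muProdHom s m T.proj ⁻¹ᵁ U)) :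
    ∃ (n : ℕ) (b c : Fin n → Γ(T.total, T.proj ⁻¹ᵁ U)),
      x = ∑ j, T.actApp U (b j) * muSndApp s m T.proj U (c j) := by
  obtain ⟨x, rfl⟩ := T.bijective_shear.2 x
  obtain ⟨n, b, c, rfl⟩ := CommRingCat.exists_sum_of_isPushout (isPushout_overApp T.proj T.proj hU) x
  refine ⟨n, b, c, ?_⟩
  rw [map_sum]
  refine Finset.sum_congr rfl fun j _ ↦ ?_
  rw [map_mul, shear_fst, shear_snd]

end Torsor

section Extension

variable {R : Type u} [CommRing R]
  {K : Type u} [Field K] [Algebra R K] [IsFractionRing R K]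
  [CharZero K] {X : Scheme.{u}} {s : X ⟶ Spec (.of R)} {m : ℕ} [NeZero m] {ζ : R}
  {hζ : IsPrimitiveRoot ζ m}
  {Y : ConstTorsor (Multiplicative (ZMod m)) (baseChange s K)}
  {T : Torsor (muGrp m R) s} {q : Y.total ⟶ T.total}

namespace IsExtension

omit [IsFractionRing R K] [CharZero K] in
lemma comp_proj {g : rootsOfUnity m R} (H : IsExtension g Y T q) :
    q ≫ T.proj = totalHom Y := H.isPullback.w

omit [CharZero K] in
-- The generic fibre of `T` is the base change, along the flat torsor, of the inclusion of functions
-- on `U` into functions on `U_K`.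
lemma injective [Flat s] {g : rootsOfUnity m R} (H : IsExtension g Y T q) {U : X.Opens}
    (hU : IsAffineOpen U) : Function.Injective (overApp H.comp_proj U) := by
  have := T.flat
  refine CommRingCat.inl_injective_of_isPushout
    (isPushout_preimage H.isPullback.flip hU).flip ?_ (baseChangeFst_app_injective s hU)
  rw [Scheme.Hom.app_eq_appLE]
  exact T.proj.flat_appLE hU (hU.preimage T.proj) _

lemma overApp_translate (H : IsExtension hζ.toRootsOfUnity Y T q) (U : X.Opens)
    (x : Γ(T.total, T.proj ⁻¹ᵁ U)) :
    overApp H.comp_proj U (overApp (T.translate_proj hζ.toRootsOfUnity) U x) =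
      (totalAction hζ Y U).σ (overApp H.comp_proj U x) := by
  have h1 := overApp_comp (T.translate_proj hζ.toRootsOfUnity) H.comp_proj U
  have h2 : (Y.act (Multiplicative.ofAdd 1)).hom.left ≫ totalHom Y = totalHom Y := by
    rw [← Category.assoc, Y.act_comp_proj]
  have h3 := overApp_comp H.comp_proj h2 U
  refine (congr($h1 x)).symm.trans (Eq.trans ?_ congr($h3 x))
  exact congr($(appLE_congr_hom H.equivariant.symm _ _) x)

variable [IsDomain R]

/-- Evaluating the coaction at `ζ^k` gives the `k`-fold iterate of `σ` on the generic torsor, and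
these values determine both families of components. -/
lemma proj_eq (H : IsExtension hζ.toRootsOfUnity Y T q) {U : X.Opens}
    {x : Γ(T.total, T.proj ⁻¹ᵁ U)} {y : ℕ → Γ(T.total, T.proj ⁻¹ᵁ U)}
    (hx : T.actApp U x =
      ∑ i ∈ Finset.range m, muProdCoord s m T.proj U ^ i * muSndApp s m T.proj U (y i))
    {i : ℕ} (hi : i < m) :
    (totalAction hζ Y U).proj i (overApp H.comp_proj U x) = overApp H.comp_proj U (y i) := by
  have hsec (r : R) : overApp H.comp_proj U (secOf (T.proj ≫ s) (T.proj ⁻¹ᵁ U) r) =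
      (totalHom Y).app U (secOf s U r) := by
    rw [app_secOf, appLE_secOf, ← Category.assoc, H.comp_proj]
  refine CyclicAction.proj_eq_of_iterate (S := totalAction hζ Y U) hζ
    (((totalHom Y).app U).hom.comp (secOf s U)) (totalAction_z hζ Y U).symm
    (y := fun i ↦ overApp H.comp_proj U (y i)) (fun k ↦ ?_) hi
  have h1 : (totalAction hζ Y U).σ^[k] (overApp H.comp_proj U x) = overApp H.comp_proj U
      (∑ i ∈ Finset.range m, secOf (T.proj ≫ s) (T.proj ⁻¹ᵁ U) (ζ ^ k) ^ i * y i) := by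
    induction k with
    | zero => simp [T.sum_eq_of_actApp_eq hx]
    | succ k ih =>
      rw [Function.iterate_succ_apply', ih, ← H.overApp_translate]
      congr 1
      have h2 := T.overApp_translate hx (hζ.toRootsOfUnity ^ k) hζ.toRootsOfUnity
      simpa [pow_succ] using h2
  rw [h1, map_sum]
  refine Finset.sum_congr rfl fun j _ ↦ ?_
  rw [map_mul, map_pow, hsec]
  rfl

/-- Homogeneous components of functions on an extension. -/
lemma exists_overApp_eq_proj (H : IsExtension hζ.toRootsOfUnity Y T q) {U : X.Opens}
    (hU : IsAffineOpen U) (x : Γ(T.total, T.proj ⁻¹ᵁ U)) (i : ℕ) :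
    ∃ y, overApp H.comp_proj U y = (totalAction hζ Y U).proj i (overApp H.comp_proj U x) := by
  obtain ⟨y, hy⟩ := exists_sum_muProdCoord hU (T.actApp U x)
  refine ⟨y (i % m), ?_⟩
  rw [← H.proj_eq hy (Nat.mod_lt _ (NeZero.pos m))]
  exact CyclicAction.proj_congr (Nat.mod_modEq i m) _

/-- The coaction components are determined on the generic fibre, so those of nonzero degree vanish;
`x` is coinvariant and descends. -/
lemma exists_app_eq_of_homog [Flat s] (H : IsExtension hζ.toRootsOfUnity Y T q) {U : X.Opens}
    (hU : IsAffineOpen U) {x : Γ(T.total, T.proj ⁻¹ᵁ U)}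
    (hx : (totalAction hζ Y U).Homog 0 (overApp H.comp_proj U x)) :
    ∃ a, T.proj.app U a = x := by
  obtain ⟨y, hy⟩ := exists_sum_muProdCoord hU (T.actApp U x)
  have h1 (i : ℕ) (hi : i < m) : y i = if i = 0 then x else 0 := by
    refine H.injective hU ?_
    rw [← H.proj_eq hy hi, CyclicAction.proj_of_homog hx i]
    rcases Nat.eq_zero_or_pos i with rfl | hi'
    · rw [if_pos (Nat.ModEq.refl 0), if_pos rfl]
    · rw [if_neg hi'.ne', if_neg, map_zero]
      exact fun h ↦ hi'.ne' (Nat.ModEq.eq_of_lt_of_lt h (NeZero.pos m) hi).symm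
  refine T.exists_app_eq hU ?_
  rw [hy, Finset.sum_eq_single_of_mem 0 (Finset.mem_range.mpr (NeZero.pos m)), h1 0 (NeZero.pos m),
    if_pos rfl, pow_zero, one_mul]
  intro i hi hi0
  rw [h1 i (Finset.mem_range.mp hi), if_neg hi0, map_zero, mul_zero]

lemma isIntegralElem_of_homog [Flat s] (H : IsExtension hζ.toRootsOfUnity Y T q) {U : X.Opens}
    (hU : IsAffineOpen U) {x : Γ(T.total, T.proj ⁻¹ᵁ U)} {i : ℕ}
    (hx : (totalAction hζ Y U).Homog i (overApp H.comp_proj U x)) :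
    ((totalHom Y).app U).hom.IsIntegralElem (overApp H.comp_proj U x) := by
  have h1 := hx.pow_card
  rw [← map_pow] at h1
  obtain ⟨a, ha⟩ := H.exists_app_eq_of_homog hU h1
  refine isIntegralElem_of_pow _ (NeZero.ne m) ?_
  rw [← map_pow, ← ha]
  have h2 := congr($(overApp_app H.comp_proj U) a)
  exact (show overApp H.comp_proj U (T.proj.app U a) = (totalHom Y).app U a from h2) ▸
    RingHom.isIntegralElem_map _

/-- An extension has enough functions in each degree. -/
lemma exists_sum_proj [Flat s] (H : IsExtension hζ.toRootsOfUnity Y T q) {U : X.Opens}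
    (hU : IsAffineOpen U) {i : ℕ} (hi : i < m) :
    ∃ (n : ℕ) (b c : Fin n → Γ(T.total, T.proj ⁻¹ᵁ U)),
      (∀ j, (totalAction hζ Y U).Homog i (overApp H.comp_proj U (b j))) ∧
      (∀ j, (totalAction hζ Y U).Homog (m - i) (overApp H.comp_proj U (c j))) ∧
      ∑ j, b j * c j = 1 := by
  obtain ⟨n, b, c, h⟩ := T.exists_sum_actApp hU (muProdCoord s m T.proj U ^ i)
  choose y hy using fun j ↦ exists_sum_muProdCoord hU (T.actApp U (b j))
  choose c' hc' using fun j ↦ H.exists_overApp_eq_proj hU (c j) (m - i)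
  -- Compares the coefficients of `T^i` in the expansion of `T^i` as a sum of `act^* b_j` times
  -- `c_j`.
  have h1 : ∑ j, y j i * c j = 1 := by
    refine (eq_of_sum_muProdCoord_eq (s := s) hζ
      (eq_zero_of_card_mul_of_injective hζ H.comp_proj (H.injective hU))
      (y := fun i ↦ ∑ j, y j i * c j) (z := fun l ↦ if l = i then 1 else 0) ?_ hi).trans (if_pos rfl)
    refine Eq.trans ?_ (Finset.sum_eq_single_of_mem i (Finset.mem_range.mpr hi)
      (fun l _ hl ↦ by rw [if_neg hl, map_zero, mul_zero])).symm
    rw [if_pos rfl, map_one, mul_one, h]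
    simp only [map_sum, Finset.mul_sum]
    rw [Finset.sum_comm]
    refine Finset.sum_congr rfl fun j _ ↦ ?_
    rw [hy j, Finset.sum_mul]
    refine Finset.sum_congr rfl fun l _ ↦ ?_
    rw [map_mul, mul_assoc]
  have h2 (j) : (totalAction hζ Y U).Homog i (overApp H.comp_proj U (y j i)) := by
    rw [← H.proj_eq (hy j) hi]
    exact CyclicAction.homog_proj _ _
  refine ⟨n, fun j ↦ y j i, c', h2, fun j ↦ ?_, H.injective hU ?_⟩
  · rw [hc']
    exact CyclicAction.homog_proj _ _
  · have h3 := congr((totalAction hζ Y U).proj (i + (m - i)) (overApp H.comp_proj U $h1))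
    rw [map_one, CyclicAction.proj_of_homog CyclicAction.homog_one, if_pos, map_sum,
      CyclicAction.proj_sum] at h3
    · rw [map_one, ← h3, map_sum]
      refine Finset.sum_congr rfl fun j _ ↦ ?_
      rw [map_mul, map_mul, hc', CyclicAction.proj_mul_of_homog (h2 j)]
    · rw [Nat.add_sub_cancel' hi.le]
      simp [Nat.ModEq]

variable [IsDiscreteValuationRing R]

/-- Every extension is an integral model. -/
theorem isIntegralModel [Flat s] (hX : IsNormalScheme X) [IsIntegral (baseChange s K)]
    (H : IsExtension hζ.toRootsOfUnity Y T q) : IsIntegralModel hζ H.comp_proj where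
  injective := H.injective
  exists_iff {U} hU b := by
    refine ⟨fun ⟨x, hx⟩ i ↦ ?_, fun hb ↦ ?_⟩
    · obtain ⟨y, hy⟩ := H.exists_overApp_eq_proj hU x i
      rw [← hx, ← hy]
      refine H.isIntegralElem_of_homog hU (i := i) ?_
      rw [hy]
      exact CyclicAction.homog_proj _ _
    · suffices h : ∀ i : ℕ, i < m → ∃ x, overApp H.comp_proj U x = (totalAction hζ Y U).proj i b by
        choose! x hx using h
        refine ⟨∑ i ∈ Finset.range m, x i, ?_⟩
        rw [map_sum, ← CyclicAction.sum_proj (S := totalAction hζ Y U) b]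
        exact Finset.sum_congr rfl fun i hi ↦ hx i (Finset.mem_range.mp hi)
      intro i hi
      obtain ⟨n, x, c, hxh, hch, h⟩ := H.exists_sum_proj hU hi
      -- The product of the degree-`i` component of `b` with `c_j` is integral of degree zero, so
      -- normality makes it a function on `U`; then the component is `∑ (bᵢ c_j) x_j`.
      have h1 (j) : ∃ a, (totalHom Y).app U a =
          (totalAction hζ Y U).proj i b * overApp H.comp_proj U (c j) := by
        refine exists_totalHom_app_eq hζ Y hX hU ?_ ((hb i).mul _ (H.isIntegralElem_of_homog hU (hch j)))
        refine ((CyclicAction.homog_proj i b).mul (hch j)).congr ?_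
        rw [Nat.add_sub_cancel' hi.le]
        simp [Nat.ModEq]
      choose a ha using h1
      refine ⟨∑ j, T.proj.app U (a j) * x j, ?_⟩
      have h2 (j) : overApp H.comp_proj U (T.proj.app U (a j)) = (totalHom Y).app U (a j) :=
        congr($(overApp_app H.comp_proj U) (a j))
      rw [map_sum]
      simp only [map_mul, h2, ha]
      have h3 := congr((totalAction hζ Y U).proj i b * overApp H.comp_proj U $h)
      rw [map_one, mul_one, map_sum, Finset.mul_sum] at h3
      refine Eq.trans (Finset.sum_congr rfl fun j _ ↦ ?_) h3
      rw [map_mul]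
      ring

omit [IsDiscreteValuationRing R] in
/-- A morphism between extensions compatible with the identification of the generic fibres is a
morphism of torsors. -/
lemma isTorsorHom [Flat s] {T' : Torsor (muGrp m R) s} {q' : Y.total ⟶ T'.total}
    (H : IsExtension hζ.toRootsOfUnity Y T q) (H' : IsExtension hζ.toRootsOfUnity Y T' q')
    {e : T.total ⟶ T'.total} (he : e ≫ T'.proj = T.proj) (hq : q ≫ e = q') :
    IsTorsorHom T T' e := by
  refine ⟨he, ?_⟩
  let ε : T.over ⟶ T'.over := Over.homMk (U := T.over) (V := T'.over) e (by simp [← he])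
  change T.act ≫ ε = ((muGrp m R).X ◁ ε) ≫ T'.act
  have hε : ((muGrp m R).X ◁ ε) = lift (fst _ _) (snd _ _ ≫ ε) := by
    ext1 <;> simp
  have hw : (snd (muGrp m R).X T.over ≫ ε).left ≫ T'.proj = muProdHom s m T.proj :=
    (Category.assoc _ _ _).trans (congrArg (_ ≫ ·) he)
  have hl : (T.act ≫ ε).left ≫ T'.proj = muProdHom s m T.proj :=
    ((Category.assoc _ _ _).trans (congrArg (_ ≫ ·) he)).trans T.act_proj
  have hr : (((muGrp m R).X ◁ ε) ≫ T'.act).left ≫ T'.proj = muProdHom s m T.proj := by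
    rw [hε]
    exact ((Category.assoc _ _ _).trans (congrArg (_ ≫ ·) T'.act_proj)).trans
      (lift_comp_muProdHom _ _ hw)
  have hqe (U : X.Opens) (x) : overApp H.comp_proj U (overApp he U x) = overApp H'.comp_proj U x := by
    refine (congr($(overApp_comp he H.comp_proj U) x)).symm.trans ?_
    exact congr($(appLE_congr_hom hq _ _) x)
  refine Over.OverMorphism.ext (hom_ext_of_overApp hl hr fun U hU ↦ CommRingCat.hom_ext
    (RingHom.ext fun x ↦ ?_))
  obtain ⟨y, hy⟩ := exists_sum_muProdCoord hU (T.actApp U (overApp he U x))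
  obtain ⟨y', hy'⟩ := exists_sum_muProdCoord hU (T'.actApp U x)
  -- Both sides restrict to the degree-`i` component of the same function on the generic torsor.
  have h1 (i : ℕ) (hi : i < m) : y i = overApp he U (y' i) := by
    refine H.injective hU ?_
    rw [← H.proj_eq hy hi, hqe, hqe, ← H'.proj_eq hy' hi]
  refine (congr($(overApp_comp he T.act_proj U) x)).trans ?_
  refine Eq.trans ?_ (overApp_lift_comp _ _ T'.act_proj hy' hw (by rw [hε]) hr).symm
  refine hy.trans (Finset.sum_congr rfl fun i hi ↦ ?_)
  rw [h1 i (Finset.mem_range.mp hi)]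
  refine congrArg (muProdCoord s m T.proj U ^ i * ·) ?_
  exact (congr($(overApp_comp he (h' := muProdSnd s m T.proj) rfl U) (y' i))).symm

end IsExtension

end Extension

end

/-! ### The action of `μ_m` on an integral model. -/

section

open MonoidalCategory CartesianMonoidalCategory

variable {R : Type u} [CommRing R]
  {K : Type u} [Field K] [Algebra R K] [IsFractionRing R K]
  [CharZero K] {X : Scheme.{u}} {s : X ⟶ Spec (.of R)} {m : ℕ} [NeZero m] {ζ : R}
  {hζ : IsPrimitiveRoot ζ m}
  {Y : ConstTorsor (Multiplicative (ZMod m)) (baseChange s K)}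

variable (hζ) in
lemma map_totalAction_σ_iterate {U V : X.Opens} (h : V ≤ U) (k : ℕ)
    (b : Γ(Y.total, totalHom Y ⁻¹ᵁ U)) :
    Y.total.presheaf.map (homOfLE ((totalHom Y).preimage_mono h)).op
      ((totalAction hζ Y U).σ^[k] b) = (totalAction hζ Y V).σ^[k]
        (Y.total.presheaf.map (homOfLE ((totalHom Y).preimage_mono h)).op b) := by
  induction k with
  | zero => rfl
  | succ k ih =>
    rw [Function.iterate_succ_apply', Function.iterate_succ_apply', ← ih]
    exact (endPull_map Y.proj (Y.act_comp_proj _) ((baseChangeFst s K).preimage_mono h) _).symm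

namespace IsIntegralModel

variable {Z : Scheme.{u}} {p : Z ⟶ X} {q : Y.total ⟶ Z} {e : q ≫ p = totalHom Y}
  (h : IsIntegralModel hζ e)

include h in
lemma exists_component {U : X.Opens} (hU : IsAffineOpen U) (i : ℕ) (x : Γ(Z, p ⁻¹ᵁ U)) :
    ∃ y, overApp e U y = (totalAction hζ Y U).proj i (overApp e U x) :=
  (h.exists_iff hU _).mpr (CyclicAction.proj_mem_integralSubring _ _
    ((h.exists_iff hU _).mp ⟨x, rfl⟩) i)

/-- The homogeneous components of functions on an integral model. -/
def component {U : X.Opens} (hU : IsAffineOpen U) (i : ℕ) (x : Γ(Z, p ⁻¹ᵁ U)) : Γ(Z, p ⁻¹ᵁ U) :=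
  (h.exists_component hU i x).choose

lemma overApp_component {U : X.Opens} (hU : IsAffineOpen U) (i : ℕ) (x : Γ(Z, p ⁻¹ᵁ U)) :
    overApp e U (h.component hU i x) = (totalAction hζ Y U).proj i (overApp e U x) :=
  (h.exists_component hU i x).choose_spec

lemma component_of_homog {U : X.Opens} (hU : IsAffineOpen U) {i : ℕ} {x : Γ(Z, p ⁻¹ᵁ U)}
    (hx : (totalAction hζ Y U).Homog i (overApp e U x)) (hi : i < m) {k : ℕ} (hk : k < m) :
    h.component hU k x = if k = i then x else 0 := by
  refine h.injective hU ?_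
  rw [overApp_component, CyclicAction.proj_of_homog hx, apply_ite (overApp e U), map_zero]
  congr 1
  exact propext ⟨fun hik ↦ (Nat.ModEq.eq_of_lt_of_lt hik hi hk).symm, fun hik ↦ hik ▸ rfl⟩

lemma homog_component {U : X.Opens} (hU : IsAffineOpen U) (i : ℕ) (x : Γ(Z, p ⁻¹ᵁ U)) :
    (totalAction hζ Y U).Homog i (overApp e U (h.component hU i x)) := by
  rw [overApp_component]
  exact CyclicAction.homog_proj _ _

lemma sum_component {U : X.Opens} (hU : IsAffineOpen U) (x : Γ(Z, p ⁻¹ᵁ U)) :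
    ∑ i ∈ Finset.range m, h.component hU i x = x := by
  refine h.injective hU ?_
  rw [map_sum]
  simp only [overApp_component]
  exact CyclicAction.sum_proj _

/-- The coaction of `μ_m` on functions on an integral model. -/
def coaction {U : X.Opens} (hU : IsAffineOpen U) (x : Γ(Z, p ⁻¹ᵁ U)) :
    Γ((muProd s m p).left, muProdHom s m p ⁻¹ᵁ U) :=
  ∑ i ∈ Finset.range m, muProdCoord s m p U ^ i * muSndApp s m p U (h.component hU i x)

/-- The value of a function on `μ_m × Z` at a power of the primitive root, as a function on the
generic torsor. -/
abbrev evalTotal (hζ : IsPrimitiveRoot ζ m) (e : q ≫ p = totalHom Y) (k : ℕ) (U : X.Opens) :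
    Γ((muProd s m p).left, muProdHom s m p ⁻¹ᵁ U) ⟶ Γ(Y.total, totalHom Y ⁻¹ᵁ U) :=
  overApp (muEval_comp (s := s) (hζ.toRootsOfUnity ^ k)) U ≫ overApp e U

/-- At `T = ζ^k` the coaction becomes `∑ ζ^(ki) xᵢ = σ^k x`. -/
lemma evalTotal_coaction {U : X.Opens} (hU : IsAffineOpen U) (k : ℕ) (x : Γ(Z, p ⁻¹ᵁ U)) :
    evalTotal hζ e k U (h.coaction hU x) = (totalAction hζ Y U).σ^[k] (overApp e U x) := by
  have hsec (r : R) : overApp e U (secOf (p ≫ s) (p ⁻¹ᵁ U) r) =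
      (totalHom Y).app U (secOf s U r) := by
    rw [app_secOf, appLE_secOf, ← Category.assoc, e]
  rw [coaction, map_sum]
  conv_rhs => rw [← CyclicAction.sum_proj (S := totalAction hζ Y U) (overApp e U x),
    ← RingHom.coe_pow, map_sum]
  refine Finset.sum_congr rfl fun i _ ↦ ?_
  rw [RingHom.coe_pow, (CyclicAction.homog_proj i _).iterate, map_mul, map_pow]
  have h1 : evalTotal hζ e k U (muProdCoord s m p U) = (totalAction hζ Y U).z ^ k := by
    refine (congrArg (overApp e U) (muEval_muProdCoord _ U)).trans ?_
    rw [hsec, totalAction_z, ← map_pow, ← map_pow]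
    rfl
  have h2 : evalTotal hζ e k U (muSndApp s m p U (h.component hU i x)) =
      (totalAction hζ Y U).proj i (overApp e U x) :=
    (congrArg (overApp e U) (muEval_muSndApp _ U _)).trans (h.overApp_component hU i x)
  rw [h1, h2, ← pow_mul, mul_comm k]

variable [IsDomain R] [IsAffineHom p]

include h in
-- Reduces identities on `μ_m × Z` to the generic torsor, where the coaction is an iterate of the
-- ring homomorphism `σ`; additivity, multiplicativity and compatibility with restriction follow at
-- once.
lemma eq_of_evalTotal {U : X.Opens} (hU : IsAffineOpen U)
    {a b : Γ((muProd s m p).left, muProdHom s m p ⁻¹ᵁ U)}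
    (hab : ∀ k, evalTotal hζ e k U a = evalTotal hζ e k U b) : a = b := by
  refine sub_eq_zero.mp (eq_zero_of_muEval (s := s) hζ hU
    (eq_zero_of_card_mul_of_injective hζ e (h.injective hU)) fun k ↦ h.injective hU ?_)
  rw [map_zero]
  refine (map_sub (evalTotal hζ e k U).hom a b).trans (sub_eq_zero.mpr (hab k))

lemma evalTotal_map {U V : X.Opens} (hVU : V ≤ U) (k : ℕ)
    (a : Γ((muProd s m p).left, muProdHom s m p ⁻¹ᵁ U)) :
    evalTotal hζ e k V ((muProd s m p).left.presheaf.map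
      (homOfLE ((muProdHom s m p).preimage_mono hVU)).op a) =
    Y.total.presheaf.map (homOfLE ((totalHom Y).preimage_mono hVU)).op (evalTotal hζ e k U a) := by
  have h1 := overApp_map (muEval_comp (s := s) (p := p) (hζ.toRootsOfUnity ^ k)) hVU
  refine (congrArg (overApp e V) congr($h1 a)).trans ?_
  exact congr($(overApp_map e hVU) (overApp (muEval_comp (s := s) (hζ.toRootsOfUnity ^ k)) U a))

lemma coaction_app {U : X.Opens} (hU : IsAffineOpen U) (a : Γ(X, U)) :
    h.coaction hU (p.app U a) = (muProdHom s m p).app U a := by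
  refine h.eq_of_evalTotal hU fun k ↦ ?_
  have h1 : overApp e U (p.app U a) = (totalHom Y).app U a := congr($(overApp_app e U) a)
  have h2 : overApp (muEval_comp (s := s) (hζ.toRootsOfUnity ^ k)) U ((muProdHom s m p).app U a) =
      p.app U a := by
    have h3 := overApp_app (muEval_comp (s := s) (p := p) (hζ.toRootsOfUnity ^ k)) U
    exact congr($h3 a)
  refine (h.evalTotal_coaction hU k _).trans ((congrArg ((totalAction hζ Y U).σ^[k]) h1).trans ?_)
  refine (CyclicAction.iterate_of_fixed (totalAction_σ_app hζ Y U a) k).trans ?_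
  exact h1.symm.trans (congrArg (overApp e U) h2).symm

lemma coaction_map {U V : X.Opens} (hU : IsAffineOpen U) (hV : IsAffineOpen V) (hVU : V ≤ U)
    (x : Γ(Z, p ⁻¹ᵁ U)) :
    h.coaction hV (Z.presheaf.map (homOfLE (p.preimage_mono hVU)).op x) =
      (muProd s m p).left.presheaf.map (homOfLE ((muProdHom s m p).preimage_mono hVU)).op
        (h.coaction hU x) := by
  refine h.eq_of_evalTotal hV fun k ↦ ?_
  rw [evalTotal_map hVU, h.evalTotal_coaction hU, h.evalTotal_coaction hV,
    map_totalAction_σ_iterate hζ hVU]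
  exact congrArg _ congr($(overApp_map e hVU) x)

/-- The coaction of `μ_m` as a ring homomorphism. -/
def coactionHom {U : X.Opens} (hU : IsAffineOpen U) :
    Γ(Z, p ⁻¹ᵁ U) →+* Γ((muProd s m p).left, muProdHom s m p ⁻¹ᵁ U) where
  toFun := h.coaction hU
  map_zero' := h.eq_of_evalTotal hU fun k ↦ by
    rw [evalTotal_coaction, map_zero, map_zero, iterate_map_zero]
  map_one' := h.eq_of_evalTotal hU fun k ↦ by
    rw [evalTotal_coaction, map_one, map_one, iterate_map_one]
  map_add' a b := h.eq_of_evalTotal hU fun k ↦ by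
    rw [evalTotal_coaction, map_add, map_add, evalTotal_coaction, evalTotal_coaction,
      iterate_map_add]
  map_mul' a b := h.eq_of_evalTotal hU fun k ↦ by
    rw [evalTotal_coaction, map_mul, map_mul, evalTotal_coaction, evalTotal_coaction,
      iterate_map_mul]

include h in
lemma exists_action : ∃ (a : (muProd s m p).left ⟶ Z) (ha : a ≫ p = muProdHom s m p),
    ∀ U hU x, overApp ha U x = h.coaction (U := U) hU x := by
  obtain ⟨a, ha, haφ⟩ := exists_hom_of_overApp (p := p) (g := muProdHom s m p)
    (fun U hU ↦ CommRingCat.ofHom (h.coactionHom hU))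
    (fun U hU ↦ CommRingCat.hom_ext (RingHom.ext (h.coaction_app hU)))
    (fun U hU V hV hVU ↦ CommRingCat.hom_ext (RingHom.ext (h.coaction_map hU hV hVU)))
  exact ⟨a, ha, fun U hU x ↦ congr($(haφ U hU) x)⟩

/-- The action of `μ_m` on an integral model. -/
def action : (muProd s m p).left ⟶ Z := h.exists_action.choose

lemma action_comp : h.action ≫ p = muProdHom s m p := h.exists_action.choose_spec.choose

lemma overApp_action {U : X.Opens} (hU : IsAffineOpen U) (x : Γ(Z, p ⁻¹ᵁ U)) :
    overApp h.action_comp U x = h.coaction hU x :=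
  h.exists_action.choose_spec.choose_spec U hU x

/-- The action of `μ_m` on an integral model, as a morphism over `R`. -/
def act : muProd s m p ⟶ Over.mk (p ≫ s) :=
  Over.homMk h.action (by
    have := Over.w (snd (muGrp m R).X (Over.mk (p ≫ s)))
    exact (Category.assoc _ _ _).symm.trans ((congrArg (· ≫ s) h.action_comp).trans
      ((Category.assoc _ _ _).trans this)))

lemma act_left_comp : h.act.left ≫ p = muProdHom s m p := h.action_comp

lemma overApp_lift_act {W : Over (Spec (.of R))} (f : W ⟶ (muGrp m R).X)
    (g : W ⟶ Over.mk (p ≫ s)) {w : W.left ⟶ X} (hw : g.left ≫ p = w)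
    (hgw : (lift f g ≫ h.act).left ≫ p = w) {U : X.Opens} (hU : IsAffineOpen U)
    (x : Γ(Z, p ⁻¹ᵁ U)) :
    overApp hgw U x = ∑ i ∈ Finset.range m,
      coord f (w ⁻¹ᵁ U) ^ i * overApp hw U (h.component hU i x) :=
  overApp_lift_comp f g h.act_left_comp (h.overApp_action hU x) hw rfl hgw

lemma lift_act_comp {W : Over (Spec (.of R))} (f : W ⟶ (muGrp m R).X)
    (g : W ⟶ Over.mk (p ≫ s)) {w : W.left ⟶ X} (hw : g.left ≫ p = w) :
    (lift f g ≫ h.act).left ≫ p = w :=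
  ((Category.assoc _ _ _).trans (congrArg (_ ≫ ·) h.act_left_comp)).trans
    (lift_comp_muProdHom f g hw)

lemma one_act : lift (toUnit (Over.mk (p ≫ s)) ≫ MonObj.one) (𝟙 _) ≫ h.act = 𝟙 _ := by
  refine Over.OverMorphism.ext (hom_ext_of_overApp (h.lift_act_comp _ _ (Category.id_comp p))
    (Category.id_comp p) fun U hU ↦ CommRingCat.hom_ext (RingHom.ext fun x ↦ ?_))
  refine (h.overApp_lift_act _ _ (Category.id_comp p) _ hU x).trans ?_
  refine Eq.trans (Finset.sum_congr rfl fun i _ ↦ ?_)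
    ((h.sum_component hU x).trans congr($(overApp_id U) x).symm)
  exact (congrArg₂ (fun a b : Γ(Z, p ⁻¹ᵁ U) ↦ a * b)
    ((congrArg (fun a : Γ(Z, p ⁻¹ᵁ U) ↦ a ^ i) (coord_one _ _)).trans (one_pow i))
    congr($(overApp_id U) (h.component hU i x))).trans (one_mul _)

/-- A component `xᵢ` is itself homogeneous, so acting by `g` multiplies it by `coord g ^ i`;
associativity is the identity `(fg)^i = f^i g^i`. -/
lemma lift_mul_act {W : Over (Spec (.of R))} (f g : W ⟶ (muGrp m R).X)
    (k : W ⟶ Over.mk (p ≫ s)) :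
    lift (lift f g ≫ MonObj.mul) k ≫ h.act = lift f (lift g k ≫ h.act) ≫ h.act := by
  have hl := h.lift_act_comp (lift f g ≫ MonObj.mul) k rfl
  have hgk := h.lift_act_comp g k rfl
  have hr := h.lift_act_comp f _ hgk
  refine Over.OverMorphism.ext (hom_ext_of_overApp hl hr fun U hU ↦
    CommRingCat.hom_ext (RingHom.ext fun x ↦ ?_))
  refine (h.overApp_lift_act _ k rfl hl hU x).trans ((Finset.sum_congr rfl fun i hi ↦ ?_).trans
    (h.overApp_lift_act f _ hgk hr hU x).symm)
  have h1 : overApp hgk U (h.component hU i x) =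
      coord g ((k.left ≫ p) ⁻¹ᵁ U) ^ i * overApp (h := k.left) rfl U (h.component hU i x) := by
    refine (h.overApp_lift_act g k rfl hgk hU _).trans ?_
    have hi' := Finset.mem_range.mp hi
    refine (Finset.sum_eq_single_of_mem i hi fun j hj hji ↦ ?_).trans ?_
    · rw [h.component_of_homog hU (h.homog_component hU i x) hi' (Finset.mem_range.mp hj),
        if_neg hji, map_zero, mul_zero]
    · rw [h.component_of_homog hU (h.homog_component hU i x) hi' hi', if_pos rfl]
  rw [h1, coord_mul, mul_pow, mul_assoc]

lemma mul_act : (MonObj.mul ▷ Over.mk (p ≫ s)) ≫ h.act =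
    (α_ (muGrp m R).X (muGrp m R).X (Over.mk (p ≫ s))).hom ≫ ((muGrp m R).X ◁ h.act) ≫ h.act := by
  have h1 := h.lift_mul_act (fst _ _ ≫ fst _ _) (fst _ _ ≫ snd _ _)
    (snd ((muGrp m R).X ⊗ (muGrp m R).X) (Over.mk (p ≫ s)))
  have h2 : lift (lift (fst ((muGrp m R).X ⊗ (muGrp m R).X) (Over.mk (p ≫ s)) ≫ fst _ _)
      (fst _ _ ≫ snd _ _) ≫ MonObj.mul) (snd _ _) = MonObj.mul ▷ Over.mk (p ≫ s) := by
    ext1 <;> simp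
  have h3 : lift (fst ((muGrp m R).X ⊗ (muGrp m R).X) (Over.mk (p ≫ s)) ≫ fst _ _)
      (lift (fst _ _ ≫ snd _ _) (snd _ _) ≫ h.act) =
      (α_ (muGrp m R).X (muGrp m R).X (Over.mk (p ≫ s))).hom ≫ ((muGrp m R).X ◁ h.act) := by
    ext1
    · simp
    · simp only [lift_snd, Category.assoc, whiskerLeft_snd]
      rw [← Category.assoc]
      congr 1
      ext1 <;> simp
  rw [h2, h3, Category.assoc] at h1
  exact h1

end IsIntegralModel

end

/-! ### Algebras with a power basis are faithfully flat and finitely presented. -/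

section

open MonoidalCategory CartesianMonoidalCategory

section Free

variable {A C : Type u} [CommRing A] [CommRing C] {φ : A →+* C} {m : ℕ} {τ : C}

/-- A ring generated as a module by the linearly independent powers `1, …, τ^{m-1}`. -/
structure IsPowerBasis (φ : A →+* C) (m : ℕ) (τ : C) : Prop where
  exists_sum (x : C) : ∃ a : ℕ → A, x = ∑ i ∈ Finset.range m, φ (a i) * τ ^ i
  eq_zero (a : ℕ → A) (h : ∑ i ∈ Finset.range m, φ (a i) * τ ^ i = 0) (i : ℕ) (hi : i < m) : a i = 0

lemma IsPowerBasis.exists_basis (h : IsPowerBasis φ m τ) :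
    letI := φ.toAlgebra
    Nonempty (Module.Basis (Fin m) A C) := by
  let _ := φ.toAlgebra
  refine ⟨.mk (v := fun i : Fin m ↦ τ ^ (i : ℕ)) ?_ ?_⟩
  · refine Fintype.linearIndependent_iff.mpr fun g hg i ↦ ?_
    have h1 := h.eq_zero (fun i ↦ if hi : i < m then g ⟨i, hi⟩ else 0) (by
      rw [Finset.sum_range, ← hg]
      refine Finset.sum_congr rfl fun j _ ↦ ?_
      rw [dif_pos j.2]
      exact (Algebra.smul_def _ _).symm) i i.2
    rwa [dif_pos i.2] at h1
  · intro x _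
    obtain ⟨a, rfl⟩ := h.exists_sum x
    refine sum_mem fun i hi ↦ ?_
    have : φ (a i) * τ ^ i = a i • τ ^ i := (Algebra.smul_def _ _).symm
    rw [this]
    exact Submodule.smul_mem _ _ (Submodule.subset_span ⟨⟨i, Finset.mem_range.mp hi⟩, rfl⟩)

lemma IsPowerBasis.flat (h : IsPowerBasis φ m τ) : φ.Flat := by
  let _ := φ.toAlgebra
  obtain ⟨b⟩ := h.exists_basis
  have := Module.Free.of_basis b
  exact (inferInstance : Module.Flat A C)

lemma IsPowerBasis.finitePresentation (h : IsPowerBasis φ m τ) : φ.FinitePresentation := by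
  let _ := φ.toAlgebra
  obtain ⟨b⟩ := h.exists_basis
  have := Module.Free.of_basis b
  have := Module.Finite.of_basis b
  have := Module.finitePresentation_of_projective A C
  exact (inferInstance : Algebra.FinitePresentation A C)

lemma IsPowerBasis.comap_surjective [NeZero m] (h : IsPowerBasis φ m τ) :
    Function.Surjective (PrimeSpectrum.comap φ) := by
  let _ := φ.toAlgebra
  obtain ⟨b⟩ := h.exists_basis
  have := Module.Free.of_basis b
  rcases subsingleton_or_nontrivial A with hA | hA
  · intro x
    exact (x.2.ne_top (Subsingleton.elim _ _)).elim
  have : Nontrivial C := by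
    refine ⟨φ 1, φ 0, fun h1 ↦ one_ne_zero (α := A) ?_⟩
    refine h.eq_zero (fun _ ↦ 1) ?_ 0 (NeZero.pos m)
    simp only [h1, map_zero, zero_mul, Finset.sum_const_zero]
  exact PrimeSpectrum.comap_surjective_of_faithfullyFlat (A := A) (B := C)

end Free

/-- A morphism of schemes all of whose points of the target have affine neighbourhoods over which
it is given by an algebra with a power basis. -/
lemma flat_surjective_locallyOfFinitePresentation_of_isPowerBasis {X Z : Scheme.{u}} {p : Z ⟶ X}
    [IsAffineHom p] {m : ℕ} [NeZero m] (H : ∀ x : X, ∃ U : X.Opens, IsAffineOpen U ∧ x ∈ U ∧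
      ∃ τ, IsPowerBasis (p.app U).hom m τ) :
    Flat p ∧ Surjective p ∧ LocallyOfFinitePresentation p := by
  refine ⟨?_, ?_, ?_⟩
  · refine (HasRingHomProperty.iff_exists_appLE (P := @Flat)
      (RingHom.Flat.stableUnderComposition.stableUnderCompositionWithLocalizationAway
        RingHom.Flat.holdsForLocalizationAway).1).mpr fun z ↦ ?_
    obtain ⟨U, hU, hx, τ, h⟩ := H (p z)
    refine ⟨⟨U, hU⟩, ⟨_, hU.preimage p⟩, hx, le_rfl, ?_⟩
    rw [← Scheme.Hom.app_eq_appLE]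
    exact h.flat
  · refine ⟨fun x ↦ ?_⟩
    obtain ⟨U, hU, hx, τ, h⟩ := H x
    obtain ⟨y, rfl⟩ : x ∈ Set.range hU.fromSpec := by rwa [hU.range_fromSpec]
    obtain ⟨z, rfl⟩ := h.comap_surjective y
    refine ⟨(hU.preimage p).fromSpec z, ?_⟩
    have h1 := hU.SpecMap_appLE_fromSpec p (hU.preimage p) le_rfl
    rw [← Scheme.Hom.app_eq_appLE] at h1
    exact congr($h1 z).symm
  · refine (HasRingHomProperty.iff_exists_appLE (P := @LocallyOfFinitePresentation)
      (RingHom.finitePresentation_stableUnderComposition.stableUnderCompositionWithLocalizationAway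
        RingHom.finitePresentation_holdsForLocalizationAway).1).mpr fun z ↦ ?_
    obtain ⟨U, hU, hx, τ, h⟩ := H (p z)
    refine ⟨⟨U, hU⟩, ⟨_, hU.preimage p⟩, hx, le_rfl, ?_⟩
    rw [← Scheme.Hom.app_eq_appLE]
    exact h.finitePresentation

end

/-! ### Local structure of an integral model: power basis and shear map. -/

section

open MonoidalCategory CartesianMonoidalCategory

lemma IsPowerBasis.exists_sum_of_isPushout {A B C D : CommRingCat.{u}} {f : A ⟶ B} {g : A ⟶ C}
    {inl : B ⟶ D} {inr : C ⟶ D} {m : ℕ} {τ : B} (h : IsPowerBasis f.hom m τ)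
    (H : IsPushout f g inl inr) (x : D) :
    ∃ d : ℕ → C, x = ∑ i ∈ Finset.range m, inl τ ^ i * inr (d i) := by
  obtain ⟨n, b, c, rfl⟩ := CommRingCat.exists_sum_of_isPushout H x
  choose a ha using fun k ↦ h.exists_sum (b k)
  refine ⟨fun i ↦ ∑ k, g (a k i) * c k, ?_⟩
  simp only [map_sum, Finset.mul_sum]
  rw [Finset.sum_comm]
  refine Finset.sum_congr rfl fun k _ ↦ ?_
  conv_lhs => rw [ha k, map_sum, Finset.sum_mul]
  refine Finset.sum_congr rfl fun i _ ↦ ?_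
  have h1 : inl (f (a k i)) = inr (g (a k i)) := congr($(H.w) (a k i))
  rw [map_mul, map_pow, map_mul, ← h1]
  change inl (f (a k i)) * _ * _ = _
  ring

variable {R : Type u} [CommRing R] [IsDomain R]
  {K : Type u} [Field K] [Algebra R K] [IsFractionRing R K]
  [CharZero K] {X : Scheme.{u}} {s : X ⟶ Spec (.of R)} {m : ℕ} [NeZero m] {ζ : R}
  {hζ : IsPrimitiveRoot ζ m}
  {Y : ConstTorsor (Multiplicative (ZMod m)) (baseChange s K)}

namespace IsIntegralModel

variable {Z : Scheme.{u}} {p : Z ⟶ X} {q : Y.total ⟶ Z} {e : q ≫ p = totalHom Y}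
  (h : IsIntegralModel hζ e)

omit [IsFractionRing R K] [CharZero K] [IsDomain R] in
lemma overApp_app_apply (e : q ≫ p = totalHom Y) {U : X.Opens} (a : Γ(X, U)) :
    overApp e U (p.app U a) = (totalHom Y).app U a := congr($(overApp_app e U) a)

include h in
/-- An integral model has a power basis where the torsor has a unit of degree one
whose `m`-th power is a unit of the base. -/
lemma exists_isPowerBasis [IsDiscreteValuationRing R] [Flat s] (hX : IsNormalScheme X)
    [IsIntegral (baseChange s K)] {U : X.Opens} (hU : IsAffineOpen U)
    {t : Γ(Y.total, totalHom Y ⁻¹ᵁ U)} {u : (Γ(X, U))ˣ} (ht : (totalAction hζ Y U).Homog 1 t)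
    (htu : t ^ m = (totalHom Y).app U u) :
    ∃ τ, (totalAction hζ Y U).Homog 1 (overApp e U τ) ∧ IsUnit τ ∧
      IsPowerBasis (p.app U).hom m τ := by
  have hti : ((totalHom Y).app U).hom.IsIntegralElem t :=
    isIntegralElem_of_pow _ (NeZero.ne m) (htu ▸ RingHom.isIntegralElem_map _)
  obtain ⟨τ, rfl⟩ := (h.exists_iff hU t).mpr (ht.mem_integralSubring _ _ hti)
  have hτ : τ ^ m = p.app U u := h.injective hU (by rw [map_pow, htu, overApp_app_apply])
  have hτu : IsUnit τ := (isUnit_pow_iff (NeZero.ne m)).mp (hτ ▸ u.isUnit.map _)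
  have hhom (a : Γ(X, U)) : (totalAction hζ Y U).Homog 0 ((totalHom Y).app U a) :=
    CyclicAction.homog_zero_iff.mpr (totalAction_σ_app hζ Y U a)
  -- The inverse is `τ^(m-1) u⁻¹`, of degree `m - 1`, and it is integral because `u` is a unit on
  -- the base.
  obtain ⟨τ', hττ', hτ'h, hτ'i⟩ : ∃ τ', τ * τ' = 1 ∧
      (totalAction hζ Y U).Homog (m - 1) (overApp e U τ') ∧
      ((totalHom Y).app U).hom.IsIntegralElem (overApp e U τ') := by
    have h1 : overApp e U (τ ^ (m - 1) * p.app U ↑u⁻¹) =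
      overApp e U τ ^ (m - 1) * (totalHom Y).app U ↑u⁻¹ := by
      rw [map_mul, map_pow, overApp_app_apply]
    refine ⟨τ ^ (m - 1) * p.app U ↑u⁻¹, ?_, ?_, ?_⟩
    · rw [← mul_assoc, ← pow_succ', Nat.sub_add_cancel NeZero.one_le, hτ, ← map_mul, u.mul_inv,
        map_one]
    · rw [h1]
      simpa using (ht.pow (m - 1)).mul (hhom ↑u⁻¹)
    · rw [h1]
      let _ := ((totalHom Y).app U).hom.toAlgebra
      exact RingHom.IsIntegralElem.mul _ (IsIntegral.pow hti (m - 1)) (RingHom.isIntegralElem_map _)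
  refine ⟨τ, ht, hτu, fun x ↦ ?_, fun a ha i hi ↦ ?_⟩
  · have h1 (i : ℕ) : ∃ a, (totalHom Y).app U a = overApp e U (h.component hU i x * τ' ^ i) := by
      rw [map_mul, map_pow]
      refine exists_totalHom_app_eq hζ Y hX hU ?_ ?_
      · refine ((h.homog_component hU i x).mul (hτ'h.pow i)).congr ?_
        have h2 : i + (m - 1) * i = m * i := by
          obtain ⟨k, hk⟩ := Nat.exists_eq_add_of_le' (NeZero.one_le (n := m))
          rw [hk, Nat.add_sub_cancel]
          ring
        rw [h2]
        simp [Nat.ModEq]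
      · let _ := ((totalHom Y).app U).hom.toAlgebra
        refine RingHom.IsIntegralElem.mul _ ?_ (IsIntegral.pow hτ'i i)
        rw [h.overApp_component]
        exact (h.exists_iff hU _).mp ⟨x, rfl⟩ i
    choose a ha using h1
    refine ⟨a, ?_⟩
    conv_lhs => rw [← h.sum_component hU x]
    refine Finset.sum_congr rfl fun i _ ↦ ?_
    have h2 : p.app U (a i) = h.component hU i x * τ' ^ i :=
      h.injective hU (by rw [overApp_app_apply, ha])
    refine Eq.trans ?_ (congrArg (· * τ ^ i) h2.symm)
    rw [mul_assoc, ← mul_pow, mul_comm τ', hττ', one_pow, mul_one]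
  -- Independence: the degree-`i` part of the relation is `aᵢ τ^i`, and `τ` is a unit.
  · have h1 := congr((totalAction hζ Y U).proj i (overApp e U $ha))
    rw [map_zero, CyclicAction.proj_zero, map_sum] at h1
    have h2 (j : ℕ) : overApp e U ((p.app U).hom (a j) * τ ^ j) =
        (totalHom Y).app U (a j) * overApp e U τ ^ j := by
      rw [map_mul, map_pow]
      exact congrArg (· * _) (overApp_app_apply e (a j))
    simp only [h2] at h1
    rw [CyclicAction.proj_eq_of_sum (fun j ↦ (totalHom Y).app U (a j) * overApp e U τ ^ j)
      (fun j ↦ by simpa using (hhom (a j)).mul (ht.pow j)) hi] at h1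
    refine totalHom_app_injective Y hU ?_
    rw [map_zero]
    exact (IsUnit.mul_left_eq_zero ((hτu.map (overApp e U).hom).pow i)).mp h1

variable [IsAffineHom p]

lemma coaction_of_homog {U : X.Opens} (hU : IsAffineOpen U) {τ : Γ(Z, p ⁻¹ᵁ U)}
    (hτ : (totalAction hζ Y U).Homog 1 (overApp e U τ)) :
    h.coaction hU τ = muProdCoord s m p U * muSndApp s m p U τ := by
  -- For `m = 1` the only degree is zero, so the index of degree one is `1 % m`.
  have hm := Nat.mod_lt 1 (NeZero.pos m)
  have h1 : (totalAction hζ Y U).Homog (1 % m) (overApp e U τ) :=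
    hτ.congr (Nat.mod_modEq 1 m).symm
  refine (Finset.sum_eq_single_of_mem (1 % m) (Finset.mem_range.mpr hm) fun j hj hj' ↦ ?_).trans ?_
  · rw [h.component_of_homog hU h1 hm (Finset.mem_range.mp hj), if_neg hj', map_zero, mul_zero]
  · rw [h.component_of_homog hU h1 hm hm, if_pos rfl, ← pow_eq_pow_mod 1 (coord_pow_card _ _),
      pow_one]

include h in
-- Functions on `Z ×_X Z` are combinations of `τ^i` with coefficients from the second factor, and
-- the shear sends `τ^i ⊗ d` to `T^i τ^i d`. As `τ` is a unit and the `T^i` are independent, this is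
-- bijective.
lemma bijective_shear {U : X.Opens} (hU : IsAffineOpen U) {τ : Γ(Z, p ⁻¹ᵁ U)}
    (hτ : (totalAction hζ Y U).Homog 1 (overApp e U τ)) (hτu : IsUnit τ)
    (hb : IsPowerBasis (p.app U).hom m τ) :
    Function.Bijective (overApp (lift_comp_fst_comp h.act_left_comp
      (b := muProdSnd s m p) rfl) U) := by
  obtain ⟨τ', hτ'⟩ := hτu.exists_right_inv
  have key (d : ℕ → Γ(Z, p ⁻¹ᵁ U)) :
      overApp (lift_comp_fst_comp h.act_left_comp (b := muProdSnd s m p) rfl) U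
        (∑ i ∈ Finset.range m, overApp (h := pullback.fst p p) rfl U τ ^ i *
          overApp (h := pullback.snd p p) pullback.condition.symm U (d i)) =
      ∑ i ∈ Finset.range m, muProdCoord s m p U ^ i * muSndApp s m p U (τ ^ i * d i) := by
    rw [map_sum]
    refine Finset.sum_congr rfl fun i _ ↦ ?_
    rw [map_mul, map_pow, overApp_lift_fst h.act_left_comp rfl,
      overApp_lift_snd h.act_left_comp rfl, map_mul, map_pow, ← mul_assoc,
      ← mul_pow, ← h.coaction_of_homog hU hτ]
    congr 2
    exact h.overApp_action hU τ
  refine ⟨(injective_iff_map_eq_zero _).mpr fun x hx ↦ ?_, fun y ↦ ?_⟩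
  · obtain ⟨d, rfl⟩ := hb.exists_sum_of_isPushout (isPushout_overApp p p hU) x
    rw [key] at hx
    refine Finset.sum_eq_zero fun i hi ↦ ?_
    have h1 := eq_of_sum_muProdCoord_eq (s := s) hζ
      (eq_zero_of_card_mul_of_injective hζ e (h.injective hU)) (z := fun _ ↦ 0)
      (hx.trans (Finset.sum_eq_zero fun i _ ↦ by rw [map_zero, mul_zero]).symm)
      (Finset.mem_range.mp hi)
    rw [(hτu.pow i).mul_right_eq_zero.mp h1, map_zero, mul_zero]
  · obtain ⟨y, rfl⟩ := exists_sum_muProdCoord hU y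
    refine ⟨_, (key fun i ↦ τ' ^ i * y i).trans (Finset.sum_congr rfl fun i _ ↦ ?_)⟩
    rw [← mul_assoc, ← mul_pow, hτ', one_pow, one_mul]

end IsIntegralModel

end

/-! ### The generic fibre of an integral model, and its structure as an extension. -/

section

open MonoidalCategory CartesianMonoidalCategory

variable {R : Type u} [CommRing R] [IsDomain R]
  {K : Type u} [Field K] [Algebra R K] [IsFractionRing R K]
  [CharZero K] {X : Scheme.{u}} {s : X ⟶ Spec (.of R)} {m : ℕ} [NeZero m] {ζ : R}
  {hζ : IsPrimitiveRoot ζ m}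
  {Y : ConstTorsor (Multiplicative (ZMod m)) (baseChange s K)}

namespace IsIntegralModel

variable {Z : Scheme.{u}} {p : Z ⟶ X} {q : Y.total ⟶ Z} {e : q ≫ p = totalHom Y}
  (h : IsIntegralModel hζ e) [IsAffineHom p] [IsDiscreteValuationRing R]

/-- Functions on a base change to the generic fibre are fractions with denominators a power
of the uniformizer. -/
lemma exists_mul_eq_overApp_fst {ϖ : R} (hϖ : Irreducible ϖ) {U : X.Opens}
    (hU : IsAffineOpen U) (w : Γ(pullback p (baseChangeFst s K),
      (pullback.fst p (baseChangeFst s K) ≫ p) ⁻¹ᵁ U)) :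
    ∃ n c, overApp (h := pullback.snd p (baseChangeFst s K)) pullback.condition.symm U
      ((baseChangeFst s K).app U (secOf s U ϖ)) ^ n * w =
        overApp (h := pullback.fst p (baseChangeFst s K)) rfl U c := by
  have H := isPushout_overApp p (baseChangeFst s K) hU
  obtain ⟨l, b, y, rfl⟩ := CommRingCat.exists_sum_of_isPushout H w
  choose n a ha using fun i ↦ exists_secOf_mul_eq s hϖ hU (y i)
  refine ⟨∑ i, n i, ∑ i, b i * p.app U (secOf s U ϖ ^ (∑ j, n j - n i) * a i), ?_⟩
  rw [Finset.mul_sum, map_sum]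
  refine Finset.sum_congr rfl fun i _ ↦ ?_
  have hn : n i ≤ ∑ j, n j := Finset.single_le_sum (fun _ _ ↦ Nat.zero_le _) (Finset.mem_univ i)
  have h1 (c) : overApp (h := pullback.fst p (baseChangeFst s K)) rfl U (p.app U c) =
      overApp (h := pullback.snd p (baseChangeFst s K)) pullback.condition.symm U
        ((baseChangeFst s K).app U c) := congr($(H.w) c)
  rw [map_mul, h1, map_mul, ← ha, map_mul, map_mul, map_pow, map_pow, map_pow, map_pow,
    mul_left_comm]
  conv_lhs => rw [← Nat.sub_add_cancel hn, pow_add]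
  ring

include h in
-- The `m`-th power of the component is a function on `U_K`, which extends to `U` after
-- multiplication by a power of `ϖ`. The component times such a power is then integral and
-- homogeneous, so it is a function on `Z`.
lemma exists_mul_proj_eq {ϖ : R} (hϖ : Irreducible ϖ) {U : X.Opens} (hU : IsAffineOpen U)
    (b : Γ(Y.total, totalHom Y ⁻¹ᵁ U)) (i : ℕ) :
    ∃ n c, (totalHom Y).app U (secOf s U ϖ) ^ n * (totalAction hζ Y U).proj i b =
      overApp e U c := by
  set b' := (totalAction hζ Y U).proj i b with hb'
  have hb : (totalAction hζ Y U).Homog i b' := CyclicAction.homog_proj _ _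
  obtain ⟨y, hy⟩ := ConstTorsor.exists_app_eq_of_homog hb.pow_card
  obtain ⟨n, a, ha⟩ := exists_secOf_mul_eq s hϖ hU y
  have hhom (a : Γ(X, U)) : (totalAction hζ Y U).Homog 0 ((totalHom Y).app U a) :=
    CyclicAction.homog_zero_iff.mpr (totalAction_σ_app hζ Y U a)
  have h1 : ((totalHom Y).app U (secOf s U ϖ) ^ n * b') ^ m =
      (totalHom Y).app U (secOf s U ϖ ^ (n * (m - 1)) * a) := by
    have h2 : (totalHom Y).app U a = (totalHom Y).app U (secOf s U ϖ) ^ n * b' ^ m := by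
      refine (congrArg (Y.proj.app _) ha.symm).trans ((map_mul _ _ _).trans ?_)
      refine congrArg₂ (fun a b : Γ(Y.total, totalHom Y ⁻¹ᵁ U) ↦ a * b) ?_ hy
      exact map_pow ((totalHom Y).app U).hom (secOf s U ϖ) n
    obtain ⟨k, hk⟩ := Nat.exists_eq_add_of_le' (NeZero.one_le (n := m))
    have h3 : n * m = n * (m - 1) + n := by
      rw [hk, Nat.add_sub_cancel]
      ring
    rw [map_mul, map_pow, h2, mul_pow, ← pow_mul, h3, pow_add, mul_assoc]
  have h2 : (totalAction hζ Y U).Homog i ((totalHom Y).app U (secOf s U ϖ) ^ n * b') := by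
    simpa using ((hhom (secOf s U ϖ)).pow n).mul hb
  obtain ⟨c, hc⟩ := (h.exists_iff hU _).mpr (h2.mem_integralSubring _ (totalAction_σ_app hζ Y U)
    (isIntegralElem_of_pow _ (NeZero.ne m) (h1 ▸ RingHom.isIntegralElem_map _)))
  exact ⟨n, c, hc.symm⟩

include h in
/-- The generic fibre of an integral model is the torsor. -/
lemma isPullback : IsPullback q Y.proj p (baseChangeFst s K) := by
  let j := baseChangeFst s K
  have hw : q ≫ p = Y.proj ≫ j := e
  have : IsAffineHom (pullback.fst p j) :=
    isAffineHom_isStableUnderBaseChange.of_isPullback (IsPullback.of_hasPullback _ _).flip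
      (inferInstanceAs (IsAffineHom j))
  obtain ⟨ϖ, hϖ⟩ := IsDiscreteValuationRing.exists_irreducible R
  have hiso : IsIso (pullback.lift q Y.proj hw) := by
    refine isIso_of_bijective_overApp (p := pullback.fst p j ≫ p) (g := totalHom Y)
      (lift_comp_fst_comp e rfl) fun x ↦ ?_
    obtain ⟨U, hU, hx, -⟩ := Opens.isBasis_iff_nbhd.mp X.isBasis_affineOpens
      (Opens.mem_top x)
    refine ⟨U, hU, hx, ?_⟩
    let L := overApp (lift_comp_fst_comp (p := p) (p' := j) e rfl) U
    let F := overApp (h := pullback.fst p j) (p := p) rfl U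
    let S := overApp (h := pullback.snd p j) (p := j) pullback.condition.symm U
    have hLF (c) : L (F c) = overApp e U c := overApp_lift_fst e rfl U c
    have hLS (y) : L (S (j.app U y)) = (totalHom Y).app U y :=
      (overApp_lift_snd e rfl U _).trans congr($(overApp_app (h := Y.proj) (p := j) rfl U) y)
    have hu : IsUnit (S (j.app U (secOf s U ϖ))) := (isUnit_app_secOf s hϖ U).map S.hom
    refine ⟨(injective_iff_map_eq_zero L.hom).mpr fun w hw ↦ ?_, fun b ↦ ?_⟩
    · obtain ⟨n, c, hc⟩ := exists_mul_eq_overApp_fst (K := K) (s := s) (p := p) hϖ hU w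
      have h1 : overApp e U c = 0 := by
        rw [← hLF]
        refine (congrArg L hc.symm).trans ((map_mul L.hom _ _).trans ?_)
        rw [hw, mul_zero]
      have h2 : c = 0 := h.injective hU (h1.trans (map_zero _).symm)
      rw [h2, map_zero] at hc
      exact (hu.pow n).mul_right_eq_zero.mp hc
    · obtain ⟨v, hv⟩ := hu.exists_left_inv
      -- Each component is a function on `Z` up to a power of `ϖ`, which is invertible on the fibre
      -- product.
      have h1 (i : ℕ) : ∃ w, L w = (totalAction hζ Y U).proj i b := by
        obtain ⟨n, c, hc⟩ := h.exists_mul_proj_eq hϖ hU b i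
        refine ⟨v ^ n * F c, ?_⟩
        rw [map_mul, hLF, ← hc, ← hLS, ← map_pow, ← mul_assoc, ← map_mul, ← mul_pow, hv, one_pow,
          map_one, one_mul]
      choose w hw using h1
      refine ⟨∑ i ∈ Finset.range m, w i, (map_sum L.hom _ _).trans ?_⟩
      exact (Finset.sum_congr rfl fun i _ ↦ hw i).trans (CyclicAction.sum_proj b)
  exact IsPullback.of_iso_pullback ⟨hw⟩ (asIso (pullback.lift q Y.proj hw))
    (pullback.lift_fst _ _ _) (pullback.lift_snd _ _ _)

include h in
/-- An integral model which locally has a power basis generated by a unit of degree one is an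
extension of the torsor. -/
lemma exists_isExtension (H : ∀ x : X, ∃ (U : X.Opens) (_ : IsAffineOpen U) (_ : x ∈ U)
    (τ : Γ(Z, p ⁻¹ᵁ U)), (totalAction hζ Y U).Homog 1 (overApp e U τ) ∧ IsUnit τ ∧
      IsPowerBasis (p.app U).hom m τ) :
    ∃ (T : Torsor (muGrp m R) s) (q' : Y.total ⟶ T.total),
      IsExtension hζ.toRootsOfUnity Y T q' := by
  obtain ⟨hflat, hsurj, hfp⟩ := flat_surjective_locallyOfFinitePresentation_of_isPowerBasis
    (p := p) (m := m) fun x ↦ by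
      obtain ⟨U, hU, hx, τ, -, -, hb⟩ := H x
      exact ⟨U, hU, hx, τ, hb⟩
  have : IsAffineHom (pullback.fst p p) :=
    isAffineHom_isStableUnderBaseChange.of_isPullback (IsPullback.of_hasPullback _ _).flip
      (inferInstanceAs (IsAffineHom p))
  let T : Torsor (muGrp m R) s :=
  { total := Z
    proj := p
    affine := inferInstance
    flat := hflat
    surjective := hsurj
    finPres := hfp
    act := h.act
    one_act := h.one_act
    mul_act := h.mul_act
    act_proj := h.act_left_comp
    isIso_shear := by
      refine isIso_of_bijective_overApp (p := pullback.fst p p ≫ p) (g := muProdHom s m p)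
        (lift_comp_fst_comp h.act_left_comp rfl) fun x ↦ ?_
      obtain ⟨U, hU, hx, τ, hτ, hτu, hb⟩ := H x
      exact ⟨U, hU, hx, h.bijective_shear hU hτ hτu hb⟩ }
  refine ⟨T, q, h.isPullback, ?_⟩
  have h1 : (Y.act (Multiplicative.ofAdd 1)).hom.left ≫ totalHom Y = totalHom Y := by
    rw [← Category.assoc, Y.act_comp_proj]
  have h2 : T.translate (muSection hζ.toRootsOfUnity) ≫ p = p := T.translate_proj _
  have hl : ((Y.act (Multiplicative.ofAdd 1)).hom.left ≫ q) ≫ p = totalHom Y := by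
    rw [Category.assoc, e, h1]
  have hr : (q ≫ T.translate (muSection hζ.toRootsOfUnity)) ≫ p = totalHom Y := by
    rw [Category.assoc, h2, e]
  refine hom_ext_of_overApp hl hr fun U hU ↦ CommRingCat.hom_ext (RingHom.ext fun x ↦ ?_)
  refine (congr($(overApp_comp e h1 U) x)).trans (Eq.trans ?_ congr($(overApp_comp h2 e U) x).symm)
  -- Translation by `ζ` is the action evaluated at `ζ`, which on the generic torsor is `σ`.
  have h3 := h.evalTotal_coaction hU 1 x
  refine h3.symm.trans (congrArg (overApp e U) ?_)
  rw [← h.overApp_action hU]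
  have h4 := overApp_comp h.action_comp (muEval_comp (s := s) (p := p) (hζ.toRootsOfUnity ^ 1)) U
  refine congr($h4 x).symm.trans ?_
  refine congr($(appLE_congr_hom ?_ _ _) x)
  rw [pow_one]
  rfl

end IsIntegralModel

end

/-! ### The integral model given by the relative spectrum. -/

section

variable {R : Type u} [CommRing R] [IsDomain R] [IsDiscreteValuationRing R]
  {K : Type u} [Field K] [Algebra R K] [IsFractionRing R K]
  [CharZero K] {X : Scheme.{u}} {s : X ⟶ Spec (.of R)} {m : ℕ} [NeZero m] {ζ : R}
  (hζ : IsPrimitiveRoot ζ m)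
  (Y : ConstTorsor (Multiplicative (ZMod m)) (baseChange s K))

/-- The relative spectrum of the algebra of integral sections is an integral model. -/
lemma isIntegralModel_spec [Flat s] (hX : IsNormalScheme X) [IsIntegral (baseChange s K)] :
    IsIntegralModel hζ (integralAlgebra hζ Y hX).fromTotal_toBase where
  injective hU := (integralAlgebra hζ Y hX).overApp_fromTotal_injective hU
  exists_iff hU b := (integralAlgebra hζ Y hX).mem_range_overApp_fromTotal hU b

end

end TorsorExt

end

theorem mainTheorem5
    {R : Type u} [CommRing R] [IsDomain R] [IsDiscreteValuationRing R]
    {K : Type u} [Field K] [Algebra R K] [IsFractionRing R K] [CharZero K]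
    (p : ℕ) [Fact p.Prime] [CharP (IsLocalRing.ResidueField R) p]
    (X : Scheme.{u}) [IsNoetherian X] (s : X ⟶ Spec (.of R)) [Flat s] [Surjective s]
    (hX : TorsorExt.IsNormalScheme X)
    [IsIntegral (TorsorExt.baseChange s K)]
    [IsIntegral (TorsorExt.baseChange s (IsLocalRing.ResidueField R))]
    (m : ℕ) [NeZero m]
    (hPic : Set.BijOn (TorsorExt.pullbackClass (TorsorExt.baseChangeFst s K))
      (TorsorExt.picTorsion m X) (TorsorExt.picTorsion m (TorsorExt.baseChange s K)))
    (ζ : R) (hζ : IsPrimitiveRoot ζ m)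
    (Y : TorsorExt.ConstTorsor (Multiplicative (ZMod m)) (TorsorExt.baseChange s K))
    [ConnectedSpace Y.total]
    (hY : IsReduced
      (TorsorExt.baseChange (TorsorExt.normalizationHom Y) (IsLocalRing.ResidueField R))) :
    ∃ (Y' : TorsorExt.Torsor (TorsorExt.muGrp m R) s) (q : Y.total ⟶ Y'.total),
      TorsorExt.IsExtension hζ.toRootsOfUnity Y Y' q ∧
      ∀ (Y'' : TorsorExt.Torsor (TorsorExt.muGrp m R) s) (q' : Y.total ⟶ Y''.total),
        TorsorExt.IsExtension hζ.toRootsOfUnity Y Y'' q' →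
        ∃! e : Y'.total ≅ Y''.total,
          TorsorExt.IsTorsorHom Y' Y'' e.hom ∧ q ≫ e.hom = q' := by
  have h := TorsorExt.isIntegralModel_spec hζ Y hX
  obtain ⟨T, q, H⟩ := h.exists_isExtension fun x ↦ by
    obtain ⟨U, hU, hx, t, u, ht, htu⟩ :=
      TorsorExt.exists_homog_pow_eq hζ Y hX hPic.surjOn hY x
    obtain ⟨τ, hτ⟩ := h.exists_isPowerBasis hX hU ht htu
    exact ⟨U, hU, hx, τ, hτ⟩
  refine ⟨T, q, H, fun T' q' H' ↦ ?_⟩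
  have hT := H.isIntegralModel hX
  obtain ⟨g, hg, hgq⟩ := hT.exists_iso (H'.isIntegralModel hX)
  refine ⟨g, ⟨H.isTorsorHom H' hg hgq, hgq⟩, fun g' ⟨⟨hg', _⟩, hgq'⟩ ↦ Iso.ext ?_⟩
  exact hT.hom_ext hg' hg (hgq'.trans hgq.symm)
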